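/- Let $T^*\mathbb R^2$ have coordinates $(q,p)$, symplectic form $dq_1\wedge dp_1+dq_2\wedge dp_2$ and projection $\pi(q,p)=q$. Let $S(T^*\mathbb R^2,0)$ be the set of symplectic diffeomorphism germs on $(T^*\mathbb R^2,0)$, and let $S^l(2)$ be the smooth manifold of $l$-jets $j^lS(0)$ of its elements. For $\sigma\subset I=\{1,2\}$ let $$L_\sigma^0=\{(q,p)\in(T^*\mathbb R^2,0)\mid q_\sigma=0,\ p_{I-\sigma}=0,\ q_{I-\sigma}\ge 0\},$$ and let $\mathbb L$ be the union of the $L^0_\sigma$. Let $F(x,q)$ be a smooth function germ at $0\in\mathbb R^2\times\mathbb R^2$ with $F(0)=0$, $dF(0)=0$, for which $x_1,x_2,\partial F/\partial x_1,\partial F/\partial x_2$ are independent at $0$. It is a generating family of the reticular Lagrangian map $\pi\circ S|_{\mathbb L}$, $S\in S(T^*\mathbb R^2,0)$, if for every $\sigma\subset I$, as germs at $0$, $$S(L_\sigma^0)=\Big\{\Big(q,\frac{\partial F}{\partial q}(x,q)\Big)\ \Big|\ x_\sigma=0,\ x_{I-\sigma}\ge0,\ \frac{\partial F}{\partial x_{I-\sigma}}(x,q)=0\Big\};$$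 $S$ is then called an extension of the reticular Lagrangian embedding defined by $F$. The Lagrangian equivalence class $[S]_L$ of $S\in S(T^*\mathbb R^2,0)$ is the set of all $S'\in S(T^*\mathbb R^2,0)$ with $\Theta\circ S=S'\circ\varphi$ for some $\Theta,\varphi\in S(T^*\mathbb R^2,0)$ such that $\pi\circ\Theta=g\circ\pi$ for a diffeomorphism germ $g$ on $(\mathbb R^2,0)$, and $\varphi(L^0_\sigma)=L^0_\sigma$ for all $\sigma\subset I$. If $S$ is an extension of the reticular Lagrangian embedding defined by $F$, the caustic-equivalence class of $S$ is $[S]_c=[S]_L\cup[S^-]_L$, where $S^-$ is an extension of the reticular Lagrangian embedding defined by $-F$ (this does not depend on the choice of $F$ and $S^-$). Let $[j^lS(0)]_c$ be the set of $l$-jets at $0$ of the elements of $[S]_c$. **Proposition.** For each $a>\frac14$ let $\pi\circ i_a$ be the reticular Lagrangian map with generating family $x_1^2+x_1x_2+ax_2^2+q_1x_1+q_2x_2$, and let $S_a\in S(T^*\mathbb R^2,0)$ be any extension of $i_a$. Then for every $l\ge1$ the weak caustic-equivalence class $$[j^lS_1(0)]_w:=\bigcup_{a>\frac14}[j^lS_a(0)]_c$$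 is an immersed manifold in $S^l(2)$, that is, the image of an injective smooth immersion into $S^l(2)$ of a second countable Hausdorff smooth manifold of constant dimension. -/

import Mathlib

open Filter Topology
open scoped Manifold ContDiff

namespace RetLag

/-! Reticular Lagrangian maps over a `2`-dimensional base with an `r = 2` corner.
Germs at `0` are represented by globally defined functions; every condition below only involves
their values near `0`. -/

/-- The plane `ℝ²`. -/
abbrev Plane : Type := Fin 2 → ℝ

/-- The cotangent bundle `T*ℝ²` with canonical coordinates `(q, p)`. -/
abbrev Phase : Type := Plane × Plane

/-- The canonical symplectic form `dq₁ ∧ dp₁ + dq₂ ∧ dp₂`. -/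
def omega (u v : Phase) : ℝ := ∑ i, (u.1 i * v.2 i - u.2 i * v.1 i)

/-- `f` represents a smooth map germ `(E, 0) → (E', 0)`. -/
def IsSmoothGerm {E E' : Type*} [NormedAddCommGroup E] [NormedSpace ℝ E]
    [NormedAddCommGroup E'] [NormedSpace ℝ E'] (f : E → E') : Prop :=
  f 0 = 0 ∧ ∀ᶠ z in 𝓝 0, ContDiffAt ℝ ∞ f z

/-- `g` represents a diffeomorphism germ on `(ℝ², 0)`. -/
def IsDiffeoGerm (g : Plane → Plane) : Prop :=
  IsSmoothGerm g ∧ Function.Bijective (fderiv ℝ g 0)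

/-- `S` represents an element of `S(T*ℝ², 0)`, a symplectic diffeomorphism germ on `(T*ℝ², 0)`.
Its derivative at `0` preserves a nondegenerate form, hence is invertible, so that `S` is
a diffeomorphism germ. -/
def IsSympGerm (S : Phase → Phase) : Prop :=
  IsSmoothGerm S ∧
    ∀ᶠ z in 𝓝 0, ∀ u v : Phase, omega (fderiv ℝ S z u) (fderiv ℝ S z v) = omega u v

/-- `L_σ⁰ = {(q, p) | q_σ = 0, p_{I - σ} = 0, q_{I - σ} ≥ 0}` for `σ ⊂ I = {1, 2}`. -/
def cornerL (σ : Set (Fin 2)) : Set Phase :=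
  {z | (∀ i ∈ σ, z.1 i = 0) ∧ ∀ i ∉ σ, z.2 i = 0 ∧ 0 ≤ z.1 i}

/-- Reticular diffeomorphism germs: symplectic diffeomorphism germs `φ` with `φ(L_σ⁰) = L_σ⁰`
for all `σ`. The image under `φ` of the germ at `0` of a set `A` is the filter
`map φ (𝓝[A] 0)`, which is generated by the sets `φ(A ∩ U)`, `U` a neighbourhood of `0`. -/
def IsReticular (φ : Phase → Phase) : Prop :=
  IsSympGerm φ ∧ ∀ σ : Set (Fin 2), map φ (𝓝[cornerL σ] 0) = 𝓝[cornerL σ] 0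

/-- Lagrangian equivalences of `π : T*ℝ² → ℝ²`, `π(q, p) = q`: symplectic diffeomorphism germs `Θ`
on `(T*ℝ², 0)` which cover a diffeomorphism germ `g` of the base, `π ∘ Θ = g ∘ π`. -/
def IsLagrangianEquivalence (Θ : Phase → Phase) : Prop :=
  IsSympGerm Θ ∧ ∃ g : Plane → Plane, IsDiffeoGerm g ∧ ∀ᶠ z in 𝓝 0, (Θ z).1 = g z.1

/-- The Lagrangian equivalence class `[S]_L`: all `S'` in `S(T*ℝ², 0)` such that
`Θ ∘ S = S' ∘ φ` for a Lagrangian equivalence `Θ` and a reticular diffeomorphism germ `φ`. -/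
def lagrangianClass (S : Phase → Phase) : Set (Phase → Phase) :=
  {S' | IsSympGerm S' ∧ ∃ Θ φ : Phase → Phase, IsLagrangianEquivalence Θ ∧ IsReticular φ ∧
    Θ ∘ S =ᶠ[𝓝 0] S' ∘ φ}

/-! ### Generating families `F(x, q)`, written as functions of the pair `(x, q)` -/

/-- `∂F/∂xᵢ`. -/
noncomputable def dX (F : Plane × Plane → ℝ) (i : Fin 2) (z : Plane × Plane) : ℝ :=
  fderiv ℝ F z (Pi.single i 1, 0)

/-- `∂F/∂qᵢ`. -/
noncomputable def dQ (F : Plane × Plane → ℝ) (i : Fin 2) (z : Plane × Plane) : ℝ :=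
  fderiv ℝ F z (0, Pi.single i 1)

/-- `{(x, q) | x_σ = 0, x_{I - σ} ≥ 0, ∂F/∂x_{I - σ} = 0}`. -/
def critSet (F : Plane × Plane → ℝ) (σ : Set (Fin 2)) : Set (Plane × Plane) :=
  {z | (∀ i ∈ σ, z.1 i = 0) ∧ ∀ i ∉ σ, 0 ≤ z.1 i ∧ dX F i z = 0}

/-- `(x, q) ↦ (q, ∂F/∂q(x, q))`. -/
noncomputable def conormal (F : Plane × Plane → ℝ) (z : Plane × Plane) : Phase :=
  (z.2, fun i => dQ F i z)

/-- `F(x, q)` is a generating family of the reticular Lagrangian map `π ∘ S|_𝕃`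
(equivalently, `S` is an extension of the reticular Lagrangian embedding defined by `F`):
* `F` is smooth near `0`, with `F(0) = 0` and `dF(0) = 0`;
* `F` is nondegenerate: `x₁, x₂, ∂F/∂x₁, ∂F/∂x₂` are independent at `0`;
* for every `σ` the restriction of `F` to `x_σ = 0` generates the Lagrangian germ `S(L_σ⁰)`, i.e.
  `S(L_σ⁰) = {(q, ∂F/∂q) | x_σ = 0, x_{I - σ} ≥ 0, ∂F/∂x_{I - σ} = 0}` as germs at `0`. -/
structure IsGeneratingFamily (F : Plane × Plane → ℝ) (S : Phase → Phase) : Prop where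
  smooth : IsSmoothGerm F
  critical : fderiv ℝ F 0 = 0
  nondegenerate : LinearIndependent ℝ
    (Sum.elim (fun i : Fin 2 => fderiv ℝ (fun z : Plane × Plane => z.1 i) 0)
      (fun i : Fin 2 => fderiv ℝ (dX F i) 0))
  generates : ∀ σ : Set (Fin 2),
    map S (𝓝[cornerL σ] 0) = map (conormal F) (𝓝[critSet F σ] 0)

/-- The family `F_a(x, q) = x₁² + x₁x₂ + a x₂² + q₁x₁ + q₂x₂`. -/
def familyB (a : ℝ) (z : Plane × Plane) : ℝ :=
  z.1 0 ^ 2 + z.1 0 * z.1 1 + a * z.1 1 ^ 2 + z.2 0 * z.1 0 + z.2 1 * z.1 1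

/-- The caustic-equivalence class `[S]_c = [S⁺]_L ∪ [S⁻]_L`, where `S⁺ = S` is an extension of the
reticular Lagrangian embedding defined by a generating family `F`, and `S⁻` is an extension
of the one defined by `-F`. -/
def causticClass (S : Phase → Phase) : Set (Phase → Phase) :=
  {S' | S' ∈ lagrangianClass S ∨
    ∃ (F : Plane × Plane → ℝ) (T : Phase → Phase), IsGeneratingFamily F S ∧
      IsSympGerm T ∧ IsGeneratingFamily (-F) T ∧ S' ∈ lagrangianClass T}

/-! ### Jets -/

/-- The finite-dimensional vector space in which `l`-jets at `0` of maps `T*ℝ² → T*ℝ²` live: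
a jet is the tuple of its derivatives of orders `0, …, l` at `0`. -/
abbrev JetSpace (l : ℕ) : Type :=
  (k : Fin (l + 1)) → ContinuousMultilinearMap ℝ (fun _ : Fin (k : ℕ) => Phase) Phase

/-- The `l`-jet `j^l S(0)`. -/
noncomputable def jet (l : ℕ) (S : Phase → Phase) : JetSpace l :=
  fun k => iteratedFDeriv ℝ (k : ℕ) S 0

/-- `S^l(2)`, the `l`-jets at `0` of symplectic diffeomorphism germs on `(T*ℝ², 0)`. -/
def sympJets (l : ℕ) : Set (JetSpace l) := jet l '' {S | IsSympGerm S}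

/-- `[j^l S(0)]_c`, the `l`-jets of the elements of `[S]_c`. -/
def causticJets (l : ℕ) (S : Phase → Phase) : Set (JetSpace l) := jet l '' causticClass S

/-- `[j^l S₁(0)]_w = ⋃_{a > 1/4} [j^l S_a(0)]_c`. -/
def weakCausticJets (l : ℕ) (S : ℝ → Phase → Phase) : Set (JetSpace l) :=
  ⋃ a ∈ Set.Ioi (1 / 4 : ℝ), causticJets l (S a)

/-- `W` is an immersed manifold in `N`, where `N` is a submanifold of the vector space `V`:
`W ⊆ N` is the image of an injective smooth immersion of a second countable Hausdorff smooth
manifold `M` without boundary, of some constant dimension `d`. Since `N` carries the smooth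
structure of a submanifold of `V`, a map with values in `N` is a smooth immersion into `N`
if and only if it is one into `V`. -/
def IsImmersedManifoldIn {V : Type*} [NormedAddCommGroup V] [NormedSpace ℝ V]
    (N W : Set V) : Prop :=
  W ⊆ N ∧ ∃ (d : ℕ) (M : Type) (_ : TopologicalSpace M)
    (_ : ChartedSpace (EuclideanSpace ℝ (Fin d)) M) (_ : IsManifold (𝓡 d) ∞ M)
    (_ : T2Space M) (_ : SecondCountableTopology M) (ι : M → V),
    ContMDiff (𝓡 d) 𝓘(ℝ, V) ∞ ι ∧ Function.Injective ι ∧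
    (∀ x : M, Function.Injective (mfderiv (𝓡 d) 𝓘(ℝ, V) ι x)) ∧
    Set.range ι = W

end RetLag

/-!
A symplectic germ tangent to the identity has a generating function `q · P + K(q, P)`. It is a
Lagrangian equivalence if `K` is affine in `P`, and a reticular diffeomorphism germ if `K` vanishes
on the Lagrangian planes spanned by the `L_σ⁰`. Expanding degree by degree, every element of the
weak class has the same `l`-jet as a composition `Θ ∘ Q ∘ φ`, where `Θ` is a linear Lagrangian map
after a Lagrangian germ with polynomial `K`, `Q` is a linear extension of the embedding of a
quadratic form `½ ⟨x, M x⟩`, and `φ` is a reticular germ with polynomial `K`. The forms `M` that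
occur, the diagonal rescalings of `± (x₁² + x₁x₂ + a x₂²)` with `a > 1/4`, fill an open set.

The parameters of such compositions thus form an open subset of a finite-dimensional vector space.
Their jets determine them, to first order as well: when the diagonal entries of `M` do not vanish,
a homogeneous polynomial which is affine in `P` and whose pullback by `Q` vanishes on the
four planes is zero, so in each degree the two kinds of generating functions contribute
independently to the jet.
-/

namespace RetLag

open Asymptotics

section IteratedFDeriv

variable {E F : Type*} [NormedAddCommGroup E] [NormedSpace ℝ E]
  [NormedAddCommGroup F] [NormedSpace ℝ F]

theorem iteratedFDeriv_comp_swap_zero_one {n : ℕ} {f : E → F} {x : E}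
    (hf : ContDiffAt ℝ (n + 2 : ℕ) f x) (v : Fin (n + 2) → E) :
    iteratedFDeriv ℝ (n + 2) f x (v ∘ Equiv.swap 0 1) = iteratedFDeriv ℝ (n + 2) f x v := by
  have smooth : ContDiffAt ℝ 2 (iteratedFDeriv ℝ n f) x :=
    hf.iteratedFDeriv_right (by norm_cast; lia)
  have smooth_deriv : DifferentiableAt ℝ (fderiv ℝ (iteratedFDeriv ℝ n f)) x :=
    (smooth.fderiv_right (m := 1) le_rfl).differentiableAt one_ne_zero
  have eq_second_deriv (w : Fin (n + 2) → E) : iteratedFDeriv ℝ (n + 2) f x w =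
      fderiv ℝ (fderiv ℝ (iteratedFDeriv ℝ n f)) x (w 0) (w 1) (Fin.tail (Fin.tail w)) := by
    rw [(hf.differentiableAt_iteratedFDeriv (by norm_cast; lia)).iteratedFDeriv_succ_apply_left']
    exact DFunLike.congr_fun ((smooth_deriv.hasFDerivAt.clm_apply
      (hasFDerivAt_const (w 1) x)).continuousMultilinear_apply_const
        (Fin.tail (Fin.tail w))).fderiv (w 0) |>.trans (by simp)
  have tail_eq : Fin.tail (Fin.tail (v ∘ Equiv.swap 0 1)) = Fin.tail (Fin.tail v) := by
    funext i
    exact congrArg v (Equiv.swap_apply_of_ne_of_ne (by simp) (by simp [Fin.ext_iff]))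
  rw [eq_second_deriv, eq_second_deriv, tail_eq,
    (smooth.isSymmSndFDerivAt (by simp)).eq ((v ∘ Equiv.swap 0 1) 0)]
  simp

theorem iteratedFDeriv_comp_swap_succ {n : ℕ} {f : E → F} {x : E}
    (hf : ContDiffAt ℝ (n + 1 : ℕ) f x) {i j : Fin n}
    (h : ∀ᶠ y in 𝓝 x, ∀ w : Fin n → E,
      iteratedFDeriv ℝ n f y (w ∘ Equiv.swap i j) = iteratedFDeriv ℝ n f y w)
    (v : Fin (n + 1) → E) :
    iteratedFDeriv ℝ (n + 1) f x (v ∘ Equiv.swap i.succ j.succ) =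
      iteratedFDeriv ℝ (n + 1) f x v := by
  have diff : DifferentiableAt ℝ (iteratedFDeriv ℝ n f) x :=
    hf.differentiableAt_iteratedFDeriv (by norm_cast; lia)
  have head_eq : (v ∘ Equiv.swap i.succ j.succ) 0 = v 0 :=
    congrArg v (Equiv.swap_apply_of_ne_of_ne (Fin.succ_ne_zero i).symm (Fin.succ_ne_zero j).symm)
  have tail_eq : Fin.tail (v ∘ Equiv.swap i.succ j.succ) = Fin.tail v ∘ Equiv.swap i j := by
    funext k
    simp only [Fin.tail, Function.comp, (Fin.succ_injective _).map_swap]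
  rw [diff.iteratedFDeriv_succ_apply_left', diff.iteratedFDeriv_succ_apply_left', head_eq, tail_eq]
  congr 1
  exact EventuallyEq.fderiv_eq (h.mono fun y hy => hy _)

theorem iteratedFDeriv_comp_swap_castSucc_succ {n : ℕ} {f : E → F} {x : E}
    (hf : ContDiffAt ℝ (n + 1 : ℕ) f x) (i : Fin n) (v : Fin (n + 1) → E) :
    iteratedFDeriv ℝ (n + 1) f x (v ∘ Equiv.swap i.castSucc i.succ) =
      iteratedFDeriv ℝ (n + 1) f x v := by
  induction n generalizing x with
  | zero => exact i.elim0
  | succ n ih =>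
    refine Fin.cases (iteratedFDeriv_comp_swap_zero_one hf v) (fun i => ?_) i
    rw [Fin.castSucc_succ]
    refine iteratedFDeriv_comp_swap_succ hf ?_ v
    filter_upwards [hf.eventually (by simp)] with y hy w using
      ih (hy.of_le (by norm_cast; lia)) i w

theorem iteratedFDeriv_comp_perm {n : ℕ} {f : E → F} {x : E} (hf : ContDiffAt ℝ n f x)
    (σ : Equiv.Perm (Fin n)) (v : Fin n → E) :
    iteratedFDeriv ℝ n f x (v ∘ σ) = iteratedFDeriv ℝ n f x v := by
  rcases n with _ | n
  · exact congrArg _ (Subsingleton.elim _ _)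
  have hσ : σ ∈ Submonoid.closure (Set.range fun i : Fin n => Equiv.swap i.castSucc i.succ) :=
    Equiv.Perm.mclosure_swap_castSucc_succ n ▸ Submonoid.mem_top σ
  induction hσ using Submonoid.closure_induction generalizing v with
  | mem σ h =>
    obtain ⟨i, rfl⟩ := h
    exact iteratedFDeriv_comp_swap_castSucc_succ hf i v
  | one => rfl
  | mul σ τ _ _ hσ hτ => rw [← hσ v, ← hτ (v ∘ σ)]; rfl

theorem iteratedFDeriv_fderiv_eq_zero_iff {f : E → F} {x : E} {n : ℕ} :
    iteratedFDeriv ℝ n (fderiv ℝ f) x = 0 ↔ iteratedFDeriv ℝ (n + 1) f x = 0 := by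
  rw [← norm_eq_zero, norm_iteratedFDeriv_fderiv, norm_eq_zero]

end IteratedFDeriv

section Flat

variable {E F : Type*} [NormedAddCommGroup E] [NormedAddCommGroup F]

theorem isLittleO_norm_pow_of_lt {j k : ℕ} (h : j < k) :
    (fun z : E => ‖z‖ ^ k) =o[𝓝 0] fun z => ‖z‖ ^ j :=
  (isLittleO_pow_pow (𝕜 := ℝ) h).comp_tendsto tendsto_norm_zero

theorem isLittleO_norm_pow_of_le {f : E → F} {j k : ℕ} (hjk : j ≤ k)
    (h : f =o[𝓝 0] fun z => ‖z‖ ^ k) : f =o[𝓝 0] fun z => ‖z‖ ^ j := by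
  rcases hjk.eq_or_lt with rfl | hlt
  exacts [h, h.trans (isLittleO_norm_pow_of_lt hlt)]

theorem apply_zero_of_isLittleO {f : E → F} {k : ℕ} (h : f =o[𝓝 0] fun z => ‖z‖ ^ (k + 1)) :
    f 0 = 0 := by
  simpa using (h.def one_pos).self_of_nhds

variable [NormedSpace ℝ E] [NormedSpace ℝ F]

theorem hasFDerivAt_zero_of_isLittleO {f : E → F} (h : f =o[𝓝 0] fun z => ‖z‖ ^ 1) :
    HasFDerivAt f (0 : E →L[ℝ] F) 0 := by
  have h0 : f 0 = 0 := apply_zero_of_isLittleO (k := 0) h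
  simp only [pow_one] at h
  simpa [hasFDerivAt_iff_isLittleO_nhds_zero, h0] using h.of_norm_right

theorem isLittleO_sub_id_of_hasFDerivAt {f : E → E}
    (h : HasFDerivAt f (ContinuousLinearMap.id ℝ E) 0) (h0 : f 0 = 0) :
    (fun z => f z - z) =o[𝓝 0] fun z => ‖z‖ := by
  simpa [h0] using (hasFDerivAt_iff_isLittleO_nhds_zero.1 h).norm_right

theorem isLittleO_norm_pow_succ_of_fderiv {f : E → F} {k : ℕ} (h0 : f 0 = 0)
    (hd : ∀ᶠ z in 𝓝 0, DifferentiableAt ℝ f z)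
    (h : fderiv ℝ f =o[𝓝 0] fun z => ‖z‖ ^ k) : f =o[𝓝 0] fun z => ‖z‖ ^ (k + 1) := by
  refine isLittleO_iff.2 fun c hc => ?_
  obtain ⟨r, hr, hball⟩ := Metric.eventually_nhds_iff_ball.1 (hd.and (h.def hc))
  filter_upwards [Metric.ball_mem_nhds (0 : E) hr] with y hy
  rw [mem_ball_zero_iff] at hy
  have bound : ∀ z ∈ Metric.closedBall (0 : E) ‖y‖, ‖fderiv ℝ f z‖ ≤ c * ‖y‖ ^ k := fun z hz => by
    rw [mem_closedBall_zero_iff] at hz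
    refine (hball z (by simpa using hz.trans_lt hy)).2.trans ?_
    rw [norm_pow, norm_norm]
    gcongr
  have := (convex_closedBall (0 : E) ‖y‖).norm_image_sub_le_of_norm_fderiv_le
    (fun z hz => (hball z (by simpa using (mem_closedBall_zero_iff.1 hz).trans_lt hy)).1) bound
    (Metric.mem_closedBall_self (norm_nonneg y)) (mem_closedBall_zero_iff.2 le_rfl)
  simpa [h0, pow_succ, mul_assoc] using this

theorem isLittleO_of_iteratedFDeriv_eq_zero {f : E → F} {k : ℕ} (hf : ContDiffAt ℝ k f 0)
    (h : ∀ j ≤ k, iteratedFDeriv ℝ j f 0 = 0) : f =o[𝓝 0] fun z => ‖z‖ ^ k := by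
  have remainder (m : ℕ) : ∀ j, j + m = k →
      iteratedFDeriv ℝ j f =o[𝓝 0] fun z => ‖z‖ ^ m := by
    induction m with
    | zero =>
      intro j hj
      simp only [pow_zero, isLittleO_one_iff, ← h j (by lia)]
      exact (hf.iteratedFDeriv_right (m := 0) (by norm_cast; lia)).continuousAt
    | succ m ih =>
      intro j hj
      refine isLittleO_norm_pow_succ_of_fderiv (h j (by lia)) ?_ ?_
      · filter_upwards [hf.eventually (by simp)] with z hz
        exact hz.differentiableAt_iteratedFDeriv (by norm_cast; lia)
      · refine IsLittleO.of_norm_left ?_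
        simpa only [norm_fderiv_iteratedFDeriv] using (ih (j + 1) (by lia)).norm_left
  refine IsLittleO.of_norm_left ?_
  simpa only [norm_iteratedFDeriv_zero] using (remainder k 0 (zero_add k)).norm_left

end Flat

section PosHomogeneous

variable {E F G : Type*} [NormedAddCommGroup E] [NormedSpace ℝ E]
  [NormedAddCommGroup F] [NormedSpace ℝ F] [NormedAddCommGroup G] [NormedSpace ℝ G]

/-- Homogeneity of degree `k` under positive scalars. For smooth maps this says that `P` is a
homogeneous polynomial map of degree `k`, see `IsPosHomogeneous.eq_diagonal`. -/
def IsPosHomogeneous (k : ℕ) (P : E → F) : Prop := ∀ s : ℝ, 0 < s → ∀ z, P (s • z) = s ^ k • P z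

theorem isPosHomogeneous_diagonal {k : ℕ}
    (c : ContinuousMultilinearMap ℝ (fun _ : Fin k => E) F) :
    IsPosHomogeneous k fun z => c fun _ => z := by
  intro s _ z
  simpa using c.map_smul_univ (fun _ => s) fun _ => z

theorem tendsto_smul_nhdsGT_zero (z : E) :
    Tendsto (fun s : ℝ => s • z) (𝓝[>] 0) (𝓝 0) := by
  have : Continuous fun s : ℝ => s • z := by fun_prop
  exact (this.tendsto' 0 0 (zero_smul ℝ z)).mono_left nhdsWithin_le_nhds

namespace IsPosHomogeneous

variable {k : ℕ} {P Q : E → F}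

theorem apply_zero (hP : IsPosHomogeneous (k + 1) P) : P 0 = 0 := by
  have h : (2 ^ (k + 1) - 1 : ℝ) • P 0 = 0 := by
    rw [sub_smul, one_smul, ← hP 2 two_pos, smul_zero, sub_self]
  exact (smul_eq_zero.1 h).resolve_left
    (sub_pos.2 (one_lt_pow₀ one_lt_two k.succ_ne_zero)).ne'

theorem sub (hP : IsPosHomogeneous k P) (hQ : IsPosHomogeneous k Q) :
    IsPosHomogeneous k fun z => P z - Q z := fun s hs z => by
  simp only [hP s hs, hQ s hs, smul_sub]

theorem comp_clm (hP : IsPosHomogeneous k P) (A : G →L[ℝ] E) :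
    IsPosHomogeneous k fun z => P (A z) := fun s hs z => by
  simp only [map_smul, hP s hs]

theorem clm_comp (hP : IsPosHomogeneous k P) (A : F →L[ℝ] G) :
    IsPosHomogeneous k fun z => A (P z) := fun s hs z => by
  simp only [map_smul, hP s hs]

theorem fderiv (hP : IsPosHomogeneous (k + 1) P) (hd : Differentiable ℝ P) :
    IsPosHomogeneous k (fderiv ℝ P) := by
  intro s hs z
  have chain : s • _root_.fderiv ℝ P (s • z) = s ^ (k + 1) • _root_.fderiv ℝ P z := by
    rw [← fderiv_comp_smul, funext (hP s hs), fderiv_fun_const_smul (hd z)]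
  rw [pow_succ', mul_smul] at chain
  exact smul_right_injective _ hs.ne' chain

theorem iteratedFDeriv {j : ℕ} (hP : IsPosHomogeneous (j + k) P) (hs : ContDiff ℝ ∞ P) :
    IsPosHomogeneous k (iteratedFDeriv ℝ j P) := by
  induction j generalizing k with
  | zero =>
    rw [zero_add] at hP
    rw [iteratedFDeriv_zero_eq_comp]
    exact hP.clm_comp 
      (continuousMultilinearCurryFin0 ℝ E F).symm.toContinuousLinearEquiv.toContinuousLinearMap
  | succ j ih =>
    rw [iteratedFDeriv_succ_eq_comp_left]
    exact ((ih (k := k + 1) (by rwa [Nat.add_right_comm] at hP)).fderiv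
      (hs.differentiable_iteratedFDeriv (by norm_cast; exact WithTop.coe_lt_top _))).clm_comp
      (continuousMultilinearCurryLeftEquiv ℝ
        (fun _ : Fin (j + 1) => E) F).symm.toContinuousLinearEquiv.toContinuousLinearMap

theorem iteratedFDeriv_zero_eq_zero (hP : IsPosHomogeneous k P) (hs : ContDiff ℝ ∞ P) {j : ℕ}
    (hj : j < k) : _root_.iteratedFDeriv ℝ j P 0 = 0 := by
  obtain ⟨m, rfl⟩ := Nat.exists_eq_add_of_lt hj
  exact apply_zero (k := m) (iteratedFDeriv (by rwa [add_assoc] at hP) hs)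

theorem euler (hP : IsPosHomogeneous k P) {z : E} (hd : DifferentiableAt ℝ P z) :
    _root_.fderiv ℝ P z z = (k : ℝ) • P z := by
  have along_ray : HasDerivAt (fun s : ℝ => P (s • z)) (_root_.fderiv ℝ P z z) 1 := by
    have hd' : HasFDerivAt P (_root_.fderiv ℝ P z) ((1 : ℝ) • z) := by simpa using hd.hasFDerivAt
    simpa [Function.comp_def] using hd'.comp_hasDerivAt (1 : ℝ) ((hasDerivAt_id _).smul_const z)
  have power : HasDerivAt (fun s : ℝ => s ^ k • P z) ((k : ℝ) • P z) 1 := by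
    simpa using (hasDerivAt_pow k (1 : ℝ)).smul_const (P z)
  refine along_ray.unique (power.congr_of_eventuallyEq ?_)
  filter_upwards [lt_mem_nhds one_pos] with s hs using hP s hs z

theorem tendsto_ray {f : E → F} (hP : IsPosHomogeneous k P)
    (hf : (fun z => f z - P z) =o[𝓝 0] fun z => ‖z‖ ^ k) (z : E) :
    Tendsto (fun s : ℝ => (s ^ k)⁻¹ • f (s • z)) (𝓝[>] 0) (𝓝 (P z)) := by
  have rescaled : (fun s : ℝ => (s ^ k)⁻¹ • f (s • z) - P z) =o[𝓝[>] 0] fun _ => ‖z‖ ^ k := by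
    refine ((isBigO_refl (fun s : ℝ => (s ^ k)⁻¹) (𝓝[>] 0)).smul_isLittleO
      (hf.comp_tendsto (tendsto_smul_nhdsGT_zero z))).congr' ?_ ?_ <;>
    filter_upwards [self_mem_nhdsWithin] with s (hs : 0 < s)
    · simp [hP s hs, smul_sub, smul_smul, hs.ne']
    · simp [norm_smul, mul_pow, abs_of_pos hs, hs.ne']
  simpa using ((isLittleO_one_iff ℝ).1
    (rescaled.trans_isBigO (isBigO_const_const _ one_ne_zero _))).add_const (P z)

theorem eq_zero_of_isLittleO (hP : IsPosHomogeneous k P)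
    (h : P =o[𝓝 0] fun z => ‖z‖ ^ k) : P = 0 := by
  funext z
  have lim := hP.tendsto_ray (f := 0) (by simpa using h.neg_left) z
  simp only [Pi.zero_apply, smul_zero] at lim
  exact tendsto_nhds_unique lim tendsto_const_nhds

end IsPosHomogeneous

theorem isLittleO_sub_leading_term {f : E → F} {k : ℕ} (hf : ContDiffAt ℝ k f 0)
    (h : ∀ j < k, iteratedFDeriv ℝ j f 0 = 0) :
    (fun z => f z - (k.factorial : ℝ)⁻¹ • iteratedFDeriv ℝ k f 0 fun _ => z)
      =o[𝓝 0] fun z => ‖z‖ ^ k := by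
  set D := iteratedFDeriv ℝ k f 0 with hD
  set diag : E → F := fun z => D fun _ => z
  have diag_smooth : ContDiff ℝ ∞ diag :=
    D.contDiff.comp (contDiff_pi.2 fun _ => contDiff_id)
  have diag_deriv : iteratedFDeriv ℝ k diag 0 = (k.factorial : ℝ) • D := by
    ext v
    have symm (σ : Equiv.Perm (Fin k)) : (D fun i => v (σ i)) = D v :=
      iteratedFDeriv_comp_perm hf σ v
    rw [D.iteratedFDeriv_comp_diagonal, Finset.sum_congr rfl fun σ _ => symm σ]
    simp [Fintype.card_perm, Nat.cast_smul_eq_nsmul]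
  have diag_smooth' (j : ℕ) : ContDiffAt ℝ j ((k.factorial : ℝ)⁻¹ • diag) 0 :=
    (diag_smooth.of_le (by exact_mod_cast le_top)).contDiffAt.const_smul _
  refine isLittleO_of_iteratedFDeriv_eq_zero (hf.sub (diag_smooth' k)) fun j hj => ?_
  change iteratedFDeriv ℝ j (f - (k.factorial : ℝ)⁻¹ • diag) 0 = 0
  rw [iteratedFDeriv_sub_apply (hf.of_le (by exact_mod_cast hj)) (diag_smooth' j),
    iteratedFDeriv_const_smul_apply (diag_smooth.of_le (by exact_mod_cast le_top)).contDiffAt]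
  rcases hj.lt_or_eq with hlt | rfl
  · rw [h j hlt, (isPosHomogeneous_diagonal D).iteratedFDeriv_zero_eq_zero
      diag_smooth hlt, smul_zero, sub_zero]
  · rw [diag_deriv, inv_smul_smul₀ (by positivity), hD, sub_self]

theorem isLittleO_norm_pow_iff_iteratedFDeriv_eq_zero {f : E → F} {k : ℕ}
    (hf : ContDiffAt ℝ k f 0) :
    (f =o[𝓝 0] fun z => ‖z‖ ^ k) ↔ ∀ j ≤ k, iteratedFDeriv ℝ j f 0 = 0 := by
  refine ⟨fun h j => ?_, isLittleO_of_iteratedFDeriv_eq_zero hf⟩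
  induction j using Nat.strong_induction_on with
  | _ j ih =>
  intro hj
  have hfj : ContDiffAt ℝ j f 0 := hf.of_le (by exact_mod_cast hj)
  have diag_flat := (isLittleO_norm_pow_of_le hj h).sub
    (isLittleO_sub_leading_term hfj fun i hi => ih i hi (by lia))
  simp only [sub_sub_cancel] at diag_flat
  have diag_zero := (isPosHomogeneous_diagonal
    ((j.factorial : ℝ)⁻¹ • iteratedFDeriv ℝ j f 0)).eq_zero_of_isLittleO diag_flat
  ext v
  have polarization := (iteratedFDeriv ℝ j f 0).iteratedFDeriv_comp_diagonal 0 v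
  have diag_zero' : (fun z => iteratedFDeriv ℝ j f 0 fun _ => z) = 0 := by
    funext z
    simpa [Nat.factorial_ne_zero] using congrFun diag_zero z
  have symm (σ : Equiv.Perm (Fin j)) : (iteratedFDeriv ℝ j f 0 fun i => v (σ i)) =
      iteratedFDeriv ℝ j f 0 v := iteratedFDeriv_comp_perm hfj σ v
  rw [diag_zero', Finset.sum_congr rfl fun σ _ => symm σ] at polarization
  simpa [Fintype.card_perm, ← Nat.cast_smul_eq_nsmul ℝ, Nat.factorial_ne_zero]
    using polarization.symm

theorem isLittleO_fderiv {f : E → F} {k : ℕ} (hf : ContDiffAt ℝ (k + 1 : ℕ) f 0)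
    (h : f =o[𝓝 0] fun z => ‖z‖ ^ (k + 1)) : fderiv ℝ f =o[𝓝 0] fun z => ‖z‖ ^ k :=
  isLittleO_of_iteratedFDeriv_eq_zero (hf.fderiv_right (by norm_cast)) fun j hj =>
    iteratedFDeriv_fderiv_eq_zero_iff.2
      ((isLittleO_norm_pow_iff_iteratedFDeriv_eq_zero hf).1 h (j + 1) (by lia))

namespace IsPosHomogeneous

variable {k : ℕ} {P : E → F}

theorem eq_diagonal (hP : IsPosHomogeneous k P) (hs : ContDiff ℝ ∞ P) (z : E) :
    P z = ((k.factorial : ℝ)⁻¹ • _root_.iteratedFDeriv ℝ k P 0) fun _ => z :=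
  sub_eq_zero.1 <| congrFun ((hP.sub (isPosHomogeneous_diagonal
    ((k.factorial : ℝ)⁻¹ • _root_.iteratedFDeriv ℝ k P 0))).eq_zero_of_isLittleO
      (isLittleO_sub_leading_term (hs.of_le (by exact_mod_cast le_top)).contDiffAt
        fun _ hj => hP.iteratedFDeriv_zero_eq_zero hs hj)) z

theorem isBigO (hP : IsPosHomogeneous k P) (hs : ContDiff ℝ ∞ P) :
    P =O[𝓝 0] fun z => ‖z‖ ^ k := by
  set c := (k.factorial : ℝ)⁻¹ • _root_.iteratedFDeriv ℝ k P 0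
  refine IsBigO.of_bound ‖c‖ (Eventually.of_forall fun z => ?_)
  rw [hP.eq_diagonal hs]
  simpa only [norm_pow, norm_norm, Finset.prod_const, Finset.card_univ, Fintype.card_fin]
    using c.le_opNorm fun _ => z

theorem comp_sub_isLittleO (hP : IsPosHomogeneous k P) (hs : ContDiff ℝ ∞ P) {f : E → E}
    (hf : (fun z => f z - z) =o[𝓝 0] fun z => ‖z‖) :
    (fun z => P (f z) - P z) =o[𝓝 0] fun z => ‖z‖ ^ k := by
  set c := (k.factorial : ℝ)⁻¹ • _root_.iteratedFDeriv ℝ k P 0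
  have bound : ∀ᶠ z in 𝓝 (0 : E), ‖P (f z) - P z‖ ≤
      (‖c‖ * k * 2 ^ (k - 1)) * ‖‖z‖ ^ (k - 1) * ‖f z - z‖‖ := by
    filter_upwards [hf.def one_pos] with z hz
    rw [one_mul, norm_norm] at hz
    have hfz : ‖f z‖ ≤ 2 * ‖z‖ := by linarith [norm_le_norm_add_norm_sub' (f z) z]
    rw [hP.eq_diagonal hs, hP.eq_diagonal hs z, norm_mul, norm_pow, norm_norm, norm_norm]
    calc _ ≤ ‖c‖ * Fintype.card (Fin k) * max ‖fun _ : Fin k => f z‖ ‖fun _ : Fin k => z‖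
            ^ (Fintype.card (Fin k) - 1) * ‖(fun _ : Fin k => f z) - fun _ => z‖ :=
          c.norm_image_sub_le (fun _ => f z) fun _ => z
      _ ≤ ‖c‖ * k * (2 * ‖z‖) ^ (k - 1) * ‖f z - z‖ := by
          rw [Fintype.card_fin]
          gcongr
          · refine max_le ?_ ?_ <;> refine (pi_norm_const_le _).trans ?_
            exacts [hfz, by linarith [norm_nonneg z]]
          · exact pi_norm_const_le _
      _ = _ := by ring
  rcases k with _ | k
  · simp only [Nat.cast_zero, mul_zero, zero_mul] at bound
    exact (isLittleO_zero _ _).congr' (bound.mono fun z hz => (norm_le_zero_iff.1 hz).symm) .rfl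
  · refine (IsBigO.of_bound _ bound).trans_isLittleO ?_
    simp only [pow_succ]
    exact (isBigO_refl _ _).mul_isLittleO hf.norm_left

end IsPosHomogeneous

end PosHomogeneous

section LocalInverse

variable {E F : Type*} [NormedAddCommGroup E] [NormedSpace ℝ E]
  [NormedAddCommGroup F] [NormedSpace ℝ F] [CompleteSpace E]

theorem eventually_hasFDerivAt_equiv {f : E → F} {a : E} (hf : ContDiffAt ℝ 1 f a)
    {f' : E ≃L[ℝ] F} (h : HasFDerivAt f (f' : E →L[ℝ] F) a) :
    ∀ᶠ x in 𝓝 a, ∃ e : E ≃L[ℝ] F, HasFDerivAt f (e : E →L[ℝ] F) x := by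
  have invertible : ∀ᶠ x in 𝓝 a, fderiv ℝ f x ∈ Set.range ((↑) : (E ≃L[ℝ] F) → E →L[ℝ] F) :=
    (hf.fderiv_right (m := 0) le_rfl).continuousAt.eventually (h.fderiv ▸ f'.nhds)
  filter_upwards [invertible, hf.eventually (by simp)] with x ⟨e, he⟩ hx
  exact ⟨e, he ▸ (hx.differentiableAt one_ne_zero).hasFDerivAt⟩

theorem exists_smooth_local_inverse {f : E → F} {a : E}
    (hf : ∀ᶠ z in 𝓝 a, ContDiffAt ℝ ∞ f z) {f' : E ≃L[ℝ] F}
    (h : HasFDerivAt f (f' : E →L[ℝ] F) a) :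
    ∃ g : F → E, g (f a) = a ∧ (∀ᶠ y in 𝓝 (f a), ContDiffAt ℝ ∞ g y) ∧
      (∀ᶠ x in 𝓝 a, g (f x) = x) ∧ ∀ᶠ y in 𝓝 (f a), f (g y) = y := by
  have hs : HasStrictFDerivAt f (f' : E →L[ℝ] F) a :=
    hf.self_of_nhds.hasStrictFDerivAt' h (by simp)
  refine ⟨hs.localInverse f f' a, hs.localInverse_apply_image, ?_, hs.eventually_left_inverse,
    hs.eventually_right_inverse⟩
  have regular := hs.localInverse_tendsto.eventually
    (hf.and (eventually_hasFDerivAt_equiv (hf.self_of_nhds.of_le (by simp)) h))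
  filter_upwards [regular, (hs.toOpenPartialHomeomorph f).open_target.mem_nhds
    hs.image_mem_toOpenPartialHomeomorph_target] with y ⟨hy, e, he⟩ hyt
  exact (hs.toOpenPartialHomeomorph f).contDiffAt_symm hyt he hy

end LocalInverse

section NearIdentity

variable {E F : Type*} [NormedAddCommGroup E] [NormedAddCommGroup F]

theorem isLittleO_of_comp_near_id {f : E → E} {g : E → F} {k : ℕ}
    (hf : (fun z => f z - z) =o[𝓝 0] fun z => ‖z‖) (hmap : map f (𝓝 0) = 𝓝 0)
    (h : (fun z => g (f z)) =o[𝓝 0] fun z => ‖z‖ ^ k) : g =o[𝓝 0] fun z => ‖z‖ ^ k := by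
  have norm_le : (fun z : E => ‖z‖) =O[𝓝 0] fun z => ‖f z‖ := by
    refine IsBigO.of_bound 2 ?_
    filter_upwards [hf.def (c := 1 / 2) (by norm_num)] with z hz
    rw [norm_norm] at hz ⊢
    rw [norm_norm]
    linarith [norm_le_norm_add_norm_sub (f z) z]
  rw [← hmap]
  exact isLittleO_map.2 (h.trans_isBigO (norm_le.pow k))

end NearIdentity

section LinearFamily

variable {V E F : Type*} [NormedAddCommGroup V] [NormedSpace ℝ V] [FiniteDimensional ℝ V]
  [NormedAddCommGroup E] [NormedSpace ℝ E] [NormedAddCommGroup F] [NormedSpace ℝ F]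

theorem uncurry_linear_eq_sum {X : Type*} (L : V →ₗ[ℝ] X → F) (p : X × V) : L p.2 p.1 =
    ∑ i, (Module.finBasis ℝ V).coord i p.2 • L (Module.finBasis ℝ V i) p.1 := by
  conv_lhs => rw [← (Module.finBasis ℝ V).sum_repr p.2]
  simp only [map_sum, map_smul, Finset.sum_apply, Pi.smul_apply, Module.Basis.coord_apply]

theorem contDiff_uncurry_linear (L : V →ₗ[ℝ] E → F) (hL : ∀ s, ContDiff ℝ ∞ (L s)) :
    ContDiff ℝ ∞ fun p : E × V => L p.2 p.1 := by
  simp only [uncurry_linear_eq_sum]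
  exact ContDiff.sum fun i _ => ContDiff.smul
    ((LinearMap.toContinuousLinearMap _).contDiff.comp contDiff_snd) ((hL _).comp contDiff_fst)

theorem hasFDerivAt_uncurry_linear_zero (L : V →ₗ[ℝ] E → F) {a : E} (h0 : ∀ s, L s a = 0)
    (hL : ∀ s, HasFDerivAt (L s) (0 : E →L[ℝ] F) a) (s₀ : V) :
    HasFDerivAt (fun p : E × V => L p.2 p.1) (0 : E × V →L[ℝ] F) (a, s₀) := by
  simp only [uncurry_linear_eq_sum]
  refine (HasFDerivAt.fun_sum fun i _ =>
    (((LinearMap.toContinuousLinearMap ((Module.finBasis ℝ V).coord i)).hasFDerivAt.comp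
      (a, s₀) hasFDerivAt_snd).smul ((hL _).comp (a, s₀) hasFDerivAt_fst))).congr_fderiv ?_
  ext <;> simp [h0]

end LinearFamily

theorem omega_eq (u v : Phase) : omega u v =
    u.1 0 * v.2 0 - u.2 0 * v.1 0 + (u.1 1 * v.2 1 - u.2 1 * v.1 1) :=
  Fin.sum_univ_two _

/-- The symplectic form as a continuous bilinear map. -/
noncomputable def omegaL : Phase →L[ℝ] Phase →L[ℝ] ℝ :=
  LinearMap.toContinuousLinearMap
    ((LinearMap.toContinuousLinearMap (𝕜 := ℝ) (E := Phase) (F' := ℝ)).toLinearMap ∘ₗ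
      LinearMap.mk₂ ℝ omega
        (fun u u' v => by simp [omega_eq]; ring) (fun c u v => by simp [omega_eq]; ring)
        (fun u v v' => by simp [omega_eq]; ring) (fun c u v => by simp [omega_eq]; ring))

theorem omegaL_apply (u v : Phase) : omegaL u v = omega u v := rfl

theorem omega_antisymm (u v : Phase) : omega u v = -omega v u := by
  rw [omega_eq, omega_eq]; ring

theorem eq_zero_of_omega_eq_zero {u : Phase} (h : ∀ v, omega u v = 0) : u = 0 := by
  ext i
  · simpa [omega, Pi.single_apply] using h (0, Pi.single i 1)
  · simpa [omega, Pi.single_apply] using h (Pi.single i 1, 0)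

theorem phase_decomp (v : Phase) : v = v.1 0 • (Pi.single 0 1, 0) + v.1 1 • (Pi.single 1 1, 0) +
    (v.2 0 • (0, Pi.single 0 1) + v.2 1 • (0, Pi.single 1 1)) := by
  ext i <;> fin_cases i <;> simp

/-- The isomorphism from covectors to vectors given by the symplectic form, see
`omega_symplecticSharp`. -/
noncomputable def symplecticSharp : (Phase →L[ℝ] ℝ) →L[ℝ] Phase :=
  LinearMap.toContinuousLinearMap
    { toFun := fun L => (fun i => L (0, Pi.single i 1), fun i => -L (Pi.single i 1, 0))
      map_add' := fun L L' => by ext i <;> simp [add_comm]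
      map_smul' := fun c L => by ext i <;> simp }

theorem omega_symplecticSharp (L : Phase →L[ℝ] ℝ) (v : Phase) :
    omega (symplecticSharp L) v = L v := by
  conv_rhs => rw [phase_decomp v]
  simp only [map_add, map_smul, smul_eq_mul, omega_eq, symplecticSharp,
    LinearMap.coe_toContinuousLinearMap', LinearMap.coe_mk, AddHom.coe_mk]
  ring

/-- The Hamiltonian vector field of `K`. -/
noncomputable def hamVF (K : Phase → ℝ) (z : Phase) : Phase := symplecticSharp (fderiv ℝ K z)

theorem omega_hamVF (K : Phase → ℝ) (z v : Phase) : omega (hamVF K z) v = fderiv ℝ K z v :=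
  omega_symplecticSharp _ v

theorem hamVF_fst_apply (K : Phase → ℝ) (z : Phase) (i : Fin 2) :
    (hamVF K z).1 i = fderiv ℝ K z (0, Pi.single i 1) := rfl

theorem contDiff_hamVF {K : Phase → ℝ} (hK : ContDiff ℝ ∞ K) : ContDiff ℝ ∞ (hamVF K) :=
  symplecticSharp.contDiff.comp (hK.fderiv_right (by simp))

theorem hamVF_isLittleO {K : Phase → ℝ} (hK : ContDiff ℝ ∞ K) {k : ℕ}
    (h : K =o[𝓝 0] fun z => ‖z‖ ^ (k + 1)) : hamVF K =o[𝓝 0] fun z => ‖z‖ ^ k :=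
  (symplecticSharp.isBigO_comp (fderiv ℝ K) _).trans_isLittleO
    (isLittleO_fderiv (hK.of_le (by exact_mod_cast le_top)).contDiffAt h)

theorem hamVF_sub {K K' : Phase → ℝ} {z : Phase} (hK : DifferentiableAt ℝ K z)
    (hK' : DifferentiableAt ℝ K' z) :
    hamVF (fun z => K z - K' z) z = hamVF K z - hamVF K' z := by
  simp only [hamVF, fderiv_fun_sub hK hK', map_sub]

theorem IsPosHomogeneous.hamVF {k : ℕ} {K : Phase → ℝ} (hP : IsPosHomogeneous (k + 1) K)
    (hs : ContDiff ℝ ∞ K) : IsPosHomogeneous k (hamVF K) :=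
  (hP.fderiv (hs.differentiable (by simp))).clm_comp symplecticSharp

/-- The coordinate projection `(q, p) ↦ (q, 0)`. -/
noncomputable def horizontalPart : Phase →L[ℝ] Phase :=
  ContinuousLinearMap.inl ℝ Plane Plane ∘L ContinuousLinearMap.fst ℝ Plane Plane

/-- The coordinate projection `(q, p) ↦ (0, p)`. -/
noncomputable def verticalPart : Phase →L[ℝ] Phase :=
  ContinuousLinearMap.inr ℝ Plane Plane ∘L ContinuousLinearMap.snd ℝ Plane Plane

theorem horizontalPart_apply (z : Phase) : horizontalPart z = (z.1, 0) := rfl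

theorem verticalPart_apply (z : Phase) : verticalPart z = (0, z.2) := rfl

theorem horizontalPart_add_verticalPart (z : Phase) : horizontalPart z + verticalPart z = z := by
  simp [horizontalPart_apply, verticalPart_apply]

theorem norm_horizontalPart_le (z : Phase) : ‖horizontalPart z‖ ≤ ‖z‖ := by
  rw [horizontalPart_apply, Prod.norm_mk, norm_zero]
  exact max_le (norm_fst_le _) (norm_nonneg _)

theorem norm_verticalPart_le (z : Phase) : ‖verticalPart z‖ ≤ ‖z‖ := by
  rw [verticalPart_apply, Prod.norm_mk, norm_zero]
  exact max_le (norm_nonneg _) (norm_snd_le _)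

/-! ### Symplectic germs from generating functions `q · P + K(q, P)` -/

/-- The map `(q, P) ↦ (q, P + ∂K/∂q)`, from the mixed coordinates to the source of the symplectic
germ with generating function `q · P + K(q, P)`. -/
noncomputable def srcMap (K : Phase → ℝ) (z : Phase) : Phase := z - verticalPart (hamVF K z)

/-- The map `(q, P) ↦ (q + ∂K/∂P, P)`, from the mixed coordinates to the target of the symplectic
germ with generating function `q · P + K(q, P)`. -/
noncomputable def tgtMap (K : Phase → ℝ) (z : Phase) : Phase := z + horizontalPart (hamVF K z)

theorem srcMap_fst (K : Phase → ℝ) (z : Phase) : (srcMap K z).1 = z.1 := sub_zero _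

theorem tgtMap_fst (K : Phase → ℝ) (z : Phase) : (tgtMap K z).1 = z.1 + (hamVF K z).1 := rfl

theorem tgtMap_sub_srcMap (K : Phase → ℝ) (z : Phase) :
    tgtMap K z - srcMap K z = hamVF K z := by
  rw [← horizontalPart_add_verticalPart (hamVF K z), tgtMap, srcMap]
  abel

theorem contDiff_srcMap {K : Phase → ℝ} (hK : ContDiff ℝ ∞ K) : ContDiff ℝ ∞ (srcMap K) :=
  contDiff_id.sub (verticalPart.contDiff.comp (contDiff_hamVF hK))

theorem contDiff_tgtMap {K : Phase → ℝ} (hK : ContDiff ℝ ∞ K) : ContDiff ℝ ∞ (tgtMap K) :=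
  contDiff_id.add (horizontalPart.contDiff.comp (contDiff_hamVF hK))

theorem hasFDerivAt_srcMap {K : Phase → ℝ} {D : Phase →L[ℝ] Phase} {z : Phase}
    (h : HasFDerivAt (hamVF K) D z) :
    HasFDerivAt (srcMap K) (ContinuousLinearMap.id ℝ Phase - verticalPart ∘L D) z :=
  (hasFDerivAt_id z).sub (verticalPart.hasFDerivAt.comp z h)

theorem hasFDerivAt_tgtMap {K : Phase → ℝ} {D : Phase →L[ℝ] Phase} {z : Phase}
    (h : HasFDerivAt (hamVF K) D z) :
    HasFDerivAt (tgtMap K) (ContinuousLinearMap.id ℝ Phase + horizontalPart ∘L D) z :=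
  (hasFDerivAt_id z).add (horizontalPart.hasFDerivAt.comp z h)

/-- Admissible generating functions: smooth functions whose Taylor expansion at `0` has no terms
of degree at most two. -/
structure IsAdm (K : Phase → ℝ) : Prop where
  smooth : ContDiff ℝ ∞ K
  flat : K =o[𝓝 0] fun z => ‖z‖ ^ 2

namespace IsAdm

variable {K : Phase → ℝ}

theorem hamVF_zero (hK : IsAdm K) : hamVF K 0 = 0 :=
  apply_zero_of_isLittleO (k := 0) (hamVF_isLittleO hK.smooth hK.flat)

theorem srcMap_zero (hK : IsAdm K) : srcMap K 0 = 0 := by simp [srcMap, hK.hamVF_zero]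

theorem tgtMap_zero (hK : IsAdm K) : tgtMap K 0 = 0 := by simp [tgtMap, hK.hamVF_zero]

theorem hasFDerivAt_hamVF (hK : IsAdm K) : HasFDerivAt (hamVF K) (0 : Phase →L[ℝ] Phase) 0 :=
  hasFDerivAt_zero_of_isLittleO (hamVF_isLittleO hK.smooth hK.flat)

theorem hasStrictFDerivAt_hamVF (hK : IsAdm K) :
    HasStrictFDerivAt (hamVF K) (0 : Phase →L[ℝ] Phase) 0 :=
  (contDiff_hamVF hK.smooth).contDiffAt.hasStrictFDerivAt' hK.hasFDerivAt_hamVF (by simp)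

theorem hasStrictFDerivAt_srcMap (hK : IsAdm K) :
    HasStrictFDerivAt (srcMap K) (ContinuousLinearMap.id ℝ Phase) 0 :=
  (contDiff_srcMap hK.smooth).contDiffAt.hasStrictFDerivAt'
    (by simpa using hasFDerivAt_srcMap hK.hasFDerivAt_hamVF) (by simp)

theorem hasStrictFDerivAt_tgtMap (hK : IsAdm K) :
    HasStrictFDerivAt (tgtMap K) (ContinuousLinearMap.id ℝ Phase) 0 :=
  (contDiff_tgtMap hK.smooth).contDiffAt.hasStrictFDerivAt'
    (by simpa using hasFDerivAt_tgtMap hK.hasFDerivAt_hamVF) (by simp)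

theorem map_srcMap (hK : IsAdm K) : map (srcMap K) (𝓝 0) = 𝓝 0 := by
  simpa only [hK.srcMap_zero] using HasStrictFDerivAt.map_nhds_eq_of_equiv
    (f' := ContinuousLinearEquiv.refl ℝ Phase) hK.hasStrictFDerivAt_srcMap

theorem tendsto_srcMap (hK : IsAdm K) : Tendsto (srcMap K) (𝓝 0) (𝓝 0) := hK.map_srcMap.le

theorem map_tgtMap (hK : IsAdm K) : map (tgtMap K) (𝓝 0) = 𝓝 0 := by
  simpa only [hK.tgtMap_zero] using HasStrictFDerivAt.map_nhds_eq_of_equiv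
    (f' := ContinuousLinearEquiv.refl ℝ Phase) hK.hasStrictFDerivAt_tgtMap

end IsAdm

/-- `G` is the symplectic germ with generating function `q · P + K(q, P)`. -/
structure IsGen (K : Phase → ℝ) (G : Phase → Phase) : Prop where
  smooth : ∀ᶠ z in 𝓝 0, ContDiffAt ℝ ∞ G z
  eq : ∀ᶠ z in 𝓝 0, G (srcMap K z) = tgtMap K z

theorem IsGen.unique {K : Phase → ℝ} (hK : IsAdm K) {G G' : Phase → Phase} (h : IsGen K G)
    (h' : IsGen K G') : G =ᶠ[𝓝 0] G' := by
  rw [EventuallyEq, ← hK.map_srcMap, eventually_map]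
  filter_upwards [h.eq, h'.eq] with z eq_tgt eq_tgt'
  rw [eq_tgt, eq_tgt']

/-- The Hamiltonian vector fields of a linear family of smooth functions. -/
noncomputable def hamVFFamily {V : Type*} [AddCommGroup V] [Module ℝ V] (L : V →ₗ[ℝ] Phase → ℝ)
    (hL : ∀ s, Differentiable ℝ (L s)) : V →ₗ[ℝ] Phase → Phase where
  toFun s := hamVF (L s)
  map_add' s t := by
    funext z
    simp only [hamVF, map_add, fderiv_add (hL s z) (hL t z), Pi.add_apply]
  map_smul' c s := by
    funext z
    simp only [hamVF, map_smul, fderiv_const_smul (hL s z) c, RingHom.id_apply, Pi.smul_apply]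

theorem exists_joint_gen {V : Type*} [NormedAddCommGroup V] [NormedSpace ℝ V]
    [FiniteDimensional ℝ V] (L : V →ₗ[ℝ] Phase → ℝ) (hL : ∀ s, IsAdm (L s)) (s₀ : V) :
    ∃ G : Phase × V → Phase, (∀ᶠ p in 𝓝 ((0 : Phase), s₀), ContDiffAt ℝ ∞ G p) ∧
      ∀ᶠ s in 𝓝 s₀, IsGen (L s) fun z => G (z, s) := by
  have : CompleteSpace V := FiniteDimensional.complete ℝ V
  let H := hamVFFamily L fun s => (hL s).smooth.differentiable (by simp)
  have H_smooth : ContDiff ℝ ∞ fun p : Phase × V => H p.2 p.1 :=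
    contDiff_uncurry_linear H fun s => contDiff_hamVF (hL s).smooth
  have H_flat : HasFDerivAt (fun p : Phase × V => H p.2 p.1) (0 : Phase × V →L[ℝ] Phase) (0, s₀) :=
    hasFDerivAt_uncurry_linear_zero H (fun s => (hL s).hamVF_zero)
      (fun s => (hL s).hasFDerivAt_hamVF) s₀
  let A : Phase × V → Phase × V := fun p => (srcMap (L p.2) p.1, p.2)
  have A_smooth : ContDiff ℝ ∞ A :=
    (contDiff_fst.sub (verticalPart.contDiff.comp H_smooth)).prodMk contDiff_snd
  have A_deriv : HasFDerivAt A
      ((ContinuousLinearEquiv.refl ℝ (Phase × V) : (Phase × V) ≃L[ℝ] (Phase × V)) :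
        Phase × V →L[ℝ] Phase × V) (0, s₀) := by
    refine ((hasFDerivAt_fst.sub (verticalPart.hasFDerivAt.comp _ H_flat)).prodMk
      hasFDerivAt_snd).congr_fderiv ?_
    rw [ContinuousLinearMap.comp_zero, sub_zero]
    rfl
  obtain ⟨B, -, B_smooth, B_left, -⟩ :=
    exists_smooth_local_inverse (Eventually.of_forall fun p => A_smooth.contDiffAt) A_deriv
  rw [show A (0, s₀) = (0, s₀) from Prod.ext (hL s₀).srcMap_zero rfl] at B_smooth
  have G_smooth : ∀ᶠ p in 𝓝 ((0 : Phase), s₀),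
      ContDiffAt ℝ ∞ (fun p => tgtMap (L (B p).2) (B p).1) p :=
    B_smooth.mono fun p hp =>
      (contDiff_fst.add (horizontalPart.contDiff.comp H_smooth)).contDiffAt.comp p hp
  refine ⟨fun p => tgtMap (L (B p).2) (B p).1, G_smooth, ?_⟩
  rw [nhds_prod_eq] at G_smooth B_left
  filter_upwards [(eventually_swap_iff.1 G_smooth).curry, (eventually_swap_iff.1 B_left).curry]
    with s hs hs'
  refine ⟨hs.mono fun z hz => ?_, hs'.mono fun z hz => ?_⟩
  · exact ContDiffAt.comp (g := fun p : Phase × V => tgtMap (L (B p).2) (B p).1) z hz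
      (contDiffAt_id.prodMk contDiffAt_const)
  · have hz' : B (srcMap (L s) z, s) = (z, s) := hz
    simp only [hz']

theorem exists_isGen {K : Phase → ℝ} (hK : IsAdm K) : ∃ G, IsGen K G := by
  obtain ⟨G, -, hG⟩ := exists_joint_gen (LinearMap.toSpanSingleton ℝ (Phase → ℝ) K)
    (fun s => ⟨contDiff_const.smul hK.smooth, hK.flat.const_smul_left s⟩) 1
  have isGen_one := hG.self_of_nhds
  rw [LinearMap.toSpanSingleton_apply, one_smul] at isGen_one
  exact ⟨_, isGen_one⟩

open Classical in
/-- The symplectic germ with generating function `q · P + K(q, P)`; the junk value `id` is only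
taken when `K` is not admissible. -/
noncomputable def gen (K : Phase → ℝ) : Phase → Phase :=
  if h : ∃ G, IsGen K G then Classical.choose h else id

theorem isGen_gen {K : Phase → ℝ} (hK : IsAdm K) : IsGen K (gen K) := by
  rw [gen, dif_pos (exists_isGen hK)]
  exact Classical.choose_spec (exists_isGen hK)

theorem omega_add_horizontalPart {u v h k : Phase} (hsymm : omega h v = omega k u) :
    omega (u + horizontalPart h) (v + horizontalPart k) =
      omega (u - verticalPart h) (v - verticalPart k) := by
  simp only [omega_eq, horizontalPart_apply, verticalPart_apply, Prod.fst_add, Prod.snd_add,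
    Prod.fst_sub, Prod.snd_sub, Pi.add_apply, Pi.sub_apply, Pi.zero_apply] at hsymm ⊢
  linarith

theorem omega_fderiv_hamVF_comm {K : Phase → ℝ} (hK : ContDiff ℝ ∞ K) (z u v : Phase) :
    omega (fderiv ℝ (hamVF K) z u) v = omega (fderiv ℝ (hamVF K) z v) u := by
  have deriv_eq : fderiv ℝ (hamVF K) z = symplecticSharp ∘L fderiv ℝ (fderiv ℝ K) z :=
    (symplecticSharp.hasFDerivAt.comp z ((hK.fderiv_right (m := ∞) (by simp)).differentiable
      (by simp) z).hasFDerivAt).fderiv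
  rw [deriv_eq, ContinuousLinearMap.comp_apply, ContinuousLinearMap.comp_apply,
    omega_symplecticSharp, omega_symplecticSharp]
  exact (hK.contDiffAt.isSymmSndFDerivAt (by
    rw [minSmoothness_of_isRCLikeNormedField]
    exact WithTop.coe_le_coe.2 (le_top : (2 : ℕ∞) ≤ ⊤))).eq u v

theorem omega_fderiv_tgtMap {K : Phase → ℝ} (hK : ContDiff ℝ ∞ K) (z u v : Phase) :
    omega (fderiv ℝ (tgtMap K) z u) (fderiv ℝ (tgtMap K) z v) =
      omega (fderiv ℝ (srcMap K) z u) (fderiv ℝ (srcMap K) z v) := by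
  have hd := ((contDiff_hamVF hK).differentiable (by simp) z).hasFDerivAt
  rw [(hasFDerivAt_srcMap hd).fderiv, (hasFDerivAt_tgtMap hd).fderiv]
  exact omega_add_horizontalPart (omega_fderiv_hamVF_comm hK z u v)

namespace IsAdm

variable {K : Phase → ℝ}

theorem gen_zero (hK : IsAdm K) : gen K 0 = 0 := by
  simpa only [hK.srcMap_zero, hK.tgtMap_zero] using (isGen_gen hK).eq.self_of_nhds

theorem eventually_fderiv_gen_comp (hK : IsAdm K) : ∀ᶠ z in 𝓝 0,
    fderiv ℝ (gen K) (srcMap K z) ∘L fderiv ℝ (srcMap K) z = fderiv ℝ (tgtMap K) z := by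
  have smooth_at_src : ∀ᶠ z in 𝓝 (0 : Phase), ContDiffAt ℝ ∞ (gen K) (srcMap K z) :=
    hK.tendsto_srcMap.eventually (isGen_gen hK).smooth
  filter_upwards [smooth_at_src, (isGen_gen hK).eq.eventually_nhds] with z hz hgen
  rw [← fderiv_comp z (hz.differentiableAt (by simp))
    ((contDiff_srcMap hK.smooth).differentiable (by simp) z)]
  exact Filter.EventuallyEq.fderiv_eq hgen

theorem hasStrictFDerivAt_gen (hK : IsAdm K) :
    HasStrictFDerivAt (gen K) (ContinuousLinearMap.id ℝ Phase) 0 := by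
  have smooth := (isGen_gen hK).smooth.self_of_nhds
  have deriv_eq := hK.eventually_fderiv_gen_comp.self_of_nhds
  rw [hK.srcMap_zero, hK.hasStrictFDerivAt_srcMap.hasFDerivAt.fderiv,
    hK.hasStrictFDerivAt_tgtMap.hasFDerivAt.fderiv, ContinuousLinearMap.comp_id] at deriv_eq
  exact deriv_eq ▸ smooth.hasStrictFDerivAt (by simp)

theorem isSympGerm_gen (hK : IsAdm K) : IsSympGerm (gen K) := by
  refine ⟨⟨hK.gen_zero, (isGen_gen hK).smooth⟩, ?_⟩
  have invertible := eventually_hasFDerivAt_equiv (f' := ContinuousLinearEquiv.refl ℝ Phase)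
    ((contDiff_srcMap hK.smooth).contDiffAt.of_le (by simp)) hK.hasStrictFDerivAt_srcMap.hasFDerivAt
  rw [← hK.map_srcMap, eventually_map]
  filter_upwards [invertible, hK.eventually_fderiv_gen_comp] with z ⟨e, he⟩ hchain u v
  obtain ⟨u, rfl⟩ := e.surjective u
  obtain ⟨v, rfl⟩ := e.surjective v
  have hchain' (w : Phase) : fderiv ℝ (gen K) (srcMap K z) (e w) = fderiv ℝ (tgtMap K) z w := by
    rw [← hchain, he.fderiv]; rfl
  have hsrc (w : Phase) : e w = fderiv ℝ (srcMap K) z w := by rw [he.fderiv]; rfl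
  rw [hchain', hchain', omega_fderiv_tgtMap hK.smooth, ← hsrc, ← hsrc]

end IsAdm

theorem gen_comp_srcMap_sub {K K' : Phase → ℝ} (hK : IsAdm K) (hK' : IsAdm K') {k : ℕ}
    (h : (fun z => hamVF K' z - hamVF K z) =O[𝓝 0] fun z => ‖z‖ ^ k) :
    (fun z => gen K' (srcMap K' z) - gen K (srcMap K' z) - (hamVF K' z - hamVF K z))
      =o[𝓝 0] fun z => ‖z‖ ^ k := by
  have src_diff : (fun z => srcMap K' z - srcMap K z) =O[𝓝 0] fun z => ‖z‖ ^ k := by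
    refine IsBigO.trans (IsBigO.of_bound 1 (Eventually.of_forall fun z => ?_)) h
    rw [srcMap, srcMap, sub_sub_sub_cancel_left, ← map_sub, norm_sub_rev (hamVF K' z), one_mul]
    exact norm_verticalPart_le _
  have gen_diff : (fun z => gen K (srcMap K' z) - gen K (srcMap K z) -
      (srcMap K' z - srcMap K z)) =o[𝓝 0] fun z => ‖z‖ ^ k :=
    (hK.hasStrictFDerivAt_gen.isLittleO.comp_tendsto
      (hK'.tendsto_srcMap.prodMk_nhds hK.tendsto_srcMap)).trans_isBigO src_diff
  refine gen_diff.neg_left.congr' ?_ EventuallyEq.rfl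
  filter_upwards [(isGen_gen hK).eq, (isGen_gen hK').eq] with z hz hz'
  rw [hz, hz', ← tgtMap_sub_srcMap K', ← tgtMap_sub_srcMap K]
  abel

theorem gen_sub_gen {K K' Δ : Phase → ℝ} (hK : IsAdm K) (hK' : IsAdm K') {k : ℕ}
    (hΔ : ContDiff ℝ ∞ Δ) (hom : IsPosHomogeneous (k + 1) Δ)
    (h : (fun z => K' z - K z - Δ z) =o[𝓝 0] fun z => ‖z‖ ^ (k + 1)) :
    (fun z => gen K' z - gen K z - hamVF Δ z) =o[𝓝 0] fun z => ‖z‖ ^ k := by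
  have ham_diff : (fun z => hamVF K' z - hamVF K z - hamVF Δ z) =o[𝓝 0] fun z => ‖z‖ ^ k := by
    refine (hamVF_isLittleO ((hK'.smooth.sub hK.smooth).sub hΔ) h).congr_left fun z => ?_
    have hd := hK.smooth.differentiable (by simp) z
    have hd' := hK'.smooth.differentiable (by simp) z
    rw [← hamVF_sub hd' hd]
    exact hamVF_sub (hd'.sub hd) (hΔ.differentiable (by simp) z)
  have ham_bound : (fun z => hamVF K' z - hamVF K z) =O[𝓝 0] fun z => ‖z‖ ^ k :=
    (ham_diff.isBigO.add ((hom.hamVF hΔ).isBigO (contDiff_hamVF hΔ))).congr_left fun z => by abel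
  have src_near_id : (fun z => srcMap K' z - z) =o[𝓝 0] fun z => ‖z‖ :=
    isLittleO_sub_id_of_hasFDerivAt hK'.hasStrictFDerivAt_srcMap.hasFDerivAt hK'.srcMap_zero
  refine isLittleO_of_comp_near_id src_near_id hK'.map_srcMap ?_
  refine (((gen_comp_srcMap_sub hK hK' ham_bound).add ham_diff).sub
    ((hom.hamVF hΔ).comp_sub_isLittleO (contDiff_hamVF hΔ) src_near_id)).congr_left fun z => ?_
  abel

/-- Functions of the form `v(q) · P + w(q)`; they generate the symplectic germs which preserve the
fibres of `π`. -/
def AffineInP (K : Phase → ℝ) : Prop :=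
  ∀ q P : Plane, K (q, P) = K (q, 0) + ∑ i, P i * (K (q, Pi.single i 1) - K (q, 0))

theorem AffineInP.hamVF_fst {K : Phase → ℝ} (h : AffineInP K) (hK : Differentiable ℝ K)
    (q P : Plane) (i : Fin 2) : (hamVF K (q, P)).1 i = K (q, Pi.single i 1) - K (q, 0) := by
  rw [hamVF_fst_apply, ← (hK (q, P)).lineDeriv_eq_fderiv]
  have along_line (t : ℝ) : K ((q, P) + t • (0, Pi.single i 1)) =
      K (q, P) + t * (K (q, Pi.single i 1) - K (q, 0)) := by
    rw [Prod.smul_mk, Prod.mk_add_mk, smul_zero, add_zero, h q (P + _), h q P]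
    fin_cases i <;> simp [Fin.sum_univ_two] <;> ring
  simp only [lineDeriv, along_line]
  simp

theorem IsAdm.isLagrangianEquivalence_gen {K : Phase → ℝ} (hK : IsAdm K) (h : AffineInP K) :
    IsLagrangianEquivalence (gen K) := by
  have base_deriv : HasFDerivAt (fun q : Plane => (tgtMap K (q, 0)).1)
      (ContinuousLinearMap.fst ℝ Plane Plane ∘L ContinuousLinearMap.id ℝ Phase ∘L
        ContinuousLinearMap.inl ℝ Plane Plane) 0 :=
    (ContinuousLinearMap.fst ℝ Plane Plane).hasFDerivAt.comp (0 : Plane)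
      (HasFDerivAt.comp (0 : Plane) (f := fun q : Plane => (q, (0 : Plane))) (g := tgtMap K)
        hK.hasStrictFDerivAt_tgtMap.hasFDerivAt (hasFDerivAt_prodMk_left (0 : Plane) (0 : Plane)))
  refine ⟨hK.isSympGerm_gen, fun q => (tgtMap K (q, 0)).1, ⟨⟨?_, ?_⟩, ?_⟩, ?_⟩
  · exact congrArg Prod.fst hK.tgtMap_zero
  · exact Eventually.of_forall fun q => ((contDiff_tgtMap hK.smooth).comp
      (contDiff_id.prodMk contDiff_const)).fst.contDiffAt
  · rw [base_deriv.fderiv]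
    exact Function.bijective_id
  · rw [← hK.map_srcMap, eventually_map]
    filter_upwards [(isGen_gen hK).eq] with ⟨q, P⟩ hz
    have hd := hK.smooth.differentiable (by simp)
    rw [hz, srcMap_fst]
    ext i
    simp only [tgtMap_fst, Pi.add_apply, h.hamVF_fst hd]

/-! ### Reticular diffeomorphism germs -/

/-- The coordinates `(q_σ, p_{I - σ})` of a point, extended by zero; they measure the
deviation from the span of `L_σ⁰`. -/
noncomputable def cornerNormal (σ : Set (Fin 2)) : Phase →ₗ[ℝ] Phase where
  toFun z := (σ.indicator z.1, σᶜ.indicator z.2)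
  map_add' z w := by simp only [Prod.fst_add, Prod.snd_add, Set.indicator_add', Prod.mk_add_mk]
  map_smul' c z := Prod.ext (Set.indicator_const_smul σ c z.1) (Set.indicator_const_smul σᶜ c z.2)

theorem cornerNormal_apply (σ : Set (Fin 2)) (z : Phase) :
    cornerNormal σ z = (σ.indicator z.1, σᶜ.indicator z.2) := rfl

/-- The Lagrangian plane spanned by `L_σ⁰`. -/
noncomputable def cornerPlane (σ : Set (Fin 2)) : Submodule ℝ Phase :=
  LinearMap.ker (cornerNormal σ)

theorem cornerNormal_eq_zero_iff {σ : Set (Fin 2)} {z : Phase} :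
    cornerNormal σ z = 0 ↔ z ∈ cornerPlane σ :=
  LinearMap.mem_ker.symm

theorem mem_cornerPlane_iff {σ : Set (Fin 2)} {z : Phase} :
    z ∈ cornerPlane σ ↔ (∀ i ∈ σ, z.1 i = 0) ∧ ∀ i ∉ σ, z.2 i = 0 := by
  simp only [← cornerNormal_eq_zero_iff, cornerNormal_apply, Prod.mk_eq_zero, funext_iff,
    Pi.zero_apply, Set.indicator_apply_eq_zero, Set.mem_compl_iff]

theorem norm_cornerNormal_le (σ : Set (Fin 2)) (z : Phase) : ‖cornerNormal σ z‖ ≤ ‖z‖ := by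
  refine max_le_max ?_ ?_ <;>
    exact (pi_norm_le_iff_of_nonneg (norm_nonneg _)).2 fun i =>
      (norm_indicator_le_norm_self _ i).trans (norm_le_pi_norm _ i)

theorem sub_cornerNormal (σ : Set (Fin 2)) (z : Phase) :
    z - cornerNormal σ z = cornerNormal σᶜ z := by
  simp only [cornerNormal_apply, Set.indicator_compl, compl_compl, Prod.ext_iff, Prod.fst_sub,
    Prod.snd_sub, sub_sub_cancel, and_self]

theorem sub_cornerNormal_mem_cornerPlane (σ : Set (Fin 2)) (z : Phase) :
    z - cornerNormal σ z ∈ cornerPlane σ := by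
  rw [← cornerNormal_eq_zero_iff, map_sub]
  simp [cornerNormal_apply, Set.indicator_indicator]

theorem cornerNormal_horizontalPart (σ : Set (Fin 2)) (z : Phase) :
    cornerNormal σ (horizontalPart z) = horizontalPart (cornerNormal σ z) := by
  simp [cornerNormal_apply, horizontalPart_apply]

theorem cornerNormal_verticalPart (σ : Set (Fin 2)) (z : Phase) :
    cornerNormal σ (verticalPart z) = verticalPart (cornerNormal σ z) := by
  simp [cornerNormal_apply, verticalPart_apply]

theorem mem_cornerPlane_of_norm_cornerNormal_le {σ : Set (Fin 2)} {z : Phase}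
    (h : ‖cornerNormal σ z‖ ≤ 1 / 2 * ‖cornerNormal σ z‖) : z ∈ cornerPlane σ :=
  cornerNormal_eq_zero_iff.1 (norm_le_zero_iff.1 (by linarith))

theorem mem_cornerL_iff {σ : Set (Fin 2)} {z : Phase} :
    z ∈ cornerL σ ↔ z ∈ cornerPlane σ ∧ ∀ i ∉ σ, 0 ≤ z.1 i := by
  simp only [cornerL, mem_cornerPlane_iff, Set.mem_ofPred_eq, imp_and, forall_and, and_assoc]

/-- Functions vanishing on the span of every `L_σ⁰`; they generate reticular diffeomorphism
germs. -/
def VanishesOnCorners (K : Phase → ℝ) : Prop := ∀ σ, ∀ z ∈ cornerPlane σ, K z = 0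

theorem fderiv_eq_zero_of_line {E : Type*} [NormedAddCommGroup E] [NormedSpace ℝ E] {f : E → ℝ}
    {z v : E} (hf : DifferentiableAt ℝ f z) (h : ∀ t : ℝ, f (z + t • v) = 0) :
    fderiv ℝ f z v = 0 := by
  rw [← hf.lineDeriv_eq_fderiv]
  simp [lineDeriv, h]

theorem VanishesOnCorners.hamVF_mem_cornerPlane {K : Phase → ℝ} (h : VanishesOnCorners K)
    (hd : Differentiable ℝ K) {σ : Set (Fin 2)} {z : Phase} (hz : z ∈ cornerPlane σ) :
    hamVF K z ∈ cornerPlane σ := by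
  refine mem_cornerPlane_iff.2 ⟨fun i hi => fderiv_eq_zero_of_line (hd z) fun t =>
    h σ _ (add_mem hz (Submodule.smul_mem _ t ?_)), fun i hi => neg_eq_zero.2
    (fderiv_eq_zero_of_line (hd z) fun t => h σ _ (add_mem hz (Submodule.smul_mem _ t ?_)))⟩
  · refine mem_cornerPlane_iff.2 ⟨fun _ _ => rfl, fun j hj => Pi.single_eq_of_ne ?_ 1⟩
    exact fun e => hj (e ▸ hi)
  · refine mem_cornerPlane_iff.2 ⟨fun j hj => Pi.single_eq_of_ne ?_ 1, fun _ _ => rfl⟩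
    exact fun e => hi (e ▸ hj)

theorem map_nhdsWithin_of_mem_iff {X : Type*} [TopologicalSpace X] {f : X → X} {a : X} {A : Set X}
    (hf : map f (𝓝 a) = 𝓝 a) (h : ∀ᶠ z in 𝓝 a, f z ∈ A ↔ z ∈ A) :
    map f (𝓝[A] a) = 𝓝[A] a := by
  have preimage_eq : 𝓝[A] a = 𝓝[f ⁻¹' A] a :=
    nhdsWithin_eq_iff_eventuallyEq.2 (eventuallyEq_set.2 (h.mono fun z hz => hz.symm))
  conv_lhs => rw [preimage_eq, nhdsWithin, map_inf_principal_preimage, hf]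
  rfl

theorem IsAdm.exists_half_lipschitz {K : Phase → ℝ} (hK : IsAdm K) : ∃ r > 0,
    ∀ z ∈ Metric.ball (0 : Phase) r, ∀ w ∈ Metric.ball (0 : Phase) r,
      ‖hamVF K z - hamVF K w‖ ≤ 1 / 2 * ‖z - w‖ := by
  have h := hK.hasStrictFDerivAt_hamVF.isLittleO.def (c := 1 / 2) (by norm_num)
  rw [nhds_prod_eq] at h
  obtain ⟨t, ht, h⟩ := mem_prod_self_iff.1 h
  obtain ⟨r, hr, hrt⟩ := Metric.mem_nhds_iff.1 ht
  refine ⟨r, hr, fun z hz w hw => ?_⟩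
  simpa using h (Set.mk_mem_prod (hrt hz) (hrt hw))

theorem IsAdm.eventually_norm_cornerNormal_hamVF_le {K : Phase → ℝ} (hK : IsAdm K)
    (h : VanishesOnCorners K) : ∀ᶠ z in 𝓝 0, ∀ σ : Set (Fin 2),
      ‖cornerNormal σ (hamVF K z)‖ ≤ 1 / 2 * ‖cornerNormal σ z‖ := by
  obtain ⟨r, hr, half_lipschitz⟩ := hK.exists_half_lipschitz
  filter_upwards [Metric.ball_mem_nhds 0 hr] with z hz σ
  have proj_mem : z - cornerNormal σ z ∈ Metric.ball (0 : Phase) r := by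
    rw [mem_ball_zero_iff] at hz ⊢
    exact (sub_cornerNormal σ z ▸ norm_cornerNormal_le σᶜ z).trans_lt hz
  have normal_eq : cornerNormal σ (hamVF K z) =
      cornerNormal σ (hamVF K z - hamVF K (z - cornerNormal σ z)) := by
    rw [map_sub, cornerNormal_eq_zero_iff.2 (h.hamVF_mem_cornerPlane
      (hK.smooth.differentiable (by simp)) (sub_cornerNormal_mem_cornerPlane σ z)), sub_zero]
  calc ‖cornerNormal σ (hamVF K z)‖
      ≤ ‖hamVF K z - hamVF K (z - cornerNormal σ z)‖ := normal_eq ▸ norm_cornerNormal_le _ _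
    _ ≤ 1 / 2 * ‖z - (z - cornerNormal σ z)‖ := half_lipschitz z hz _ proj_mem
    _ = 1 / 2 * ‖cornerNormal σ z‖ := by rw [sub_sub_cancel]

theorem IsAdm.eventually_srcMap_mem_cornerL_iff {K : Phase → ℝ} (hK : IsAdm K)
    (h : VanishesOnCorners K) (σ : Set (Fin 2)) :
    ∀ᶠ z in 𝓝 0, srcMap K z ∈ cornerL σ ↔ z ∈ cornerL σ := by
  filter_upwards [hK.eventually_norm_cornerNormal_hamVF_le h] with z hz
  simp only [mem_cornerL_iff, srcMap_fst]
  refine and_congr_left' ⟨fun hs => ?_, fun hs => ?_⟩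
  · refine mem_cornerPlane_of_norm_cornerNormal_le (le_trans ?_ (hz σ))
    rw [← cornerNormal_eq_zero_iff, srcMap, map_sub, sub_eq_zero, cornerNormal_verticalPart] at hs
    exact hs ▸ norm_verticalPart_le _
  · have hm := h.hamVF_mem_cornerPlane (hK.smooth.differentiable (by simp)) hs
    rw [← cornerNormal_eq_zero_iff] at hs hm ⊢
    rw [srcMap, map_sub, cornerNormal_verticalPart, hs, hm, map_zero, sub_zero]

/-- Apply the estimate on the normal coordinates of `cornerPlane (insert i σ)`, which on
`cornerPlane σ` reduce to `q_i`. -/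
theorem abs_hamVF_fst_le {K : Phase → ℝ} {σ : Set (Fin 2)} {i : Fin 2} {z : Phase}
    (h : ‖cornerNormal (insert i σ) (hamVF K z)‖ ≤ 1 / 2 * ‖cornerNormal (insert i σ) z‖)
    (hz : z ∈ cornerPlane σ) : |(hamVF K z).1 i| ≤ 1 / 2 * |z.1 i| := by
  have normal_eq : cornerNormal (insert i σ) z = (Pi.single i (z.1 i), 0) := by
    refine Prod.ext (funext fun j => ?_) (funext fun j => ?_)
    · rcases eq_or_ne j i with rfl | hj
      · simp [cornerNormal_apply]
      · simpa [cornerNormal_apply, hj] using (mem_cornerPlane_iff.1 hz).1 j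
    · simpa [cornerNormal_apply] using fun _ => (mem_cornerPlane_iff.1 hz).2 j
  have norm_eq : ‖cornerNormal (insert i σ) z‖ = |z.1 i| := by
    rw [normal_eq, Prod.norm_mk, norm_zero, Pi.norm_single, max_eq_left (norm_nonneg _),
      Real.norm_eq_abs]
  calc |(hamVF K z).1 i| = ‖(cornerNormal (insert i σ) (hamVF K z)).1 i‖ := by
        simp [cornerNormal_apply]
    _ ≤ ‖cornerNormal (insert i σ) (hamVF K z)‖ := (norm_le_pi_norm _ i).trans (norm_fst_le _)
    _ ≤ 1 / 2 * |z.1 i| := norm_eq ▸ h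

theorem add_nonneg_iff_of_abs_le_half {a b : ℝ} (h : |b| ≤ 1 / 2 * |a|) : 0 ≤ a + b ↔ 0 ≤ a := by
  obtain ⟨lower, upper⟩ := abs_le.1 h
  rcases le_total 0 a with ha | ha
  · rw [abs_of_nonneg ha] at lower
    exact iff_of_true (by linarith) ha
  · rw [abs_of_nonpos ha] at upper lower
    constructor <;> intro <;> linarith

theorem IsAdm.eventually_tgtMap_mem_cornerL_iff {K : Phase → ℝ} (hK : IsAdm K)
    (h : VanishesOnCorners K) (σ : Set (Fin 2)) :
    ∀ᶠ z in 𝓝 0, tgtMap K z ∈ cornerL σ ↔ z ∈ cornerL σ := by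
  filter_upwards [hK.eventually_norm_cornerNormal_hamVF_le h] with z hz
  have mem_plane : tgtMap K z ∈ cornerPlane σ ↔ z ∈ cornerPlane σ := by
    refine ⟨fun hs => ?_, fun hs => ?_⟩
    · refine mem_cornerPlane_of_norm_cornerNormal_le (le_trans ?_ (hz σ))
      rw [← cornerNormal_eq_zero_iff, tgtMap, map_add, add_eq_zero_iff_eq_neg,
        cornerNormal_horizontalPart] at hs
      rw [hs, norm_neg]
      exact norm_horizontalPart_le _
    · have hm := h.hamVF_mem_cornerPlane (hK.smooth.differentiable (by simp)) hs
      rw [← cornerNormal_eq_zero_iff] at hs hm ⊢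
      rw [tgtMap, map_add, cornerNormal_horizontalPart, hs, hm, map_zero, add_zero]
  rw [mem_cornerL_iff, mem_cornerL_iff, mem_plane]
  exact and_congr_right fun hs => forall₂_congr fun i _ =>
    add_nonneg_iff_of_abs_le_half (abs_hamVF_fst_le (hz (insert i σ)) hs)

theorem IsAdm.isReticular_gen {K : Phase → ℝ} (hK : IsAdm K) (h : VanishesOnCorners K) :
    IsReticular (gen K) := by
  refine ⟨hK.isSympGerm_gen, fun σ => ?_⟩
  calc map (gen K) (𝓝[cornerL σ] 0)
      = map (gen K) (map (srcMap K) (𝓝[cornerL σ] 0)) := by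
        rw [map_nhdsWithin_of_mem_iff hK.map_srcMap (hK.eventually_srcMap_mem_cornerL_iff h σ)]
    _ = map (tgtMap K) (𝓝[cornerL σ] 0) :=
        map_congr ((isGen_gen hK).eq.filter_mono nhdsWithin_le_nhds)
    _ = 𝓝[cornerL σ] 0 :=
        map_nhdsWithin_of_mem_iff hK.map_tgtMap (hK.eventually_tgtMap_mem_cornerL_iff h σ)

/-! ### Leading terms of differences of symplectic germs -/

theorem IsSympGerm.continuousAt_fderiv {f : Phase → Phase} (hf : IsSympGerm f) :
    ContinuousAt (fderiv ℝ f) 0 :=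
  (hf.1.2.self_of_nhds.fderiv_right (m := 0) (by simp)).continuousAt

theorem tendsto_omega {α : Type*} {l : Filter α} {a b : α → Phase} {u v : Phase}
    (ha : Tendsto a l (𝓝 u)) (hb : Tendsto b l (𝓝 v)) :
    Tendsto (fun s => omega (a s) (b s)) l (𝓝 (omega u v)) :=
  (omegaL.isBoundedBilinearMap.continuous.tendsto (u, v)).comp (ha.prodMk_nhds hb)

theorem tendsto_clm_apply_const {α E F : Type*} [NormedAddCommGroup E] [NormedSpace ℝ E]
    [NormedAddCommGroup F] [NormedSpace ℝ F] {l : Filter α} {T : α → E →L[ℝ] F} {T₀ : E →L[ℝ] F}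
    (h : Tendsto T l (𝓝 T₀)) (v : E) : Tendsto (fun s => T s v) l (𝓝 (T₀ v)) :=
  ((ContinuousLinearMap.apply ℝ F v).continuous.tendsto _).comp h

/-- A linear vector field is infinitesimally symplectic if it preserves `omega` to first order. -/
def IsInfinitesimallySymplectic (A : Phase →L[ℝ] Phase) : Prop :=
  ∀ u v, omega (A u) v + omega u (A v) = 0

theorem IsSympGerm.isInfinitesimallySymplectic_of_leading {f g : Phase → Phase} (hf : IsSympGerm f)
    (hg : IsSympGerm g) (hf' : fderiv ℝ f 0 = ContinuousLinearMap.id ℝ Phase)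
    (hg' : fderiv ℝ g 0 = ContinuousLinearMap.id ℝ Phase) {k : ℕ} {d : Phase → Phase}
    (hd : ContDiff ℝ ∞ d) (hom : IsPosHomogeneous (k + 1) d)
    (h : (fun z => f z - g z - d z) =o[𝓝 0] fun z => ‖z‖ ^ (k + 1)) (z : Phase) :
    IsInfinitesimallySymplectic (fderiv ℝ d z) := by
  intro u v
  have hdd := hd.differentiable (by simp)
  have deriv_diff : (fun z => (fderiv ℝ f z - fderiv ℝ g z) - fderiv ℝ d z)
      =o[𝓝 0] fun z => ‖z‖ ^ k := by
    have smooth := (hf.1.2.self_of_nhds.sub hg.1.2.self_of_nhds).sub hd.contDiffAt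
    refine (isLittleO_fderiv (smooth.of_le (by exact_mod_cast le_top)) h).congr' ?_ EventuallyEq.rfl
    filter_upwards [hf.1.2, hg.1.2] with z hfz hgz
    exact (((hfz.differentiableAt (by simp)).hasFDerivAt.sub
      (hgz.differentiableAt (by simp)).hasFDerivAt).sub (hdd z).hasFDerivAt).fderiv
  have lim_diff := (hom.fderiv hdd).tendsto_ray deriv_diff z
  have ray := tendsto_smul_nhdsGT_zero z
  have lim_f := hf' ▸ hf.continuousAt_fderiv.tendsto.comp ray
  have lim_g := hg' ▸ hg.continuousAt_fderiv.tendsto.comp ray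
  -- Divide `ω(Df u, Df v) - ω(Dg u, Dg v) = ω((Df - Dg) u, Df v) + ω(Dg u, (Df - Dg) v)` by `sᵏ`.
  refine tendsto_nhds_unique ((tendsto_omega (tendsto_clm_apply_const lim_diff u)
    (tendsto_clm_apply_const lim_f v)).add (tendsto_omega (tendsto_clm_apply_const lim_g u)
      (tendsto_clm_apply_const lim_diff v))) (tendsto_const_nhds.congr' ?_)
  filter_upwards [ray.eventually (hf.2.and hg.2)] with s ⟨hfs, hgs⟩
  specialize hfs u v
  specialize hgs u v
  simp only [Function.comp, ← omegaL_apply, smul_apply, sub_apply, map_smul, map_sub,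
    smul_eq_mul] at hfs hgs ⊢
  linear_combination (-(s ^ k)⁻¹) * (hfs - hgs)

/-- The Hamiltonian function of an infinitesimally symplectic vector field that is homogeneous of
degree `k`; the factor comes from Euler's identity. -/
noncomputable def hamFun (k : ℕ) (d : Phase → Phase) (z : Phase) : ℝ :=
  ((k : ℝ) + 1)⁻¹ * omega (d z) z

theorem contDiff_hamFun {k : ℕ} {d : Phase → Phase} (hd : ContDiff ℝ ∞ d) :
    ContDiff ℝ ∞ (hamFun k d) :=
  contDiff_const.mul (omegaL.isBoundedBilinearMap.contDiff.comp (hd.prodMk contDiff_id))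

theorem IsPosHomogeneous.hamFun {k : ℕ} {d : Phase → Phase} (hom : IsPosHomogeneous k d) :
    IsPosHomogeneous (k + 1) (hamFun k d) := by
  intro s hs z
  simp only [RetLag.hamFun, hom s hs z, ← omegaL_apply, map_smul, smul_apply, smul_eq_mul]
  ring

theorem fderiv_hamFun {k : ℕ} {d : Phase → Phase} {z : Phase} (hd : DifferentiableAt ℝ d z)
    (v : Phase) : fderiv ℝ (hamFun k d) z v =
      ((k : ℝ) + 1)⁻¹ * (omega (d z) v + omega (fderiv ℝ d z v) z) := by
  have h : HasFDerivAt (hamFun k d) _ z :=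
    (omegaL.hasFDerivAt_of_bilinear hd.hasFDerivAt (hasFDerivAt_id z)).const_mul ((k : ℝ) + 1)⁻¹
  simpa [omegaL_apply, mul_add] using DFunLike.congr_fun h.fderiv v

theorem hamVF_hamFun {k : ℕ} {d : Phase → Phase} (hd : Differentiable ℝ d)
    (hom : IsPosHomogeneous k d) (h : ∀ z, IsInfinitesimallySymplectic (fderiv ℝ d z)) :
    hamVF (hamFun k d) = d := by
  funext z
  refine sub_eq_zero.1 (eq_zero_of_omega_eq_zero fun v => ?_)
  have symm := h z v z
  rw [hom.euler (hd z), omega_antisymm v, ← omegaL_apply ((k : ℝ) • d z), map_smul, smul_apply,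
    smul_eq_mul, omegaL_apply] at symm
  rw [← omegaL_apply, map_sub, sub_apply, omegaL_apply, omegaL_apply, omega_hamVF,
    fderiv_hamFun (hd z), eq_neg_of_add_eq_zero_left symm, neg_neg]
  field_simp
  ring

/-! ### Normal forms of germs tangent to the identity -/

/-- Homogeneous polynomials of degree `k` on the phase space. -/
def homPoly (k : ℕ) : Submodule ℝ (Phase → ℝ) where
  carrier := {K | ContDiff ℝ ∞ K ∧ IsPosHomogeneous k K}
  add_mem' h h' := ⟨h.1.add h'.1, fun s hs z => by
    simp only [Pi.add_apply, h.2 s hs, h'.2 s hs, smul_add]⟩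
  zero_mem' := ⟨contDiff_const, fun s _ _ => (smul_zero (s ^ k)).symm⟩
  smul_mem' c K h := ⟨contDiff_const.smul h.1, fun s hs z => by
    simp only [Pi.smul_apply, h.2 s hs, smul_comm c]⟩

/-- Homogeneous generating functions of Lagrangian equivalences. -/
def lagPoly (k : ℕ) : Submodule ℝ (Phase → ℝ) where
  carrier := {K | K ∈ homPoly k ∧ AffineInP K}
  add_mem' h h' := ⟨add_mem h.1 h'.1, fun q P => by
    simp only [Pi.add_apply, Fin.sum_univ_two]
    rw [h.2 q P, h'.2 q P, Fin.sum_univ_two, Fin.sum_univ_two]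
    ring⟩
  zero_mem' := ⟨zero_mem _, fun q P => by simp⟩
  smul_mem' c K h := ⟨Submodule.smul_mem _ c h.1, fun q P => by
    simp only [Pi.smul_apply, Fin.sum_univ_two, smul_eq_mul]
    rw [h.2 q P, Fin.sum_univ_two]
    ring⟩

/-- Homogeneous generating functions of reticular diffeomorphisms. -/
def retPoly (k : ℕ) : Submodule ℝ (Phase → ℝ) where
  carrier := {K | K ∈ homPoly k ∧ VanishesOnCorners K}
  add_mem' h h' := ⟨add_mem h.1 h'.1, fun σ z hz => by simp [h.2 σ z hz, h'.2 σ z hz]⟩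
  zero_mem' := ⟨zero_mem _, fun _ _ _ => rfl⟩
  smul_mem' c K h := ⟨Submodule.smul_mem _ c h.1, fun σ z hz => by simp [h.2 σ z hz]⟩

theorem lagPoly_le (k : ℕ) : lagPoly k ≤ homPoly k := fun _ h => h.1

theorem retPoly_le (k : ℕ) : retPoly k ≤ homPoly k := fun _ h => h.1

instance finiteDimensional_homPoly (k : ℕ) : FiniteDimensional ℝ (homPoly k) := by
  let diag : MultilinearMap ℝ (fun _ : Fin k => Phase) ℝ →ₗ[ℝ] Phase → ℝ :=
    { toFun := fun c z => c fun _ => z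
      map_add' := fun _ _ => rfl
      map_smul' := fun _ _ => rfl }
  refine Submodule.finiteDimensional_of_le (S₂ := LinearMap.range diag) fun K hK =>
    ⟨((k.factorial : ℝ)⁻¹ • iteratedFDeriv ℝ k K 0).toMultilinearMap, ?_⟩
  exact funext fun z => (hK.2.eq_diagonal hK.1 z).symm

instance finiteDimensional_lagPoly (k : ℕ) : FiniteDimensional ℝ (lagPoly k) :=
  Submodule.finiteDimensional_of_le (lagPoly_le k)

instance finiteDimensional_retPoly (k : ℕ) : FiniteDimensional ℝ (retPoly k) :=
  Submodule.finiteDimensional_of_le (retPoly_le k)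

theorem isLittleO_of_mem_homPoly {K : Phase → ℝ} {j k : ℕ} (hK : K ∈ homPoly k) (hjk : j < k) :
    K =o[𝓝 0] fun z => ‖z‖ ^ j :=
  (hK.2.isBigO hK.1).trans_isLittleO (isLittleO_norm_pow_of_lt hjk)

/-- The polynomial with homogeneous components of degrees `3, …, n + 2` in the spaces `V k`. -/
def polySum (V : ℕ → Submodule ℝ (Phase → ℝ)) (n : ℕ) :
    ((j : Fin n) → V (j + 3)) →ₗ[ℝ] Phase → ℝ :=
  ∑ j : Fin n, (V (j + 3)).subtype ∘ₗ LinearMap.proj (φ := fun j : Fin n => V (j + 3)) j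

theorem polySum_apply {V : ℕ → Submodule ℝ (Phase → ℝ)} {n : ℕ} (c : (j : Fin n) → V (j + 3))
    (z : Phase) : polySum V n c z = ∑ j, (c j : Phase → ℝ) z := by
  simp [polySum]

theorem polySum_snoc {V : ℕ → Submodule ℝ (Phase → ℝ)} {n : ℕ} (c : (j : Fin n) → V (j + 3))
    (G : V (n + 3)) (z : Phase) :
    polySum V (n + 1) (Fin.snoc (α := fun j : Fin (n + 1) => V (j + 3)) c G) z =
      polySum V n c z + (G : Phase → ℝ) z := by
  simp [polySum_apply, Fin.sum_univ_castSucc]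

theorem isAdm_polySum {V : ℕ → Submodule ℝ (Phase → ℝ)} (hV : ∀ k, V k ≤ homPoly k) {n : ℕ}
    (c : (j : Fin n) → V (j + 3)) : IsAdm (polySum V n c) := by
  rw [show polySum V n c = fun z => ∑ j, (c j : Phase → ℝ) z from funext (polySum_apply c)]
  exact ⟨ContDiff.sum fun j _ => (hV _ (c j).2).1,
    IsLittleO.fun_sum fun j _ => isLittleO_of_mem_homPoly (hV _ (c j).2) (by omega)⟩

theorem affineInP_polySum {n : ℕ} (c : (j : Fin n) → lagPoly (j + 3)) :
    AffineInP (polySum lagPoly n c) := by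
  intro q P
  simp only [polySum_apply, ← Finset.sum_sub_distrib, Finset.mul_sum]
  rw [Finset.sum_comm, ← Finset.sum_add_distrib]
  exact Finset.sum_congr rfl fun j _ => (c j).2.2 q P

theorem vanishesOnCorners_polySum {n : ℕ} (c : (j : Fin n) → retPoly (j + 3)) :
    VanishesOnCorners (polySum retPoly n c) := by
  intro σ z hz
  rw [polySum_apply]
  exact Finset.sum_eq_zero fun j _ => (c j).2.2 σ z hz

theorem exists_hamVF_leading_term {f g : Phase → Phase} (hf : IsSympGerm f) (hg : IsSympGerm g)
    (hf' : fderiv ℝ f 0 = ContinuousLinearMap.id ℝ Phase)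
    (hg' : fderiv ℝ g 0 = ContinuousLinearMap.id ℝ Phase) {k : ℕ}
    (h : (fun z => f z - g z) =o[𝓝 0] fun z => ‖z‖ ^ k) :
    ∃ G ∈ homPoly (k + 2), (fun z => f z - g z - hamVF G z) =o[𝓝 0] fun z => ‖z‖ ^ (k + 1) := by
  have smooth : ContDiffAt ℝ ∞ (fun z => f z - g z) 0 :=
    hf.1.2.self_of_nhds.sub hg.1.2.self_of_nhds
  have smooth_nat (m : ℕ) := smooth.of_le (m := m) (by exact_mod_cast le_top)
  have lower_zero := (isLittleO_norm_pow_iff_iteratedFDeriv_eq_zero (smooth_nat k)).1 h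
  have leading := isLittleO_sub_leading_term (smooth_nat (k + 1)) fun j hj =>
    lower_zero j (Nat.lt_succ_iff.1 hj)
  let D := ((k + 1).factorial : ℝ)⁻¹ • iteratedFDeriv ℝ (k + 1) (fun z => f z - g z) 0
  let d : Phase → Phase := fun z => D fun _ => z
  have hd : ContDiff ℝ ∞ d := D.contDiff.comp (contDiff_pi.2 fun _ => contDiff_id)
  have hom : IsPosHomogeneous (k + 1) d := isPosHomogeneous_diagonal D
  refine ⟨hamFun (k + 1) d, ⟨contDiff_hamFun hd, hom.hamFun⟩, ?_⟩
  rwa [hamVF_hamFun (hd.differentiable (by simp)) hom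
    (hf.isInfinitesimallySymplectic_of_leading hg hf' hg' hd hom leading)]

/-- A class of symplectic germs tangent to the identity whose infinitesimal generators are given
by `V` is exhausted, up to jets, by the germs with generating functions in `V`. -/
theorem exists_gen_approx {V : ℕ → Submodule ℝ (Phase → ℝ)} (hV : ∀ k, V k ≤ homPoly k)
    {p : (Phase → Phase) → Prop} (hgen : ∀ n (c : (j : Fin n) → V (j + 3)), p (gen (polySum V n c)))
    (hlead : ∀ f g k G, G ∈ homPoly (k + 1) → p f → p g →
      (fun z => f z - g z - hamVF G z) =o[𝓝 0] (fun z => ‖z‖ ^ k) → G ∈ V (k + 1))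
    {f : Phase → Phase} (hf : IsSympGerm f) (hf' : fderiv ℝ f 0 = ContinuousLinearMap.id ℝ Phase)
    (hpf : p f) (n : ℕ) :
    ∃ c : (j : Fin n) → V (j + 3),
      (fun z => f z - gen (polySum V n c) z) =o[𝓝 0] fun z => ‖z‖ ^ (n + 1) := by
  induction n with
  | zero =>
    refine ⟨fun j => j.elim0, ?_⟩
    have adm := isAdm_polySum hV (n := 0) fun j => j.elim0
    have f_near_id := isLittleO_sub_id_of_hasFDerivAt
      (hf' ▸ (hf.1.2.self_of_nhds.differentiableAt (by simp)).hasFDerivAt) hf.1.1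
    have gen_near_id :=
      isLittleO_sub_id_of_hasFDerivAt adm.hasStrictFDerivAt_gen.hasFDerivAt adm.gen_zero
    simpa using f_near_id.sub gen_near_id
  | succ n ih =>
    obtain ⟨c, hc⟩ := ih
    have adm := isAdm_polySum hV c
    obtain ⟨G, hG, leading⟩ := exists_hamVF_leading_term hf adm.isSympGerm_gen hf'
      adm.hasStrictFDerivAt_gen.hasFDerivAt.fderiv hc
    have G_mem : G ∈ V (n + 3) := hlead f _ _ G hG hpf (hgen n c) leading
    let c' := Fin.snoc (α := fun j : Fin (n + 1) => V (j + 3)) c ⟨G, G_mem⟩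
    have gen_diff := gen_sub_gen adm (isAdm_polySum hV c') hG.1 hG.2 <|
      (isLittleO_zero _ _).congr_left fun z => by rw [polySum_snoc]; ring
    refine ⟨c', (leading.sub gen_diff).congr_left fun z => ?_⟩
    abel

theorem omega_eq_zero_of_mem_cornerPlane {σ : Set (Fin 2)} {u v : Phase} (hu : u ∈ cornerPlane σ)
    (hv : v ∈ cornerPlane σ) : omega u v = 0 := by
  rw [mem_cornerPlane_iff] at hu hv
  refine Finset.sum_eq_zero fun i _ => ?_
  by_cases hi : i ∈ σ
  · simp [hu.1 i hi, hv.1 i hi]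
  · simp [hu.2 i hi, hv.2 i hi]

theorem cornerL_subset_cornerPlane (σ : Set (Fin 2)) : cornerL σ ⊆ cornerPlane σ :=
  fun _ hz => (mem_cornerL_iff.1 hz).1

theorem smul_mem_cornerL {σ : Set (Fin 2)} {z : Phase} (hz : z ∈ cornerL σ) {s : ℝ} (hs : 0 ≤ s) :
    s • z ∈ cornerL σ := by
  rw [mem_cornerL_iff] at hz ⊢
  exact ⟨Submodule.smul_mem _ s hz.1, fun i hi => mul_nonneg hs (hz.2 i hi)⟩

theorem tendsto_smul_cornerL {σ : Set (Fin 2)} {z : Phase} (hz : z ∈ cornerL σ) :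
    Tendsto (fun s : ℝ => s • z) (𝓝[>] 0) (𝓝[cornerL σ] 0) :=
  tendsto_nhdsWithin_iff.2 ⟨tendsto_smul_nhdsGT_zero z,
    eventually_mem_nhdsWithin.mono fun _ hs => smul_mem_cornerL hz (le_of_lt hs)⟩

theorem exists_add_smul_mem_cornerL (σ : Set (Fin 2)) :
    ∃ u, ∀ z ∈ cornerPlane σ, ∀ s : ℝ, ‖z‖ ≤ s → z + s • u ∈ cornerL σ := by
  refine ⟨cornerNormal σᶜ (1, 0), fun z hz s hs => ?_⟩
  have u_mem : cornerNormal σᶜ (1, 0) ∈ cornerPlane σ :=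
    sub_cornerNormal σ (1, 0) ▸ sub_cornerNormal_mem_cornerPlane σ (1, 0)
  refine mem_cornerL_iff.2 ⟨add_mem hz (Submodule.smul_mem _ s u_mem), fun i hi => ?_⟩
  have lower := (neg_le_of_abs_le ((norm_le_pi_norm z.1 i).trans ((norm_fst_le z).trans hs)))
  simpa [cornerNormal_apply, hi] using neg_le_iff_add_nonneg.1 lower

theorem IsPosHomogeneous.contDiff_omega {E F : Type*} [NormedAddCommGroup E] [NormedSpace ℝ E]
    [NormedAddCommGroup F] [NormedSpace ℝ F] {P : E → F} {k : ℕ} (hP : IsPosHomogeneous k P)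
    (hs : ContDiff ℝ ∞ P) : ContDiff ℝ ω P := by
  rw [show P = _ from funext (hP.eq_diagonal hs)]
  exact (ContinuousMultilinearMap.contDiff _).comp (contDiff_pi.2 fun _ => contDiff_id)

theorem eq_zero_on_cornerPlane {K : Phase → ℝ} (hK : ContDiff ℝ ω K) {σ : Set (Fin 2)}
    (h : ∀ z ∈ cornerL σ, K z = 0) {z : Phase} (hz : z ∈ cornerPlane σ) : K z = 0 := by
  obtain ⟨u, hu⟩ := exists_add_smul_mem_cornerL σ
  have analytic : AnalyticOnNhd ℝ (fun s : ℝ => K (z + s • u)) Set.univ :=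
    contDiff_omega_iff_analyticOnNhd.1
      (hK.comp (contDiff_const.add (contDiff_id.smul contDiff_const)))
  have eventually_zero : (fun s : ℝ => K (z + s • u)) =ᶠ[𝓝 (‖z‖ + 1)] fun _ => 0 :=
    (lt_mem_nhds (lt_add_one ‖z‖)).mono fun s hs => h _ (hu z hz s (le_of_lt hs))
  simpa using congrFun (analytic.eq_of_eventuallyEq analyticOnNhd_const eventually_zero) 0

theorem mem_retPoly_of_leading {f g : Phase → Phase} {k : ℕ} {G : Phase → ℝ}
    (hG : G ∈ homPoly (k + 1))
    (hf : ∀ σ, ∀ᶠ z in 𝓝[cornerL σ] 0, f z ∈ cornerL σ)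
    (hg : ∀ σ, ∀ᶠ z in 𝓝[cornerL σ] 0, g z ∈ cornerL σ)
    (h : (fun z => f z - g z - hamVF G z) =o[𝓝 0] fun z => ‖z‖ ^ k) : G ∈ retPoly (k + 1) := by
  refine ⟨hG, fun σ z hz => eq_zero_on_cornerPlane (hG.2.contDiff_omega hG.1) (fun z hz => ?_) hz⟩
  have hamVF_mem : hamVF G z ∈ cornerPlane σ := by
    refine (cornerPlane σ).closed_of_finiteDimensional.mem_of_tendsto
      ((hG.2.hamVF hG.1).tendsto_ray h z) ?_
    filter_upwards [(tendsto_smul_cornerL hz).eventually ((hf σ).and (hg σ))] with s hs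
    exact Submodule.smul_mem _ _
      (sub_mem (cornerL_subset_cornerPlane σ hs.1) (cornerL_subset_cornerPlane σ hs.2))
  have euler := hG.2.euler (hG.1.differentiable (by simp) z)
  rw [← omega_hamVF,
    omega_eq_zero_of_mem_cornerPlane hamVF_mem (cornerL_subset_cornerPlane σ hz)] at euler
  exact (smul_eq_zero.1 euler.symm).resolve_left (by positivity)

theorem eq_add_of_hasFDerivAt_const {E F : Type*} [NormedAddCommGroup E] [NormedSpace ℝ E]
    [NormedAddCommGroup F] [NormedSpace ℝ F] {f : E → F} {L : E →L[ℝ] F}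
    (h : ∀ x, HasFDerivAt f L x) (x : E) : f x = f 0 + L x := by
  have deriv_zero (x : E) : HasFDerivAt (fun x => f x - L x) (0 : E →L[ℝ] F) x :=
    sub_self L ▸ (h x).sub L.hasFDerivAt
  have const := is_const_of_fderiv_eq_zero (𝕜 := ℝ) (fun x => (deriv_zero x).differentiableAt)
    (fun x => (deriv_zero x).fderiv) x 0
  rw [map_zero, sub_zero] at const
  rw [← const, sub_add_cancel]

theorem affineInP_of_hamVF {G : Phase → ℝ} (hG : Differentiable ℝ G)
    (h : ∀ q P, (hamVF G (q, P)).1 = (hamVF G (q, 0)).1) : AffineInP G := by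
  intro q P
  let L : Plane →L[ℝ] ℝ := fderiv ℝ G (q, 0) ∘L ContinuousLinearMap.inr ℝ Plane Plane
  have deriv_const (P : Plane) : HasFDerivAt (fun P => G (q, P)) L P := by
    refine ((hG (q, P)).hasFDerivAt.comp P (hasFDerivAt_prodMk_right q P)).congr_fderiv ?_
    ext v
    simp [L, ← omega_hamVF, omega_eq, h q P]
  have affine (P : Plane) : G (q, P) = G (q, 0) + L P := eq_add_of_hasFDerivAt_const deriv_const P
  simp only [affine (Pi.single _ 1), add_sub_cancel_left]
  rw [affine P]
  congr 1
  conv_lhs => rw [← Finset.univ_sum_single P, map_sum]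
  refine Finset.sum_congr rfl fun i _ => ?_
  rw [← smul_eq_mul, ← map_smul, ← Pi.single_smul, smul_eq_mul, mul_one]

theorem mem_lagPoly_of_leading {f g : Phase → Phase} {k : ℕ} {G : Phase → ℝ}
    (hG : G ∈ homPoly (k + 1))
    (hf : ∃ b : Plane → Plane, ∀ᶠ z in 𝓝 0, (f z).1 = b z.1)
    (hg : ∃ b : Plane → Plane, ∀ᶠ z in 𝓝 0, (g z).1 = b z.1)
    (h : (fun z => f z - g z - hamVF G z) =o[𝓝 0] fun z => ‖z‖ ^ k) : G ∈ lagPoly (k + 1) := by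
  obtain ⟨b, hb⟩ := hf
  obtain ⟨b', hb'⟩ := hg
  refine ⟨hG, affineInP_of_hamVF (hG.1.differentiable (by simp)) fun q P => ?_⟩
  have lim z := (continuous_fst.tendsto _).comp ((hG.2.hamVF hG.1).tendsto_ray h z)
  refine tendsto_nhds_unique (lim (q, P)) ((lim (q, 0)).congr' ?_)
  filter_upwards [(tendsto_smul_nhdsGT_zero (q, P)).eventually (hb.and hb'),
    (tendsto_smul_nhdsGT_zero (q, (0 : Plane))).eventually (hb.and hb')] with s hs hs'
  simp only [Function.comp, Prod.smul_fst, Prod.fst_sub, hs.1, hs.2, hs'.1, hs'.2]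

theorem IsReticular.eventually_mem {φ : Phase → Phase} (h : IsReticular φ) (σ : Set (Fin 2)) :
    ∀ᶠ z in 𝓝[cornerL σ] 0, φ z ∈ cornerL σ :=
  Tendsto.eventually (h.2 σ).le eventually_mem_nhdsWithin

theorem exists_gen_approx_of_reticular {φ : Phase → Phase} (hφ : IsReticular φ)
    (hφ' : fderiv ℝ φ 0 = ContinuousLinearMap.id ℝ Phase) (n : ℕ) :
    ∃ c : (j : Fin n) → retPoly (j + 3),
      (fun z => φ z - gen (polySum retPoly n c) z) =o[𝓝 0] fun z => ‖z‖ ^ (n + 1) :=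
  exists_gen_approx retPoly_le
    (p := fun f => ∀ σ, ∀ᶠ z in 𝓝[cornerL σ] 0, f z ∈ cornerL σ)
    (fun _ c => ((isAdm_polySum retPoly_le c).isReticular_gen
      (vanishesOnCorners_polySum c)).eventually_mem)
    (fun _ _ _ _ hG hf hg h => mem_retPoly_of_leading hG hf hg h) hφ.1 hφ' hφ.eventually_mem n

theorem exists_gen_approx_of_lagrangian {Θ : Phase → Phase} (hΘ : IsLagrangianEquivalence Θ)
    (hΘ' : fderiv ℝ Θ 0 = ContinuousLinearMap.id ℝ Phase) (n : ℕ) :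
    ∃ c : (j : Fin n) → lagPoly (j + 3),
      (fun z => Θ z - gen (polySum lagPoly n c) z) =o[𝓝 0] fun z => ‖z‖ ^ (n + 1) :=
  exists_gen_approx lagPoly_le
    (p := fun f => ∃ b : Plane → Plane, ∀ᶠ z in 𝓝 0, (f z).1 = b z.1)
    (fun _ c => by
      obtain ⟨-, b, -, h⟩ := (isAdm_polySum lagPoly_le c).isLagrangianEquivalence_gen
        (affineInP_polySum c)
      exact ⟨b, h⟩)
    (fun _ _ _ _ hG hf hg h => mem_lagPoly_of_leading hG hf hg h) hΘ.1 hΘ'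
    (hΘ.2.imp fun _ hb => hb.2) n

/-! ### The groups of symplectic germs, reticular germs and Lagrangian equivalences -/

/-- Linear maps preserving the symplectic form. -/
def IsSympLin (T : Phase →L[ℝ] Phase) : Prop := ∀ u v, omega (T u) (T v) = omega u v

namespace IsSympLin

variable {T T' : Phase →L[ℝ] Phase}

theorem injective (hT : IsSympLin T) : Function.Injective T := by
  refine (injective_iff_map_eq_zero T).2 fun u hu => eq_zero_of_omega_eq_zero fun v => ?_
  rw [← hT, hu, ← omegaL_apply, map_zero, zero_apply]

theorem exists_equiv (hT : IsSympLin T) : ∃ e : Phase ≃L[ℝ] Phase, (e : Phase →L[ℝ] Phase) = T :=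
  ⟨(LinearEquiv.ofInjectiveEndo (T : Phase →ₗ[ℝ] Phase) hT.injective).toContinuousLinearEquiv,
    ContinuousLinearMap.ext fun _ => rfl⟩

theorem exists_inverse (hT : IsSympLin T) :
    ∃ T', IsSympLin T' ∧ (∀ z, T' (T z) = z) ∧ ∀ z, T (T' z) = z := by
  obtain ⟨e, rfl⟩ := hT.exists_equiv
  refine ⟨e.symm, fun u v => ?_, e.symm_apply_apply, e.apply_symm_apply⟩
  simpa using (hT (e.symm u) (e.symm v)).symm

theorem isSympGerm (hT : IsSympLin T) : IsSympGerm T :=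
  ⟨⟨map_zero T, Eventually.of_forall fun _ => T.contDiff.contDiffAt⟩,
    Eventually.of_forall fun z u v => by rw [T.fderiv]; exact hT u v⟩

theorem comp (hT : IsSympLin T) (hT' : IsSympLin T') : IsSympLin (T ∘L T') :=
  fun u v => (hT _ _).trans (hT' u v)

end IsSympLin

theorem omega_single_right (u : Phase) (i : Fin 2) : omega u (0, Pi.single i 1) = u.1 i := by
  fin_cases i <;> simp [omega_eq]

theorem fst_inverse_apply_eq_zero {T T' : Phase →L[ℝ] Phase} (hT : IsSympLin T)
    (inv : ∀ z, T (T' z) = z) (h : ∀ p, (T (0, p)).1 = 0) (p : Plane) : (T' (0, p)).1 = 0 := by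
  funext i
  rw [← omega_single_right, ← hT, inv]
  simp [omega_eq, h]

namespace IsSympGerm

variable {S T : Phase → Phase}

theorem isSympLin_fderiv (hS : IsSympGerm S) : IsSympLin (fderiv ℝ S 0) := hS.2.self_of_nhds

theorem tendsto (hS : IsSympGerm S) : Tendsto S (𝓝 0) (𝓝 0) := by
  simpa only [hS.1.1] using hS.1.2.self_of_nhds.continuousAt.tendsto

theorem hasFDerivAt (hS : IsSympGerm S) : HasFDerivAt S (fderiv ℝ S 0) 0 :=
  (hS.1.2.self_of_nhds.differentiableAt (by simp)).hasFDerivAt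

theorem comp (hS : IsSympGerm S) (hT : IsSympGerm T) : IsSympGerm (S ∘ T) := by
  refine ⟨⟨by simp only [Function.comp, hT.1.1, hS.1.1], ?_⟩, ?_⟩
  · filter_upwards [hT.1.2, hT.tendsto.eventually hS.1.2] with z hTz hSz using hSz.comp z hTz
  · filter_upwards [hT.1.2, hT.tendsto.eventually hS.1.2, hT.2, hT.tendsto.eventually hS.2]
      with z hTz hSz symp_T symp_S u v
    rw [fderiv_comp z (hSz.differentiableAt (by simp)) (hTz.differentiableAt (by simp))]
    exact (symp_S _ _).trans (symp_T u v)

theorem exists_inverse (hS : IsSympGerm S) :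
    ∃ T, IsSympGerm T ∧ (∀ᶠ z in 𝓝 0, T (S z) = z) ∧ ∀ᶠ z in 𝓝 0, S (T z) = z := by
  obtain ⟨e, he⟩ := hS.isSympLin_fderiv.exists_equiv
  obtain ⟨T, T_zero, T_smooth, left_inv, right_inv⟩ :=
    exists_smooth_local_inverse hS.1.2 (he ▸ hS.hasFDerivAt)
  rw [hS.1.1] at T_zero T_smooth right_inv
  refine ⟨T, ⟨⟨T_zero, T_smooth⟩, ?_⟩, left_inv, right_inv⟩
  have T_tendsto : Tendsto T (𝓝 0) (𝓝 0) := by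
    simpa only [T_zero] using T_smooth.self_of_nhds.continuousAt.tendsto
  filter_upwards [T_smooth, T_tendsto.eventually hS.1.2, T_tendsto.eventually hS.2,
    right_inv.eventually_nhds] with z hTz hSz symp_S hz u v
  have deriv_comp : fderiv ℝ S (T z) ∘L fderiv ℝ T z = ContinuousLinearMap.id ℝ Phase := by
    rw [← fderiv_comp z (hSz.differentiableAt (by simp)) (hTz.differentiableAt (by simp)),
      ← fderiv_id (x := z)]
    exact EventuallyEq.fderiv_eq hz
  have deriv_apply (w : Phase) : fderiv ℝ S (T z) (fderiv ℝ T z w) = w :=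
    DFunLike.congr_fun deriv_comp w
  rw [← symp_S, deriv_apply, deriv_apply]

end IsSympGerm

theorem map_map_nhdsWithin_of_leftInverse {X Y : Type*} [TopologicalSpace X] {f : X → Y}
    {g : Y → X} {a : X} {s : Set X} (h : ∀ᶠ x in 𝓝 a, g (f x) = x) :
    map g (map f (𝓝[s] a)) = 𝓝[s] a := by
  rw [map_map, map_congr (m₁ := g ∘ f) (m₂ := id) (h.filter_mono nhdsWithin_le_nhds), map_id]

theorem IsReticular.comp {φ ψ : Phase → Phase} (hφ : IsReticular φ) (hψ : IsReticular ψ) :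
    IsReticular (φ ∘ ψ) :=
  ⟨hφ.1.comp hψ.1, fun σ => by rw [← map_map, hψ.2, hφ.2]⟩

theorem IsReticular.exists_inverse {φ : Phase → Phase} (hφ : IsReticular φ) :
    ∃ ψ, IsReticular ψ ∧ (∀ᶠ z in 𝓝 0, ψ (φ z) = z) ∧ ∀ᶠ z in 𝓝 0, φ (ψ z) = z := by
  obtain ⟨ψ, hψ, left_inv, right_inv⟩ := hφ.1.exists_inverse
  refine ⟨ψ, ⟨hψ, fun σ => ?_⟩, left_inv, right_inv⟩
  conv_lhs => rw [← hφ.2 σ, map_map_nhdsWithin_of_leftInverse left_inv]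

theorem exists_reticular_factor {S S' : Phase → Phase} (hS : IsSympGerm S) (hS' : IsSympGerm S')
    (h : ∀ σ, map S (𝓝[cornerL σ] 0) = map S' (𝓝[cornerL σ] 0)) :
    ∃ φ, IsReticular φ ∧ S =ᶠ[𝓝 0] S' ∘ φ := by
  obtain ⟨T, hT, left_inv, right_inv⟩ := hS'.exists_inverse
  refine ⟨T ∘ S, ⟨hT.comp hS, fun σ => ?_⟩, ?_⟩
  · rw [← map_map, h, map_map_nhdsWithin_of_leftInverse left_inv]
  · exact (hS.tendsto.eventually right_inv).mono fun z hz => hz.symm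

theorem IsDiffeoGerm.comp {g g' : Plane → Plane} (hg : IsDiffeoGerm g) (hg' : IsDiffeoGerm g') :
    IsDiffeoGerm (g ∘ g') := by
  have g'_smooth := hg'.1.2.self_of_nhds
  have tendsto : Tendsto g' (𝓝 0) (𝓝 0) := by
    simpa only [hg'.1.1] using g'_smooth.continuousAt.tendsto
  refine ⟨⟨by simp only [Function.comp, hg'.1.1, hg.1.1], ?_⟩, ?_⟩
  · filter_upwards [hg'.1.2, tendsto.eventually hg.1.2] with z hz' hz using hz.comp z hz'
  · rw [fderiv_comp 0 (hg'.1.1.symm ▸ hg.1.2.self_of_nhds.differentiableAt (by simp))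
      (g'_smooth.differentiableAt (by simp)), hg'.1.1]
    exact hg.2.comp hg'.2

theorem IsLagrangianEquivalence.comp {Θ Θ' : Phase → Phase} (h : IsLagrangianEquivalence Θ)
    (h' : IsLagrangianEquivalence Θ') : IsLagrangianEquivalence (Θ ∘ Θ') := by
  obtain ⟨hs, g, hg, hb⟩ := h
  obtain ⟨hs', g', hg', hb'⟩ := h'
  refine ⟨hs.comp hs', g ∘ g', hg.comp hg', ?_⟩
  filter_upwards [hb', hs'.tendsto.eventually hb] with z covers' covers
  simp only [Function.comp, covers, covers']

theorem IsSympLin.isLagrangianEquivalence {T : Phase →L[ℝ] Phase} (hT : IsSympLin T)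
    (h : ∀ p, (T (0, p)).1 = 0) : IsLagrangianEquivalence T := by
  let g : Plane →L[ℝ] Plane :=
    ContinuousLinearMap.fst ℝ Plane Plane ∘L T ∘L ContinuousLinearMap.inl ℝ Plane Plane
  have g_injective : Function.Injective (g : Plane →ₗ[ℝ] Plane) := by
    refine (injective_iff_map_eq_zero _).2 fun q (hq : (T (q, 0)).1 = 0) => ?_
    funext i
    have symp := hT (q, 0) (0, Pi.single i 1)
    rw [omega_single_right] at symp
    simpa [omega_eq, hq, h] using symp.symm
  refine ⟨hT.isSympGerm, g, ⟨⟨map_zero g, Eventually.of_forall fun _ => g.contDiff.contDiffAt⟩, ?_⟩,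
    Eventually.of_forall fun z => ?_⟩
  · rw [g.fderiv]
    exact ⟨g_injective, LinearMap.injective_iff_surjective.1 g_injective⟩
  · have split : T z = T (z.1, 0) + T (0, z.2) := by rw [← map_add]; simp
    rw [split, Prod.fst_add, h, add_zero]
    rfl

theorem hasDerivAt_comp_smul {E F : Type*} [NormedAddCommGroup E] [NormedSpace ℝ E]
    [NormedAddCommGroup F] [NormedSpace ℝ F] {f : E → F} {f' : E →L[ℝ] F}
    (h : HasFDerivAt f f' 0) (z : E) : HasDerivAt (fun s : ℝ => f (s • z)) (f' z) 0 := by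
  simpa [HasLineDerivAt] using h.hasLineDerivAt z

theorem IsLagrangianEquivalence.fderiv_fst {Θ : Phase → Phase} (h : IsLagrangianEquivalence Θ)
    (p : Plane) : (fderiv ℝ Θ 0 (0, p)).1 = 0 := by
  obtain ⟨hs, g, -, hb⟩ := h
  have deriv := (ContinuousLinearMap.fst ℝ Plane Plane).hasFDerivAt.comp_hasDerivAt (0 : ℝ)
    (hasDerivAt_comp_smul hs.hasFDerivAt (0, p))
  refine deriv.unique ((hasDerivAt_const (0 : ℝ) (g 0)).congr_of_eventuallyEq ?_)
  have ray : Tendsto (fun s : ℝ => s • ((0 : Plane), p)) (𝓝 0) (𝓝 0) :=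
    Continuous.tendsto' (by fun_prop) 0 0 (zero_smul ℝ _)
  filter_upwards [ray.eventually hb] with s hs
  simpa using hs

theorem isClosed_cornerL (σ : Set (Fin 2)) : IsClosed (cornerL σ) := by
  have eq_inter : cornerL σ = (cornerPlane σ : Set Phase) ∩ ⋂ i ∈ σᶜ, {z : Phase | 0 ≤ z.1 i} := by
    ext z
    simp [mem_cornerL_iff]
  rw [eq_inter]
  exact (cornerPlane σ).closed_of_finiteDimensional.inter
    (isClosed_biInter fun i _ => isClosed_le continuous_const (by fun_prop))

theorem IsReticular.fderiv_mem_cornerL {φ : Phase → Phase} (h : IsReticular φ) {σ : Set (Fin 2)}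
    {z : Phase} (hz : z ∈ cornerL σ) : fderiv ℝ φ 0 z ∈ cornerL σ := by
  refine (isClosed_cornerL σ).mem_of_tendsto
    (hasDerivAt_comp_smul h.1.hasFDerivAt z).tendsto_slope_zero_right ?_
  filter_upwards [(tendsto_smul_cornerL hz).eventually (h.eventually_mem σ), self_mem_nhdsWithin]
    with s hs hs_pos
  simpa [h.1.1.1] using smul_mem_cornerL hs (inv_nonneg.2 (le_of_lt hs_pos))

/-! ### Linear normal forms -/

/-- `(x, p) ↦ (D x, D⁻¹ p)` for a diagonal matrix `D`: the linear reticular diffeomorphisms when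
the entries of `D` are positive. -/
noncomputable def diagMap (D : Fin 2 → ℝ) : Phase →L[ℝ] Phase :=
  LinearMap.toContinuousLinearMap
    { toFun := fun z => (fun i => D i * z.1 i, fun i => (D i)⁻¹ * z.2 i)
      map_add' := fun u v => by ext i <;> simp [mul_add]
      map_smul' := fun c u => by ext i <;> simp <;> ring }

theorem diagMap_apply (D : Fin 2 → ℝ) (z : Phase) :
    diagMap D z = (fun i => D i * z.1 i, fun i => (D i)⁻¹ * z.2 i) := rfl

theorem diagMap_fst_zero (D : Fin 2 → ℝ) (p : Plane) : (diagMap D (0, p)).1 = 0 := by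
  ext i
  simp [diagMap_apply]

/-- `(x, p) ↦ (-(p + M x), x)`, where `M` is the symmetric matrix with diagonal entries `M 0`, `M 2`
and off-diagonal entry `M 1`: an extension of the embedding with generating family
`½ ⟨x, M x⟩ + ⟨q, x⟩`. -/
noncomputable def quadMap (M : Fin 3 → ℝ) : Phase →L[ℝ] Phase :=
  LinearMap.toContinuousLinearMap
    { toFun := fun z => (![-(z.2 0 + M 0 * z.1 0 + M 1 * z.1 1),
        -(z.2 1 + M 1 * z.1 0 + M 2 * z.1 1)], z.1)
      map_add' := fun u v => by ext i <;> fin_cases i <;> simp <;> ring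
      map_smul' := fun c u => by ext i <;> fin_cases i <;> simp <;> ring }

theorem quadMap_apply (M : Fin 3 → ℝ) (z : Phase) :
    quadMap M z = (![-(z.2 0 + M 0 * z.1 0 + M 1 * z.1 1),
        -(z.2 1 + M 1 * z.1 0 + M 2 * z.1 1)], z.1) := rfl

/-- The determinant of the matrix with rows `g 0, g 1` and `g 2, g 3`. -/
def detMap (g : Fin 4 → ℝ) : ℝ := g 0 * g 3 - g 1 * g 2

/-- `(q, p) ↦ (g q, g⁻ᵀ (p + w q))`, where `g` is the matrix with rows `g 0, g 1` and `g 2, g 3`,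
and `w` is the symmetric matrix with diagonal entries `w 0`, `w 2` and off-diagonal entry `w 1`: the
linear Lagrangian equivalences when `detMap g ≠ 0`. -/
noncomputable def affMap (g : Fin 4 → ℝ) (w : Fin 3 → ℝ) : Phase →L[ℝ] Phase :=
  LinearMap.toContinuousLinearMap
    { toFun := fun z => (![g 0 * z.1 0 + g 1 * z.1 1, g 2 * z.1 0 + g 3 * z.1 1],
        ![(g 3 * (z.2 0 + w 0 * z.1 0 + w 1 * z.1 1) -
            g 2 * (z.2 1 + w 1 * z.1 0 + w 2 * z.1 1)) / detMap g,
          (g 0 * (z.2 1 + w 1 * z.1 0 + w 2 * z.1 1) -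
            g 1 * (z.2 0 + w 0 * z.1 0 + w 1 * z.1 1)) / detMap g])
      map_add' := fun u v => by ext i <;> fin_cases i <;> simp <;> ring
      map_smul' := fun c u => by ext i <;> fin_cases i <;> simp <;> ring }

theorem affMap_apply (g : Fin 4 → ℝ) (w : Fin 3 → ℝ) (z : Phase) :
    affMap g w z = (![g 0 * z.1 0 + g 1 * z.1 1, g 2 * z.1 0 + g 3 * z.1 1],
        ![(g 3 * (z.2 0 + w 0 * z.1 0 + w 1 * z.1 1) -
            g 2 * (z.2 1 + w 1 * z.1 0 + w 2 * z.1 1)) / detMap g,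
          (g 0 * (z.2 1 + w 1 * z.1 0 + w 2 * z.1 1) -
            g 1 * (z.2 0 + w 0 * z.1 0 + w 1 * z.1 1)) / detMap g]) := rfl

theorem affMap_fst_zero (g : Fin 4 → ℝ) (w : Fin 3 → ℝ) (p : Plane) :
    (affMap g w (0, p)).1 = 0 := by
  ext i
  fin_cases i <;> simp [affMap_apply]

theorem isSympLin_diagMap {D : Fin 2 → ℝ} (hD : ∀ i, D i ≠ 0) : IsSympLin (diagMap D) := by
  intro u v
  have hD0 := hD 0
  have hD1 := hD 1
  simp only [diagMap_apply, omega_eq]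
  field_simp

theorem isSympLin_quadMap (M : Fin 3 → ℝ) : IsSympLin (quadMap M) := by
  intro u v
  simp only [quadMap_apply, omega_eq, Matrix.cons_val_zero, Matrix.cons_val_one]
  ring

theorem isSympLin_affMap {g : Fin 4 → ℝ} (hg : detMap g ≠ 0) (w : Fin 3 → ℝ) :
    IsSympLin (affMap g w) := by
  intro u v
  simp only [affMap_apply, omega_eq, Matrix.cons_val_zero, Matrix.cons_val_one]
  field_simp
  simp only [detMap]
  ring

theorem isReticular_diagMap {D : Fin 2 → ℝ} (hD : ∀ i, 0 < D i) : IsReticular (diagMap D) := by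
  have hs := isSympLin_diagMap fun i => (hD i).ne'
  refine ⟨hs.isSympGerm, fun σ => map_nhdsWithin_of_mem_iff ?_ (Eventually.of_forall fun z => ?_)⟩
  · obtain ⟨e, he⟩ := hs.exists_equiv
    simpa [← he] using e.toHomeomorph.map_nhds_eq 0
  · simp [cornerL, diagMap_apply, (hD _).ne', mul_nonneg_iff_of_pos_left (hD _)]

theorem single_fst_mem_cornerL {σ : Set (Fin 2)} {i : Fin 2} (hi : i ∉ σ) :
    ((Pi.single i 1, 0) : Phase) ∈ cornerL σ :=
  ⟨fun _ hj => Pi.single_eq_of_ne (ne_of_mem_of_not_mem hj hi) 1,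
    fun j _ => ⟨rfl, (Pi.single_nonneg.2 zero_le_one : (0 : Plane) ≤ Pi.single i 1) j⟩⟩

theorem single_snd_mem_cornerL {σ : Set (Fin 2)} {i : Fin 2} (hi : i ∈ σ) :
    ((0, Pi.single i 1) : Phase) ∈ cornerL σ :=
  ⟨fun _ _ => rfl,
    fun _ hj => ⟨Pi.single_eq_of_ne (ne_of_mem_of_not_mem hi hj).symm 1, le_rfl⟩⟩

theorem exists_eq_diagMap {T : Phase →L[ℝ] Phase} (hT : IsSympLin T)
    (h : ∀ σ, ∀ z ∈ cornerL σ, T z ∈ cornerL σ) :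
    ∃ D : Fin 2 → ℝ, (∀ i, 0 < D i) ∧ T = diagMap D := by
  let D (i : Fin 2) : ℝ := (T (Pi.single i 1, 0)).1 i
  let D' (i : Fin 2) : ℝ := (T (0, Pi.single i 1)).2 i
  have image_q (i : Fin 2) : T (Pi.single i 1, 0) = (Pi.single i (D i), 0) := by
    have fst_mem := h {i}ᶜ _ (single_fst_mem_cornerL (i := i) (by simp))
    have snd_mem := h ∅ _ (single_fst_mem_cornerL (Set.notMem_empty i))
    refine Prod.ext (funext fun j => ?_) (funext fun j => (snd_mem.2 j (Set.notMem_empty j)).1)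
    rcases eq_or_ne j i with rfl | hj
    exacts [(Pi.single_eq_same (M := fun _ => ℝ) j (D j)).symm,
      (fst_mem.1 j hj).trans (Pi.single_eq_of_ne (M := fun _ => ℝ) hj (D i)).symm]
  have image_p (i : Fin 2) : T (0, Pi.single i 1) = (0, Pi.single i (D' i)) := by
    have fst_mem := h Set.univ _ (single_snd_mem_cornerL (Set.mem_univ i))
    have snd_mem := h {i} _ (single_snd_mem_cornerL (Set.mem_singleton i))
    refine Prod.ext (funext fun j => fst_mem.1 j (Set.mem_univ j)) (funext fun j => ?_)
    rcases eq_or_ne j i with rfl | hj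
    exacts [(Pi.single_eq_same (M := fun _ => ℝ) j (D' j)).symm,
      (snd_mem.2 j hj).1.trans (Pi.single_eq_of_ne (M := fun _ => ℝ) hj (D' i)).symm]
  have D_mul (i : Fin 2) : D i * D' i = 1 := by
    have symp := hT (Pi.single i 1, 0) (0, Pi.single i 1)
    rw [image_q, image_p, omega_eq, omega_eq] at symp
    fin_cases i <;> simpa using symp
  have D_nonneg (i : Fin 2) : 0 ≤ D i :=
    ((h ∅ _ (single_fst_mem_cornerL (Set.notMem_empty i))).2 i (Set.notMem_empty i)).2
  refine ⟨D, fun i => (D_nonneg i).lt_of_ne' (left_ne_zero_of_mul_eq_one (D_mul i)),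
    ContinuousLinearMap.ext fun z => ?_⟩
  conv_lhs => rw [phase_decomp z]
  simp only [map_add, map_smul, image_q, image_p, diagMap_apply,
    inv_eq_of_mul_eq_one_right (D_mul _)]
  ext i <;> fin_cases i <;> simp [mul_comm]

theorem dual_basis_entries {a b c d : Plane} (ac : a 0 * c 0 + a 1 * c 1 = 1)
    (ad : a 0 * d 0 + a 1 * d 1 = 0) (bc : b 0 * c 0 + b 1 * c 1 = 0)
    (bd : b 0 * d 0 + b 1 * d 1 = 1) :
    a 0 * b 1 - b 0 * a 1 ≠ 0 ∧
      c 0 * (a 0 * b 1 - b 0 * a 1) = b 1 ∧ c 1 * (a 0 * b 1 - b 0 * a 1) = -b 0 ∧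
      d 0 * (a 0 * b 1 - b 0 * a 1) = -a 1 ∧ d 1 * (a 0 * b 1 - b 0 * a 1) = a 0 := by
  refine ⟨left_ne_zero_of_mul_eq_one (b := c 0 * d 1 - c 1 * d 0) ?_, ?_, ?_, ?_, ?_⟩
  · linear_combination (b 0 * d 0 + b 1 * d 1) * ac + bd - (b 0 * c 0 + b 1 * c 1) * ad
  · linear_combination b 1 * ac - a 1 * bc
  · linear_combination a 0 * bc - b 0 * ac
  · linear_combination b 1 * ad - a 1 * bd
  · linear_combination a 0 * bd - b 0 * ad

theorem exists_eq_affMap {T : Phase →L[ℝ] Phase} (hT : IsSympLin T)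
    (h : ∀ p, (T (0, p)).1 = 0) : ∃ g w, detMap g ≠ 0 ∧ T = affMap g w := by
  set a := T (Pi.single 0 1, 0) with ha
  set b := T (Pi.single 1 1, 0) with hb
  set c := T (0, Pi.single 0 1) with hc
  set d := T (0, Pi.single 1 1) with hd
  have c_fst (i : Fin 2) : c.1 i = 0 := congrFun (h _) i
  have d_fst (i : Fin 2) : d.1 i = 0 := congrFun (h _) i
  have omega_ac : a.1 0 * c.2 0 + a.1 1 * c.2 1 = 1 := by
    simpa [omega_eq, ← ha, ← hc, c_fst] using hT (Pi.single 0 1, 0) (0, Pi.single 0 1)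
  have omega_ad : a.1 0 * d.2 0 + a.1 1 * d.2 1 = 0 := by
    simpa [omega_eq, ← ha, ← hd, d_fst] using hT (Pi.single 0 1, 0) (0, Pi.single 1 1)
  have omega_bc : b.1 0 * c.2 0 + b.1 1 * c.2 1 = 0 := by
    simpa [omega_eq, ← hb, ← hc, c_fst] using hT (Pi.single 1 1, 0) (0, Pi.single 0 1)
  have omega_bd : b.1 0 * d.2 0 + b.1 1 * d.2 1 = 1 := by
    simpa [omega_eq, ← hb, ← hd, d_fst] using hT (Pi.single 1 1, 0) (0, Pi.single 1 1)
  have omega_ab : a.1 0 * b.2 0 - a.2 0 * b.1 0 + (a.1 1 * b.2 1 - a.2 1 * b.1 1) = 0 := by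
    simpa [omega_eq] using hT (Pi.single 0 1, 0) (Pi.single 1 1, 0)
  obtain ⟨det_ne, c_zero, c_one, d_zero, d_one⟩ :=
    dual_basis_entries omega_ac omega_ad omega_bc omega_bd
  refine ⟨![a.1 0, b.1 0, a.1 1, b.1 1], ![a.1 0 * a.2 0 + a.1 1 * a.2 1,
    b.1 0 * a.2 0 + b.1 1 * a.2 1, b.1 0 * b.2 0 + b.1 1 * b.2 1], by simpa [detMap] using det_ne,
    ContinuousLinearMap.ext fun z => ?_⟩
  conv_lhs => rw [phase_decomp z]
  simp only [map_add, map_smul, affMap_apply, ← ha, ← hb, ← hc, ← hd, detMap]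
  ext i <;> fin_cases i
  · simp [c_fst, d_fst, mul_comm]
  · simp [c_fst, d_fst, mul_comm]
  · refine eq_div_of_mul_eq det_ne ?_
    simp only [Fin.zero_eta, Prod.snd_add, Prod.smul_snd, Pi.add_apply, Pi.smul_apply, smul_eq_mul,
      Matrix.cons_val]
    linear_combination z.2 0 * c_zero + z.2 1 * d_zero + z.1 1 * b.1 1 * omega_ab
  · refine eq_div_of_mul_eq det_ne ?_
    simp only [Fin.mk_one, Prod.snd_add, Prod.smul_snd, Pi.add_apply, Pi.smul_apply, smul_eq_mul,
      Matrix.cons_val]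
    linear_combination z.2 0 * c_one + z.2 1 * d_one - z.1 1 * b.1 0 * omega_ab

/-! ### The family of normal forms -/

/-- The parameters of the normal forms `germOf`, a vector space: a linear Lagrangian
equivalence `affMap g w`, a quadratic form, and polynomial generating functions of a Lagrangian
equivalence and of a reticular diffeomorphism. -/
abbrev Params (n : ℕ) : Type :=
  (Fin 4 → ℝ) × (Fin 3 → ℝ) × (Fin 3 → ℝ) × ((j : Fin n) → lagPoly (j + 3)) ×
    ((j : Fin n) → retPoly (j + 3))

namespace Params

variable {n : ℕ} (t : Params n)

/-- The action on the base of the linear Lagrangian equivalence. -/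
abbrev base : Fin 4 → ℝ := t.1

/-- The shear of the fibres by the linear Lagrangian equivalence. -/
abbrev shear : Fin 3 → ℝ := t.2.1

/-- The quadratic form in the generating family of the linear part. -/
abbrev quad : Fin 3 → ℝ := t.2.2.1

/-- The homogeneous components of the Lagrangian generating function. -/
abbrev lag : (j : Fin n) → lagPoly (j + 3) := t.2.2.2.1

/-- The homogeneous components of the reticular generating function. -/
abbrev ret : (j : Fin n) → retPoly (j + 3) := t.2.2.2.2

end Params

/-- The symplectic germ in normal form with parameters `t`. -/
noncomputable def germOf {n : ℕ} (t : Params n) : Phase → Phase :=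
  affMap t.base t.shear ∘ gen (polySum lagPoly n t.lag) ∘ quadMap t.quad ∘
    gen (polySum retPoly n t.ret)

/-- The quadratic forms which are `± (x₁² + x₁x₂ + a x₂²)` with `a > 1/4` up to positive rescaling
of `x₁` and `x₂`, given by the entries `M 0`, `M 1`, `M 2` of their matrices as in `quadMap`. -/
def quadSet : Set (Fin 3 → ℝ) := {M | 0 < M 0 * M 1 ∧ 0 < M 0 * M 2 - M 1 ^ 2}

/-- The parameters whose jets make up the weak caustic-equivalence class. -/
def paramSet (n : ℕ) : Set (Params n) := {t | detMap t.base ≠ 0 ∧ t.quad ∈ quadSet}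

theorem isSympGerm_germOf {n : ℕ} {t : Params n} (ht : detMap t.base ≠ 0) :
    IsSympGerm (germOf t) :=
  (isSympLin_affMap ht _).isSympGerm.comp ((isAdm_polySum lagPoly_le _).isSympGerm_gen.comp
    ((isSympLin_quadMap _).isSympGerm.comp (isAdm_polySum retPoly_le _).isSympGerm_gen))

theorem hasStrictFDerivAt_germOf {n : ℕ} (t : Params n) :
    HasStrictFDerivAt (germOf t) (affMap t.base t.shear ∘L quadMap t.quad) 0 := by
  have ret := (isAdm_polySum retPoly_le t.ret).hasStrictFDerivAt_gen
  have lag : HasStrictFDerivAt (gen (polySum lagPoly n t.lag)) (ContinuousLinearMap.id ℝ Phase)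
      (quadMap t.quad (gen (polySum retPoly n t.ret) 0)) := by
    rw [(isAdm_polySum retPoly_le t.ret).gen_zero, map_zero]
    exact (isAdm_polySum lagPoly_le t.lag).hasStrictFDerivAt_gen
  exact (affMap t.base t.shear).hasStrictFDerivAt.comp (0 : Phase)
    (lag.comp (0 : Phase) ((quadMap t.quad).hasStrictFDerivAt.comp (0 : Phase) ret))

theorem contDiffAt_germOf {n : ℕ} (t : Params n) : ContDiffAt ℝ ∞ (germOf t) 0 :=
  (affMap t.base t.shear).contDiff.contDiffAt.comp (0 : Phase)
    ((isAdm_polySum lagPoly_le t.lag).isSympGerm_gen.comp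
      ((isSympLin_quadMap t.quad).isSympGerm.comp
        (isAdm_polySum retPoly_le t.ret).isSympGerm_gen)).1.2.self_of_nhds

/-! ### Jets -/

theorem jet_congr {l : ℕ} {S T : Phase → Phase} (h : S =ᶠ[𝓝 0] T) : jet l S = jet l T :=
  funext fun k => (h.iteratedFDeriv ℝ k).self_of_nhds

theorem jet_eq_iff {l : ℕ} {S T : Phase → Phase} (hS : ContDiffAt ℝ ∞ S 0)
    (hT : ContDiffAt ℝ ∞ T 0) :
    jet l S = jet l T ↔ (fun z => S z - T z) =o[𝓝 0] fun z => ‖z‖ ^ l := by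
  rw [isLittleO_norm_pow_iff_iteratedFDeriv_eq_zero
    ((hS.sub hT).of_le (by exact_mod_cast le_top))]
  have deriv_sub (j : ℕ) : iteratedFDeriv ℝ j (fun z => S z - T z) 0 =
      iteratedFDeriv ℝ j S 0 - iteratedFDeriv ℝ j T 0 :=
    iteratedFDeriv_sub_apply (hS.of_le (by exact_mod_cast le_top))
      (hT.of_le (by exact_mod_cast le_top))
  simp only [deriv_sub, sub_eq_zero]
  exact ⟨fun h j hj => congrFun h ⟨j, by omega⟩, fun h => funext fun k => h k (by omega)⟩

theorem iteratedFDeriv_comp_clm_of_contDiffAt {E F G : Type*} [NormedAddCommGroup E]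
    [NormedSpace ℝ E] [NormedAddCommGroup F] [NormedSpace ℝ F] [NormedAddCommGroup G]
    [NormedSpace ℝ G] {f : F → G} (g : E →L[ℝ] F) {x : E} {k : ℕ}
    (hf : ContDiffAt ℝ k f (g x)) :
    iteratedFDeriv ℝ k (f ∘ g) x =
      (iteratedFDeriv ℝ k f (g x)).compContinuousLinearMap fun _ => g := by
  obtain ⟨u, hu, contDiffOn_u⟩ := hf.contDiffOn le_rfl (by simp)
  obtain ⟨v, hvu, v_open, mem_v⟩ := mem_nhds_iff.1 hu
  have preimage_open : IsOpen (g ⁻¹' v) := v_open.preimage g.continuous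
  have within := g.iteratedFDerivWithin_comp_right (contDiffOn_u.mono hvu) v_open.uniqueDiffOn
    preimage_open.uniqueDiffOn mem_v le_rfl (i := k)
  rwa [iteratedFDerivWithin_of_isOpen _ preimage_open mem_v,
    iteratedFDerivWithin_of_isOpen _ v_open mem_v] at within

theorem iteratedFDeriv_prodMk_const {E V F : Type*} [NormedAddCommGroup E] [NormedSpace ℝ E]
    [NormedAddCommGroup V] [NormedSpace ℝ V] [NormedAddCommGroup F] [NormedSpace ℝ F]
    {f : E × V → F} {s : V} {k : ℕ} (hf : ContDiffAt ℝ k f (0, s)) :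
    iteratedFDeriv ℝ k (fun z => f (z, s)) 0 = (iteratedFDeriv ℝ k f (0, s)).compContinuousLinearMap
      fun _ => ContinuousLinearMap.inl ℝ E V := by
  let shifted (p : E × V) : F := f (p + (0, s))
  have shifted_contDiffAt : ContDiffAt ℝ k shifted (ContinuousLinearMap.inl ℝ E V 0) := by
    refine ContDiffAt.comp (g := f) _ ?_ (contDiff_id.add contDiff_const).contDiffAt
    simpa using hf
  have comp_eq : (fun z => f (z, s)) = shifted ∘ ContinuousLinearMap.inl ℝ E V := by
    funext z
    simp [shifted]
  rw [comp_eq, iteratedFDeriv_comp_clm_of_contDiffAt _ shifted_contDiffAt,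
    iteratedFDeriv_comp_add_right, map_zero, zero_add]

theorem contDiffAt_jet {V : Type*} [NormedAddCommGroup V] [NormedSpace ℝ V] {l : ℕ}
    {H : Phase × V → Phase} {s₀ : V} (hH : ContDiffAt ℝ ∞ H (0, s₀)) :
    ContDiffAt ℝ ∞ (fun s => jet l fun z => H (z, s)) s₀ := by
  refine contDiffAt_pi.2 fun k => ?_
  have smooth_nearby : ∀ᶠ s in 𝓝 s₀, ContDiffAt ℝ (k : ℕ) H (0, s) :=
    (Continuous.tendsto (by fun_prop : Continuous fun s : V => ((0 : Phase), s)) s₀).eventually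
      ((hH.of_le (m := (k : ℕ)) (by exact_mod_cast le_top)).eventually (by simp))
  have smooth_deriv : ContDiffAt ℝ ∞ (fun s => iteratedFDeriv ℝ (k : ℕ) H (0, s)) s₀ :=
    (hH.iteratedFDeriv_right (m := ∞) (i := k) (by exact_mod_cast le_top)).comp s₀
      (contDiffAt_const.prodMk contDiffAt_id)
  refine ContDiffAt.congr_of_eventuallyEq ?_
    (smooth_nearby.mono fun s hs => iteratedFDeriv_prodMk_const hs)
  exact (ContinuousMultilinearMap.compContinuousLinearMapL
    (fun _ : Fin k => ContinuousLinearMap.inl ℝ Phase V)).contDiff.contDiffAt.comp s₀ smooth_deriv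

/-! ### Smoothness of the jets of the normal forms -/

theorem contDiff_quadMap : ContDiff ℝ ∞ fun p : (Fin 3 → ℝ) × Phase => quadMap p.1 p.2 := by
  simp only [quadMap_apply]
  refine ContDiff.prodMk (contDiff_pi.2 fun i => ?_) (by fun_prop)
  fin_cases i <;> simp only [Fin.zero_eta, Fin.mk_one, Matrix.cons_val] <;> fun_prop

theorem contDiffAt_affMap {g : Fin 4 → ℝ} (hg : detMap g ≠ 0) (w : Fin 3 → ℝ) (z : Phase) :
    ContDiffAt ℝ ∞ (fun p : ((Fin 4 → ℝ) × (Fin 3 → ℝ)) × Phase => affMap p.1.1 p.1.2 p.2)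
      ((g, w), z) := by
  have smooth_det : ContDiffAt ℝ ∞
      (fun p : ((Fin 4 → ℝ) × (Fin 3 → ℝ)) × Phase => detMap p.1.1) ((g, w), z) := by
    unfold detMap
    fun_prop
  simp only [affMap_apply]
  refine ContDiffAt.prodMk (contDiffAt_pi.2 fun i => ?_) (contDiffAt_pi.2 fun i => ?_)
  · fin_cases i <;> simp only [Fin.zero_eta, Fin.mk_one, Matrix.cons_val] <;> fun_prop
  · fin_cases i <;> exact ContDiffAt.div (by fun_prop) smooth_det hg

theorem exists_joint_gen_polySum {V : Type*} [NormedAddCommGroup V] [NormedSpace ℝ V]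
    [FiniteDimensional ℝ V] {W : ℕ → Submodule ℝ (Phase → ℝ)} (hW : ∀ k, W k ≤ homPoly k) {n : ℕ}
    (c : V →ₗ[ℝ] (j : Fin n) → W (j + 3)) (s₀ : V) :
    ∃ G : Phase × V → Phase, ContDiffAt ℝ ∞ G (0, s₀) ∧ G (0, s₀) = 0 ∧
      ∀ᶠ s in 𝓝 s₀, (fun z => G (z, s)) =ᶠ[𝓝 0] gen (polySum W n (c s)) := by
  have adm (s : V) := isAdm_polySum hW (c s)
  obtain ⟨G, smooth, isGen⟩ := exists_joint_gen (polySum W n ∘ₗ c) adm s₀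
  have eq_gen := isGen.mono fun s hs => hs.unique (adm s) (isGen_gen (adm s))
  exact ⟨G, smooth.self_of_nhds, eq_gen.self_of_nhds.self_of_nhds.trans (adm s₀).gen_zero, eq_gen⟩

theorem contDiffAt_affMap_comp_quadMap {V : Type*} [NormedAddCommGroup V] [NormedSpace ℝ V]
    {g : V → Fin 4 → ℝ} {w M : V → Fin 3 → ℝ} (hg : ContDiff ℝ ∞ g) (hw : ContDiff ℝ ∞ w)
    (hM : ContDiff ℝ ∞ M) {G₁ G₂ : Phase × V → Phase} {s₀ : V} (hdet : detMap (g s₀) ≠ 0)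
    (h₁ : ContDiffAt ℝ ∞ G₁ (0, s₀)) (h₂ : ContDiffAt ℝ ∞ G₂ (0, s₀)) (h₀ : G₂ (0, s₀) = 0) :
    ContDiffAt ℝ ∞ (fun p : Phase × V =>
      affMap (g p.2) (w p.2) (G₁ (quadMap (M p.2) (G₂ p), p.2))) (0, s₀) := by
  have smooth_quad : ContDiffAt ℝ ∞ (fun p : Phase × V => quadMap (M p.2) (G₂ p)) (0, s₀) :=
    contDiff_quadMap.contDiffAt.comp ((0 : Phase), s₀)
      ((hM.comp contDiff_snd).contDiffAt.prodMk h₂)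
  have smooth_inner : ContDiffAt ℝ ∞ (fun p : Phase × V => G₁ (quadMap (M p.2) (G₂ p), p.2))
      (0, s₀) := by
    refine ContDiffAt.comp (g := G₁) ((0 : Phase), s₀) ?_ (smooth_quad.prodMk contDiffAt_snd)
    simpa only [h₀, map_zero] using h₁
  exact ContDiffAt.comp
    (g := fun p : ((Fin 4 → ℝ) × (Fin 3 → ℝ)) × Phase => affMap p.1.1 p.1.2 p.2)
    ((0 : Phase), s₀) (contDiffAt_affMap hdet _ _)
    (((hg.comp contDiff_snd).contDiffAt.prodMk (hw.comp contDiff_snd).contDiffAt).prodMk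
      smooth_inner)

theorem exists_joint_germOf {V : Type*} [NormedAddCommGroup V] [NormedSpace ℝ V]
    [FiniteDimensional ℝ V] {n : ℕ} (e : V →ₗ[ℝ] Params n) {s₀ : V}
    (hs₀ : detMap (e s₀).base ≠ 0) :
    ∃ H : Phase × V → Phase, ContDiffAt ℝ ∞ H (0, s₀) ∧
      ∀ᶠ s in 𝓝 s₀, (fun z => H (z, s)) =ᶠ[𝓝 0] germOf (e s) := by
  let g := LinearMap.fst ℝ _ _ ∘ₗ e
  let tail := LinearMap.snd ℝ _ _ ∘ₗ e
  let w := LinearMap.fst ℝ _ _ ∘ₗ tail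
  let M := LinearMap.fst ℝ _ _ ∘ₗ LinearMap.snd ℝ _ _ ∘ₗ tail
  let hamiltonians := LinearMap.snd ℝ _ _ ∘ₗ LinearMap.snd ℝ _ _ ∘ₗ tail
  obtain ⟨G₁, smooth₁, -, eq_gen₁⟩ :=
    exists_joint_gen_polySum lagPoly_le (LinearMap.fst ℝ _ _ ∘ₗ hamiltonians) s₀
  obtain ⟨G₂, smooth₂, zero₂, eq_gen₂⟩ :=
    exists_joint_gen_polySum retPoly_le (LinearMap.snd ℝ _ _ ∘ₗ hamiltonians) s₀
  refine ⟨fun p => affMap (g p.2) (w p.2) (G₁ (quadMap (M p.2) (G₂ p), p.2)),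
    contDiffAt_affMap_comp_quadMap (LinearMap.toContinuousLinearMap g).contDiff
      (LinearMap.toContinuousLinearMap w).contDiff (LinearMap.toContinuousLinearMap M).contDiff
      hs₀ smooth₁ smooth₂ zero₂, ?_⟩
  filter_upwards [eq_gen₁, eq_gen₂] with s h₁ h₂
  have to_zero : Tendsto (fun z => quadMap (M s) (gen (polySum retPoly n (e s).ret) z))
      (𝓝 0) (𝓝 0) :=
    ((isSympLin_quadMap (M s)).isSympGerm.comp
      (isAdm_polySum retPoly_le (e s).ret).isSympGerm_gen).tendsto
  filter_upwards [to_zero.eventually h₁, h₂] with z hz₁ hz₂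
  exact congrArg (affMap (g s) (w s))
    ((congrArg (fun y => G₁ (quadMap (M s) y, s)) hz₂).trans hz₁)

theorem contDiffAt_jet_germOf {V : Type*} [NormedAddCommGroup V] [NormedSpace ℝ V]
    [FiniteDimensional ℝ V] {n l : ℕ} (e : V →ₗ[ℝ] Params n) {s₀ : V}
    (hs₀ : detMap (e s₀).base ≠ 0) : ContDiffAt ℝ ∞ (fun s => jet l (germOf (e s))) s₀ := by
  obtain ⟨H, smooth, eq_germOf⟩ := exists_joint_germOf e hs₀
  exact (contDiffAt_jet smooth).congr_of_eventuallyEq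
    (eq_germOf.mono fun s hs => (jet_congr hs).symm)

/-! ### Transversality of the two kinds of Hamiltonians -/

theorem IsSympLin.comp_add_eq_of_hamVF {T : Phase →L[ℝ] Phase} (hT : IsSympLin T)
    {H K : Phase → ℝ} (hH : Differentiable ℝ H) (hK : Differentiable ℝ K)
    (h : ∀ z, hamVF H (T z) + T (hamVF K z) = 0) (z : Phase) : H (T z) + K z = H 0 + K 0 := by
  have deriv_zero (z : Phase) : HasFDerivAt (fun z => H (T z) + K z) (0 : Phase →L[ℝ] ℝ) z := by
    refine (((hH (T z)).hasFDerivAt.comp z T.hasFDerivAt).add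
      (hK z).hasFDerivAt).congr_fderiv (ContinuousLinearMap.ext fun v => ?_)
    calc fderiv ℝ H (T z) (T v) + fderiv ℝ K z v
        = omegaL (hamVF H (T z)) (T v) + omegaL (T (hamVF K z)) (T v) := by
          rw [omegaL_apply, omegaL_apply, omega_hamVF, hT, omega_hamVF]
      _ = 0 := by rw [← add_apply, ← map_add, h, map_zero, zero_apply]
  simpa using is_const_of_fderiv_eq_zero (fun z => (deriv_zero z).differentiableAt)
    (fun z => (deriv_zero z).fderiv) z 0

theorem eq_zero_of_forall_coord_ne_zero {ι : Type*} {f : (ι → ℝ) → ℝ} (hf : Continuous f) (i : ι)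
    (h : ∀ q, q i ≠ 0 → f q = 0) (q : ι → ℝ) : f q = 0 := by
  classical
  have line_zero := Continuous.ext_on (dense_compl_singleton (0 : ℝ))
    (hf.comp (by fun_prop : Continuous fun s : ℝ => Function.update q i s)) continuous_const
    fun s hs => h (Function.update q i s) (by simpa using hs)
  simpa using congrFun line_zero (q i)

theorem AffineInP.eq_zero_of_vanishesOnCorners {M : Fin 3 → ℝ} (h₀ : M 0 ≠ 0) (h₂ : M 2 ≠ 0)
    {H : Phase → ℝ} (hH : Continuous H) (haff : AffineInP H)
    (h : VanishesOnCorners (H ∘ quadMap M)) : H = 0 := by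
  have zero_section (q : Plane) : H (q, 0) = 0 := by
    have quad_eq : quadMap M (0, -q) = (q, 0) := by
      ext i <;> fin_cases i <;> simp [quadMap_apply]
    rw [← quad_eq]
    exact h Set.univ (0, -q) (mem_cornerPlane_iff.2 ⟨by simp, by simp⟩)
  have linear (q P : Plane) :
      H (q, P) = P 0 * H (q, Pi.single 0 1) + P 1 * H (q, Pi.single 1 1) := by
    rw [haff q P, zero_section, zero_add, Fin.sum_univ_two, sub_zero, sub_zero]
  have coeff_zero : ∀ q, H (q, Pi.single 0 1) = 0 := by
    refine eq_zero_of_forall_coord_ne_zero (by fun_prop) 0 fun q hq => ?_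
    have quad_eq : quadMap M (![-q 0 / M 0, 0], ![0, -q 1 + M 1 * q 0 / M 0]) =
        (q, ![-q 0 / M 0, 0]) := by
      ext i <;> fin_cases i <;> simp [quadMap_apply] <;> field_simp
      ring
    have vanish := h {1} (![-q 0 / M 0, 0], ![0, -q 1 + M 1 * q 0 / M 0]) (mem_cornerPlane_iff.2
      ⟨by simp, fun i hi => by fin_cases i <;> simp at hi ⊢⟩)
    rw [Function.comp_apply, quad_eq, linear] at vanish
    simpa [hq, h₀] using vanish
  have coeff_one : ∀ q, H (q, Pi.single 1 1) = 0 := by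
    refine eq_zero_of_forall_coord_ne_zero (by fun_prop) 1 fun q hq => ?_
    have quad_eq : quadMap M (![0, -q 1 / M 2], ![-q 0 + M 1 * q 1 / M 2, 0]) =
        (q, ![0, -q 1 / M 2]) := by
      ext i <;> fin_cases i <;> simp [quadMap_apply] <;> field_simp
      ring
    have vanish := h {0} (![0, -q 1 / M 2], ![-q 0 + M 1 * q 1 / M 2, 0]) (mem_cornerPlane_iff.2
      ⟨by simp, fun i hi => by fin_cases i <;> simp at hi ⊢⟩)
    rw [Function.comp_apply, quad_eq, linear] at vanish
    simpa [hq, h₂] using vanish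
  funext ⟨q, P⟩
  rw [linear, coeff_zero, coeff_one, mul_zero, mul_zero, add_zero, Pi.zero_apply]

theorem lagPoly_retPoly_transverse {M : Fin 3 → ℝ} (h₀ : M 0 ≠ 0) (h₂ : M 2 ≠ 0) {k : ℕ}
    {H K : Phase → ℝ} (hH : H ∈ lagPoly (k + 1)) (hK : K ∈ retPoly (k + 1))
    (h : ∀ z, hamVF H (quadMap M z) + quadMap M (hamVF K z) = 0) : H = 0 ∧ K = 0 := by
  have sum_zero (z : Phase) : H (quadMap M z) + K z = 0 := by
    rw [(isSympLin_quadMap M).comp_add_eq_of_hamVF (hH.1.1.differentiable (by simp))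
      (hK.1.1.differentiable (by simp)) h z, hH.1.2.apply_zero, hK.1.2.apply_zero, add_zero]
  have H_zero : H = 0 := AffineInP.eq_zero_of_vanishesOnCorners h₀ h₂ hH.1.1.continuous hH.2
    fun σ z hz => by
      simpa only [hK.2 σ z hz, add_zero, Function.comp_apply] using sum_zero z
  exact ⟨H_zero, funext fun z => by simpa [H_zero] using sum_zero z⟩

/-! ### Separation of parameters by jets -/

theorem iteratedFDeriv_diag_of_isLittleO {E F : Type*} [NormedAddCommGroup E] [NormedSpace ℝ E]
    [NormedAddCommGroup F] [NormedSpace ℝ F] {f g P : E → F} (hf : ContDiffAt ℝ ∞ f 0)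
    (hg : ContDiffAt ℝ ∞ g 0) {k : ℕ} (hP : ContDiff ℝ ∞ P) (hom : IsPosHomogeneous k P)
    (h : (fun z => f z - g z - P z) =o[𝓝 0] fun z => ‖z‖ ^ k) (z : E) :
    iteratedFDeriv ℝ k f 0 (fun _ => z) =
      iteratedFDeriv ℝ k g 0 (fun _ => z) + (k.factorial : ℝ) • P z := by
  have le : ((k : ℕ) : WithTop ℕ∞) ≤ ∞ := by exact_mod_cast le_top
  have deriv_eq := (isLittleO_norm_pow_iff_iteratedFDeriv_eq_zero
    (((hf.sub hg).sub hP.contDiffAt).of_le le)).1 h k le_rfl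
  rw [fun_iteratedFDeriv_sub_apply ((hf.sub hg).of_le le) (hP.contDiffAt.of_le le),
    fun_iteratedFDeriv_sub_apply (hf.of_le le) (hg.of_le le), sub_sub, sub_eq_zero] at deriv_eq
  rw [deriv_eq, hom.eq_diagonal hP z, add_apply, smul_apply, smul_smul,
    mul_inv_cancel₀ (by positivity), one_smul]

theorem IsAdm.gen_sub_id {K : Phase → ℝ} (hK : IsAdm K) :
    (fun z => gen K z - z) =o[𝓝 0] fun z => ‖z‖ :=
  isLittleO_sub_id_of_hasFDerivAt hK.hasStrictFDerivAt_gen.hasFDerivAt hK.gen_zero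

theorem comp_gen_sub_comp_gen {h h' K K' : Phase → ℝ} (hh : IsAdm h) (hh' : IsAdm h')
    (hK : IsAdm K) (hK' : IsAdm K') {k : ℕ} {δh δK : Phase → ℝ} (dh : δh ∈ homPoly (k + 1))
    (dK : δK ∈ homPoly (k + 1))
    (eh : (fun z => h' z - h z - δh z) =o[𝓝 0] fun z => ‖z‖ ^ (k + 1))
    (eK : (fun z => K' z - K z - δK z) =o[𝓝 0] fun z => ‖z‖ ^ (k + 1)) (T : Phase →L[ℝ] Phase) :
    (fun z => gen h' (T (gen K' z)) - gen h (T (gen K z)) -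
      (hamVF δh (T z) + T (hamVF δK z))) =o[𝓝 0] fun z => ‖z‖ ^ k := by
  have to_zero {K : Phase → ℝ} (hK : IsAdm K) : Tendsto (fun z => T (gen K z)) (𝓝 0) (𝓝 0) :=
    Tendsto.comp (by simpa only [map_zero] using T.continuous.tendsto 0) hK.isSympGerm_gen.tendsto
  have inner_isBigO : (fun z => T (gen K' z)) =O[𝓝 0] fun z => ‖z‖ :=
    (T.isBigO_comp (gen K') _).trans ((hK'.gen_sub_id.isBigO.add
      (isBigO_refl (fun z : Phase => z) (𝓝 0)).norm_right).congr_left fun z => by simp)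
  have vary_outer : (fun z => gen h' (T (gen K' z)) - gen h (T (gen K' z)) -
      hamVF δh (T (gen K' z))) =o[𝓝 0] fun z => ‖z‖ ^ k :=
    ((gen_sub_gen hh hh' dh.1 dh.2 eh).comp_tendsto (to_zero hK')).trans_isBigO
      (inner_isBigO.norm_left.pow k)
  have vary_argument : (fun z => hamVF δh (T (gen K' z)) - hamVF δh (T z))
      =o[𝓝 0] fun z => ‖z‖ ^ k :=
    ((dh.2.hamVF dh.1).comp_clm T).comp_sub_isLittleO
      ((contDiff_hamVF dh.1).comp T.contDiff) hK'.gen_sub_id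
  have vary_inner : (fun z => T (gen K' z) - T (gen K z) - T (hamVF δK z))
      =o[𝓝 0] fun z => ‖z‖ ^ k :=
    ((T.isBigO_comp _ _).trans_isLittleO (gen_sub_gen hK hK' dK.1 dK.2 eK)).congr_left
      fun z => by simp only [map_sub]
  have inner_diff : (fun z => T (gen K' z) - T (gen K z)) =O[𝓝 0] fun z => ‖z‖ ^ k :=
    (vary_inner.isBigO.add ((T.isBigO_comp (hamVF δK) (𝓝 0)).trans
      ((dK.2.hamVF dK.1).isBigO (contDiff_hamVF dK.1)))).congr_left fun z => by abel
  have outer_near_id : (fun z => gen h (T (gen K' z)) - gen h (T (gen K z)) -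
      (T (gen K' z) - T (gen K z))) =o[𝓝 0] fun z => ‖z‖ ^ k :=
    (hh.hasStrictFDerivAt_gen.isLittleO.comp_tendsto
      ((to_zero hK').prodMk_nhds (to_zero hK))).trans_isBigO inner_diff
  refine (((vary_outer.add vary_argument).add vary_inner).add outer_near_id).congr_left fun z => ?_
  abel

theorem polySum_add_smul_sub {V : ℕ → Submodule ℝ (Phase → ℝ)} (hV : ∀ k, V k ≤ homPoly k) {n : ℕ}
    (c d : (j : Fin n) → V (j + 3)) (j : Fin n) (hd : ∀ i < j, d i = 0) (s : ℝ) :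
    (fun z => polySum V n (c + s • d) z - polySum V n c z - (s • (d j : Phase → ℝ)) z)
      =o[𝓝 0] fun z => ‖z‖ ^ ((j : ℕ) + 3) := by
  have diff_eq (z : Phase) : polySum V n (c + s • d) z - polySum V n c z -
      (s • (d j : Phase → ℝ)) z = ∑ i ∈ Finset.univ.erase j, s • (d i : Phase → ℝ) z := by
    rw [map_add, map_smul, Pi.add_apply, add_sub_cancel_left, Pi.smul_apply, Pi.smul_apply,
      polySum_apply, ← Finset.smul_sum, ← smul_sub, ← Finset.add_sum_erase _ _ (Finset.mem_univ j),
      add_sub_cancel_left]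
  simp only [diff_eq]
  refine IsLittleO.fun_sum fun i hi => ?_
  rcases lt_or_gt_of_ne (Finset.ne_of_mem_erase hi) with below | above
  · simp only [hd i below, ZeroMemClass.coe_zero, Pi.zero_apply, smul_zero, isLittleO_zero]
  · exact (isLittleO_of_mem_homPoly (hV _ (d i).2) (by simpa using above)).const_smul_left s

theorem hamVF_smul {K : Phase → ℝ} (hK : Differentiable ℝ K) (s : ℝ) (z : Phase) :
    hamVF (s • K) z = s • hamVF K z := by
  rw [hamVF, fderiv_const_smul (hK z), map_smul, hamVF]

/-- The first variation of `germOf` at `t` along a pair of Hamiltonians. -/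
noncomputable def firstVariation {n : ℕ} (t : Params n) (H K : Phase → ℝ) (z : Phase) : Phase :=
  affMap t.base t.shear (hamVF H (quadMap t.quad z) + quadMap t.quad (hamVF K z))

theorem contDiff_firstVariation {n : ℕ} (t : Params n) {H K : Phase → ℝ} (hH : ContDiff ℝ ∞ H)
    (hK : ContDiff ℝ ∞ K) : ContDiff ℝ ∞ (firstVariation t H K) :=
  (affMap t.base t.shear).contDiff.comp (((contDiff_hamVF hH).comp (quadMap t.quad).contDiff).add
    ((quadMap t.quad).contDiff.comp (contDiff_hamVF hK)))

theorem isPosHomogeneous_firstVariation {n k : ℕ} (t : Params n) {H K : Phase → ℝ}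
    (hH : H ∈ homPoly (k + 1)) (hK : K ∈ homPoly (k + 1)) :
    IsPosHomogeneous k (firstVariation t H K) := by
  intro s hs z
  rw [firstVariation, firstVariation, ← map_smul, smul_add]
  exact congrArg _ (congrArg₂ (· + ·) ((hH.2.hamVF hH.1).comp_clm (quadMap t.quad) s hs z)
    ((hK.2.hamVF hK.1).clm_comp (quadMap t.quad) s hs z))

theorem germOf_add_smul_sub {n : ℕ} (t τ : Params n) (hbase : τ.base = 0) (hshear : τ.shear = 0)
    (hquad : τ.quad = 0) (j : Fin n) (hlag : ∀ i < j, τ.lag i = 0) (hret : ∀ i < j, τ.ret i = 0)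
    (s : ℝ) :
    (fun z => germOf (t + s • τ) z - germOf t z - (s • firstVariation t (τ.lag j) (τ.ret j)) z)
      =o[𝓝 0] fun z => ‖z‖ ^ ((j : ℕ) + 2) := by
  have dlag := lagPoly_le _ (τ.lag j).2
  have dret := retPoly_le _ (τ.ret j).2
  have inner := comp_gen_sub_comp_gen (isAdm_polySum lagPoly_le t.lag)
    (isAdm_polySum lagPoly_le (t.lag + s • τ.lag)) (isAdm_polySum retPoly_le t.ret)
    (isAdm_polySum retPoly_le (t.ret + s • τ.ret)) (Submodule.smul_mem _ s dlag)
    (Submodule.smul_mem _ s dret) (polySum_add_smul_sub lagPoly_le _ _ j hlag s)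
    (polySum_add_smul_sub retPoly_le _ _ j hret s) (quadMap t.quad)
  refine (((affMap t.base t.shear).isBigO_comp _ _).trans_isLittleO inner).congr_left fun z => ?_
  simp only [germOf, firstVariation, Function.comp, Params.base, Params.shear, Params.quad,
    Params.lag, Params.ret, Prod.fst_add, Prod.snd_add, Prod.smul_fst, Prod.smul_snd, hbase, hshear,
    hquad, smul_zero, add_zero, Pi.smul_apply, map_add, map_sub, map_smul, smul_add,
    hamVF_smul (dlag.1.differentiable (by simp)), hamVF_smul (dret.1.differentiable (by simp))]

/-- Every linear functional of the jet of `germOf` which is affine along the line `t + ℝ τ` is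
constant on it. This both excludes that `t` and `t + τ` have the same jet and that `τ` is in the
kernel of the derivative of the jet at `t`. -/
def JetStationary {n : ℕ} (t τ : Params n) : Prop :=
  ∀ (L : JetSpace (n + 1) →L[ℝ] Phase) (b : Phase),
    (∀ s : ℝ, L (jet (n + 1) (germOf (t + s • τ))) = L (jet (n + 1) (germOf t)) + s • b) → b = 0

/-- The diagonal of the derivative of order `k` at the vector `v`, as a linear map on jets. -/
noncomputable def jetDiag {l : ℕ} (k : Fin (l + 1)) (v : Phase) : JetSpace l →L[ℝ] Phase :=
  ContinuousMultilinearMap.apply ℝ (fun _ : Fin (k : ℕ) => Phase) Phase (fun _ => v) ∘L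
    ContinuousLinearMap.proj k

theorem jetDiag_jet {l : ℕ} (k : Fin (l + 1)) (v : Phase) (S : Phase → Phase) :
    jetDiag k v (jet l S) = iteratedFDeriv ℝ (k : ℕ) S 0 fun _ => v := rfl

theorem jetDiag_one_jet_germOf {n : ℕ} (t : Params n) (v : Phase) :
    jetDiag 1 v (jet (n + 1) (germOf t)) = affMap t.base t.shear (quadMap t.quad v) := by
  rw [jetDiag_jet, Fin.val_one, iteratedFDeriv_one_apply,
    (hasStrictFDerivAt_germOf t).hasFDerivAt.fderiv, ContinuousLinearMap.comp_apply]

theorem symm_coeff_eq_zero {m : Fin 3 → ℝ}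
    (h : ∀ v : Plane, (![m 0 * v 0 + m 1 * v 1, m 1 * v 0 + m 2 * v 1] : Plane) = 0) : m = 0 := by
  have row_zero := h (Pi.single 0 1)
  have row_one := h (Pi.single 1 1)
  simp only [Pi.single_eq_same, mul_one, ne_eq, one_ne_zero, not_false_eq_true,
    Pi.single_eq_of_ne, mul_zero, add_zero, Matrix.cons_eq_zero_iff, zero_ne_one, zero_add]
    at row_zero row_one
  ext i
  fin_cases i
  exacts [row_zero.1, row_zero.2.1, row_one.2.1]

namespace JetStationary

variable {n : ℕ} {t τ : Params n}

theorem linear_eq_zero (H : JetStationary t τ) (B : Phase →L[ℝ] Phase) (v b : Phase)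
    (h : ∀ s : ℝ, B (affMap (t.base + s • τ.base) (t.shear + s • τ.shear)
      (quadMap (t.quad + s • τ.quad) v)) = B (affMap t.base t.shear (quadMap t.quad v)) + s • b) :
    b = 0 := by
  refine H (B ∘L jetDiag 1 v) b fun s => ?_
  rw [ContinuousLinearMap.comp_apply, ContinuousLinearMap.comp_apply, jetDiag_one_jet_germOf,
    jetDiag_one_jet_germOf]
  exact h s

theorem linear_fst_eq_zero (H : JetStationary t τ) (v : Phase) (b : Plane)
    (h : ∀ s : ℝ, (affMap (t.base + s • τ.base) (t.shear + s • τ.shear)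
      (quadMap (t.quad + s • τ.quad) v)).1 =
        (affMap t.base t.shear (quadMap t.quad v)).1 + s • b) : b = 0 :=
  congrArg Prod.fst (H.linear_eq_zero (ContinuousLinearMap.inl ℝ Plane Plane ∘L
    ContinuousLinearMap.fst ℝ Plane Plane) v (b, 0) fun s => Prod.ext (h s) (by simp))

theorem base_eq_zero (H : JetStationary t τ) : τ.base = 0 := by
  have column_zero := H.linear_fst_eq_zero (0, Pi.single 0 1) ![-τ.base 0, -τ.base 2] fun s => by
    ext i
    fin_cases i <;> simp [affMap_apply, quadMap_apply] <;> ring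
  have column_one := H.linear_fst_eq_zero (0, Pi.single 1 1) ![-τ.base 1, -τ.base 3] fun s => by
    ext i
    fin_cases i <;> simp [affMap_apply, quadMap_apply] <;> ring
  simp only [Matrix.cons_eq_zero_iff, neg_eq_zero] at column_zero column_one
  ext i
  fin_cases i
  exacts [column_zero.1, column_one.1, column_zero.2.1, column_one.2.1]

theorem quad_eq_zero (ht : detMap t.base ≠ 0) (H : JetStationary t τ) : τ.quad = 0 := by
  refine symm_coeff_eq_zero fun v => ?_
  set y : Plane := ![τ.quad 0 * v 0 + τ.quad 1 * v 1, τ.quad 1 * v 0 + τ.quad 2 * v 1] with hy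
  have fst_zero := H.linear_fst_eq_zero (v, 0) (affMap t.base 0 (-y, 0)).1 fun s => by
    rw [H.base_eq_zero]
    ext i
    fin_cases i <;> simp [affMap_apply, quadMap_apply, hy] <;> ring
  have image_zero : affMap t.base 0 (-y, 0) = 0 := by
    refine Prod.ext fst_zero (funext fun i => ?_)
    fin_cases i <;> simp [affMap_apply]
  exact neg_eq_zero.1 (congrArg Prod.fst
    ((map_eq_zero_iff _ (isSympLin_affMap ht 0).injective).1 image_zero))

theorem shear_eq_zero (ht : detMap t.base ≠ 0) (H : JetStationary t τ) : τ.shear = 0 := by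
  refine symm_coeff_eq_zero fun v => ?_
  set y : Plane := ![τ.shear 0 * v 0 + τ.shear 1 * v 1, τ.shear 1 * v 0 + τ.shear 2 * v 1] with hy
  have image_zero := H.linear_eq_zero (ContinuousLinearMap.id ℝ Phase) (0, -v)
    (affMap t.base 0 (0, y)) fun s => by
      rw [H.base_eq_zero, H.quad_eq_zero ht]
      ext i <;> fin_cases i <;> simp [affMap_apply, quadMap_apply, hy] <;> ring
  exact congrArg Prod.snd ((map_eq_zero_iff _ (isSympLin_affMap ht 0).injective).1 image_zero)

theorem firstVariation_eq_zero (ht : detMap t.base ≠ 0) (H : JetStationary t τ) (j : Fin n)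
    (hlag : ∀ i < j, τ.lag i = 0) (hret : ∀ i < j, τ.ret i = 0) (z : Phase) :
    firstVariation t (τ.lag j) (τ.ret j) z = 0 := by
  have dlag := lagPoly_le _ (τ.lag j).2
  have dret := retPoly_le _ (τ.ret j).2
  have smooth := contDiff_firstVariation t dlag.1 dret.1
  have hom := isPosHomogeneous_firstVariation t dlag dret
  have coeff_zero := H (jetDiag ⟨(j : ℕ) + 2, by omega⟩ z)
    ((((j : ℕ) + 2).factorial : ℝ) • firstVariation t (τ.lag j) (τ.ret j) z) fun s => by
      rw [jetDiag_jet, jetDiag_jet, smul_comm]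
      exact iteratedFDeriv_diag_of_isLittleO (contDiffAt_germOf _) (contDiffAt_germOf t)
        (smooth.const_smul s) (fun r hr z =>
          (congrArg (s • ·) (hom r hr z)).trans (smul_comm _ _ _))
        (germOf_add_smul_sub t τ H.base_eq_zero (H.shear_eq_zero ht) (H.quad_eq_zero ht) j
          hlag hret s) z
  exact (smul_eq_zero.1 coeff_zero).resolve_left (by positivity)

theorem hamiltonians_eq_zero (ht : t ∈ paramSet n) (H : JetStationary t τ) (j : Fin n) :
    τ.lag j = 0 ∧ τ.ret j = 0 := by
  induction j using WellFoundedLT.induction with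
  | _ j ih =>
    obtain ⟨hdet, quad_zero_mul_one, quad_det⟩ := ht
    have quad_two : t.quad 2 ≠ 0 := fun h => by
      rw [h, mul_zero, zero_sub, Left.neg_pos_iff] at quad_det
      exact quad_det.not_ge (sq_nonneg _)
    have variation_zero := H.firstVariation_eq_zero hdet j (fun i hi => (ih i hi).1)
      fun i hi => (ih i hi).2
    have both_zero := lagPoly_retPoly_transverse (left_ne_zero_of_mul quad_zero_mul_one.ne')
      quad_two (τ.lag j).2 (τ.ret j).2 fun z =>
        (map_eq_zero_iff _ (isSympLin_affMap hdet t.shear).injective).1 (variation_zero z)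
    exact ⟨Subtype.ext both_zero.1, Subtype.ext both_zero.2⟩

theorem eq_zero (ht : t ∈ paramSet n) (H : JetStationary t τ) : τ = 0 :=
  Prod.ext H.base_eq_zero (Prod.ext (H.shear_eq_zero ht.1) (Prod.ext (H.quad_eq_zero ht.1)
    (Prod.ext (funext fun j => (H.hamiltonians_eq_zero ht j).1)
      (funext fun j => (H.hamiltonians_eq_zero ht j).2))))

end JetStationary

/-! ### Reduction to normal form -/

/-- `D M D` for a diagonal matrix `D` and a symmetric matrix `M`, encoded as in `quadMap`. -/
def conjDiag (D : Fin 2 → ℝ) (M : Fin 3 → ℝ) : Fin 3 → ℝ :=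
  ![D 0 ^ 2 * M 0, D 0 * D 1 * M 1, D 1 ^ 2 * M 2]

theorem conjDiag_smul (D : Fin 2 → ℝ) (c : ℝ) (M : Fin 3 → ℝ) :
    conjDiag D (c • M) = c • conjDiag D M := by
  ext i
  fin_cases i <;> simp [conjDiag] <;> ring

theorem conjDiag_mem_quadSet {D : Fin 2 → ℝ} (hD : ∀ i, 0 < D i) {M : Fin 3 → ℝ}
    (hM : M ∈ quadSet) : conjDiag D M ∈ quadSet := by
  have D_zero := hD 0
  have D_one := hD 1
  obtain ⟨hM₁, hM₂⟩ := hM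
  constructor
  · calc 0 < D 0 ^ 3 * D 1 * (M 0 * M 1) := by positivity
      _ = D 0 ^ 2 * M 0 * (D 0 * D 1 * M 1) := by ring
  · calc 0 < (D 0 * D 1) ^ 2 * (M 0 * M 2 - M 1 ^ 2) := by positivity
      _ = D 0 ^ 2 * M 0 * (D 1 ^ 2 * M 2) - (D 0 * D 1 * M 1) ^ 2 := by ring

theorem smul_mem_quadSet {ε : ℝ} (hε : ε * ε = 1) {M : Fin 3 → ℝ} (hM : M ∈ quadSet) :
    ε • M ∈ quadSet := by
  have ε_sq : ε ^ 2 = 1 := by rw [sq, hε]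
  constructor
  · simpa [mul_mul_mul_comm, hε] using hM.1
  · simpa [mul_mul_mul_comm, mul_pow, hε, ε_sq] using hM.2

theorem diagMap_apply_inv {D : Fin 2 → ℝ} (hD : ∀ i, D i ≠ 0) (z : Phase) :
    diagMap D (diagMap D⁻¹ z) = z := by
  ext i <;> simp [diagMap_apply, hD]

theorem diagMap_inv_apply {D : Fin 2 → ℝ} (hD : ∀ i, D i ≠ 0) (z : Phase) :
    diagMap D⁻¹ (diagMap D z) = z := by
  simpa only [inv_inv] using diagMap_apply_inv (D := D⁻¹) (fun i => inv_ne_zero (hD i)) z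

theorem diagMap_quadMap_diagMap {D : Fin 2 → ℝ} (hD : ∀ i, D i ≠ 0) (M : Fin 3 → ℝ) (z : Phase) :
    diagMap D (quadMap M (diagMap D z)) = quadMap (conjDiag D M) z := by
  have D_zero := hD 0
  have D_one := hD 1
  ext i <;> fin_cases i <;> simp [diagMap_apply, quadMap_apply, conjDiag, D_zero, D_one] <;>
    field_simp

theorem isLagrangianEquivalence_diagMap {D : Fin 2 → ℝ} (hD : ∀ i, D i ≠ 0) :
    IsLagrangianEquivalence (diagMap D) :=
  (isSympLin_diagMap hD).isLagrangianEquivalence (diagMap_fst_zero D)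

theorem IsReticular.exists_eq_diagMap_comp {φ : Phase → Phase} (hφ : IsReticular φ) :
    ∃ (D : Fin 2 → ℝ) (φ' : Phase → Phase), (∀ i, 0 < D i) ∧ IsReticular φ' ∧
      fderiv ℝ φ' 0 = ContinuousLinearMap.id ℝ Phase ∧ φ = diagMap D ∘ φ' := by
  obtain ⟨D, hD, deriv_eq⟩ :=
    exists_eq_diagMap hφ.1.isSympLin_fderiv fun _ _ => hφ.fderiv_mem_cornerL
  have hD' (i) : D i ≠ 0 := (hD i).ne'
  refine ⟨D, diagMap D⁻¹ ∘ φ, hD, (isReticular_diagMap fun i => inv_pos.2 (hD i)).comp hφ, ?_,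
    funext fun z => (diagMap_apply_inv hD' (φ z)).symm⟩
  rw [((diagMap D⁻¹).hasFDerivAt.comp (0 : Phase) hφ.1.hasFDerivAt).fderiv, deriv_eq]
  exact ContinuousLinearMap.ext (diagMap_inv_apply hD')

theorem IsLagrangianEquivalence.exists_eq_affMap_comp {Θ : Phase → Phase}
    (hΘ : IsLagrangianEquivalence Θ) :
    ∃ (g : Fin 4 → ℝ) (w : Fin 3 → ℝ) (Θ' : Phase → Phase), detMap g ≠ 0 ∧
      IsLagrangianEquivalence Θ' ∧ fderiv ℝ Θ' 0 = ContinuousLinearMap.id ℝ Phase ∧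
      Θ = affMap g w ∘ Θ' := by
  obtain ⟨g, w, hg, deriv_eq⟩ := exists_eq_affMap hΘ.1.isSympLin_fderiv hΘ.fderiv_fst
  obtain ⟨T, hT, left_inv, right_inv⟩ := (isSympLin_affMap hg w).exists_inverse
  have hT_fst := fst_inverse_apply_eq_zero (isSympLin_affMap hg w) right_inv (affMap_fst_zero g w)
  refine ⟨g, w, T ∘ Θ, hg, (hT.isLagrangianEquivalence hT_fst).comp hΘ, ?_,
    funext fun z => (right_inv (Θ z)).symm⟩
  rw [(T.hasFDerivAt.comp (0 : Phase) hΘ.1.hasFDerivAt).fderiv, deriv_eq]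
  exact ContinuousLinearMap.ext left_inv

theorem jet_comp_eq_jet_germOf {n : ℕ} {Θ φ : Phase → Phase} (hΘ : IsSympGerm Θ)
    (hφ : IsSympGerm φ) (t : Params n)
    (eΘ : (fun z => Θ z - gen (polySum lagPoly n t.lag) z) =o[𝓝 0] fun z => ‖z‖ ^ (n + 1))
    (eφ : (fun z => φ z - gen (polySum retPoly n t.ret) z) =o[𝓝 0] fun z => ‖z‖ ^ (n + 1)) :
    jet (n + 1) (affMap t.base t.shear ∘ Θ ∘ quadMap t.quad ∘ φ) = jet (n + 1) (germOf t) := by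
  have lag_adm := isAdm_polySum lagPoly_le t.lag
  have inner_symp : IsSympGerm (quadMap t.quad ∘ φ) := (isSympLin_quadMap _).isSympGerm.comp hφ
  have gen_inner_symp : IsSympGerm (quadMap t.quad ∘ gen (polySum retPoly n t.ret)) :=
    (isSympLin_quadMap _).isSympGerm.comp (isAdm_polySum retPoly_le _).isSympGerm_gen
  have inner_isBigO : (quadMap t.quad ∘ φ) =O[𝓝 0] fun z => ‖z‖ := by
    simpa only [inner_symp.1.1, sub_zero] using inner_symp.hasFDerivAt.isBigO_sub.norm_right
  have vary_outer : (fun z => Θ (quadMap t.quad (φ z)) -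
      gen (polySum lagPoly n t.lag) (quadMap t.quad (φ z))) =o[𝓝 0] fun z => ‖z‖ ^ (n + 1) :=
    (eΘ.comp_tendsto inner_symp.tendsto).trans_isBigO (inner_isBigO.norm_left.pow (n + 1))
  have vary_inner : (fun z => quadMap t.quad (φ z) -
      quadMap t.quad (gen (polySum retPoly n t.ret) z)) =o[𝓝 0] fun z => ‖z‖ ^ (n + 1) :=
    (((quadMap t.quad).isBigO_comp _ _).trans_isLittleO eφ).congr_left fun z => map_sub _ _ _
  have vary_argument : (fun z => gen (polySum lagPoly n t.lag) (quadMap t.quad (φ z)) -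
      gen (polySum lagPoly n t.lag) (quadMap t.quad (gen (polySum retPoly n t.ret) z)))
      =o[𝓝 0] fun z => ‖z‖ ^ (n + 1) :=
    (lag_adm.hasStrictFDerivAt_gen.isBigO_sub.comp_tendsto
      (inner_symp.tendsto.prodMk_nhds gen_inner_symp.tendsto)).trans_isLittleO vary_inner
  refine (jet_eq_iff ((affMap t.base t.shear).contDiff.contDiffAt.comp (0 : Phase)
    (hΘ.comp inner_symp).1.2.self_of_nhds) (contDiffAt_germOf t)).2 ?_
  refine (((affMap t.base t.shear).isBigO_comp _ _).trans_isLittleO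
    (vary_outer.add vary_argument)).congr_left fun z => ?_
  simp only [germOf, Function.comp, sub_add_sub_cancel, map_sub]

theorem exists_params_of_comp {Θ φ : Phase → Phase} {M : Fin 3 → ℝ}
    (hΘ : IsLagrangianEquivalence Θ) (hφ : IsReticular φ) (hM : M ∈ quadSet) (n : ℕ) :
    ∃ t ∈ paramSet n, jet (n + 1) (Θ ∘ quadMap M ∘ φ) = jet (n + 1) (germOf t) := by
  obtain ⟨D, φ', hD, hφ', fderiv_φ', rfl⟩ := hφ.exists_eq_diagMap_comp
  have hD' (i) : D i ≠ 0 := (hD i).ne'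
  obtain ⟨g, w, Θ', hg, hΘ', fderiv_Θ', Θ_diag_eq⟩ := (hΘ.comp
    (isLagrangianEquivalence_diagMap (D := D⁻¹) fun i => inv_ne_zero (hD' i))).exists_eq_affMap_comp
  obtain ⟨K, hK⟩ := exists_gen_approx_of_reticular hφ' fderiv_φ' n
  obtain ⟨H, hH⟩ := exists_gen_approx_of_lagrangian hΘ' fderiv_Θ' n
  refine ⟨(g, w, conjDiag D M, H, K), ⟨hg, conjDiag_mem_quadSet hD hM⟩, ?_⟩
  rw [← jet_comp_eq_jet_germOf hΘ'.1 hφ'.1 (g, w, conjDiag D M, H, K) hH hK]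
  congr 1
  funext z
  calc Θ (quadMap M (diagMap D (φ' z)))
      = (Θ ∘ diagMap D⁻¹) (quadMap (conjDiag D M) (φ' z)) := by
        rw [← diagMap_quadMap_diagMap hD', Function.comp, diagMap_inv_apply hD']
    _ = affMap g w (Θ' (quadMap (conjDiag D M) (φ' z))) := by rw [Θ_diag_eq]; rfl

theorem isSympLin_smul_id {ε : ℝ} (hε : ε * ε = 1) :
    IsSympLin (ε • ContinuousLinearMap.id ℝ Phase) := by
  intro u v
  simp only [omega_eq, smul_apply, ContinuousLinearMap.id_apply, Prod.smul_fst, Prod.smul_snd,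
    Pi.smul_apply, smul_eq_mul]
  linear_combination (u.1 0 * v.2 0 - u.2 0 * v.1 0 + (u.1 1 * v.2 1 - u.2 1 * v.1 1)) * hε

theorem isLagrangianEquivalence_smul_id {ε : ℝ} (hε : ε * ε = 1) :
    IsLagrangianEquivalence (ε • ContinuousLinearMap.id ℝ Phase) :=
  (isSympLin_smul_id hε).isLagrangianEquivalence fun _ => smul_zero ε

/-- For a sign `ε`, an extension of the embedding with generating family
`ε (½ ⟨x, M x⟩ + ⟨q, x⟩)`. -/
noncomputable def signedQuad (ε : ℝ) (M : Fin 3 → ℝ) : Phase →L[ℝ] Phase :=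
  (ε • ContinuousLinearMap.id ℝ Phase) ∘L quadMap (ε • M)

theorem isSympLin_signedQuad {ε : ℝ} (hε : ε * ε = 1) (M : Fin 3 → ℝ) :
    IsSympLin (signedQuad ε M) :=
  (isSympLin_smul_id hε).comp (isSympLin_quadMap _)

theorem exists_params_of_mem_lagrangianClass {X S : Phase → Phase} {ε : ℝ} (hε : ε * ε = 1)
    {M : Fin 3 → ℝ} (hM : M ∈ quadSet) (hX : IsSympGerm X)
    (h : ∀ σ, map X (𝓝[cornerL σ] 0) = map (signedQuad ε M) (𝓝[cornerL σ] 0))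
    (hS : S ∈ lagrangianClass X) (n : ℕ) :
    ∃ t ∈ paramSet n, jet (n + 1) S = jet (n + 1) (germOf t) := by
  obtain ⟨-, Θ, φ, hΘ, hφ, Θ_comp_eq⟩ := hS
  obtain ⟨χ, hχ, X_eq⟩ := exists_reticular_factor hX (isSympLin_signedQuad hε M).isSympGerm h
  obtain ⟨ψ, hψ, -, right_inv⟩ := hφ.exists_inverse
  obtain ⟨t, ht, jet_eq⟩ := exists_params_of_comp (hΘ.comp (isLagrangianEquivalence_smul_id hε))
    (hχ.comp hψ) (smul_mem_quadSet hε hM) n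
  refine ⟨t, ht, jet_eq ▸ jet_congr ?_⟩
  filter_upwards [right_inv, hψ.1.tendsto.eventually Θ_comp_eq, hψ.1.tendsto.eventually X_eq]
    with z φ_ψ Θ_X X_χ
  calc S z = S (φ (ψ z)) := by rw [φ_ψ]
    _ = Θ (X (ψ z)) := Θ_X.symm
    _ = Θ (signedQuad ε M (χ (ψ z))) := by rw [X_χ]; rfl

theorem germOf_mem_lagrangianClass {X : Phase → Phase} {ε : ℝ} (hε : ε * ε = 1)
    {M : Fin 3 → ℝ} {D : Fin 2 → ℝ} (hD : ∀ i, 0 < D i) (hX : IsSympGerm X)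
    (h : ∀ σ, map X (𝓝[cornerL σ] 0) = map (signedQuad ε M) (𝓝[cornerL σ] 0))
    {n : ℕ} {t : Params n} (ht : detMap t.base ≠ 0) (quad_eq : t.quad = conjDiag D (ε • M)) :
    germOf t ∈ lagrangianClass X := by
  obtain ⟨χ, hχ, X_eq⟩ := exists_reticular_factor hX (isSympLin_signedQuad hε M).isSympGerm h
  have hD' (i) : D i ≠ 0 := (hD i).ne'
  have ret := (isReticular_diagMap hD).comp
    ((isAdm_polySum retPoly_le t.ret).isReticular_gen (vanishesOnCorners_polySum _))
  have lag := ((isSympLin_affMap ht t.shear).isLagrangianEquivalence (affMap_fst_zero _ _)).comp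
    ((isAdm_polySum lagPoly_le t.lag).isLagrangianEquivalence_gen (affineInP_polySum _))
  obtain ⟨ψ, hψ, -, right_inv⟩ := ret.exists_inverse
  refine ⟨isSympGerm_germOf ht, _, ψ ∘ χ, lag.comp ((isLagrangianEquivalence_diagMap hD').comp
    (isLagrangianEquivalence_smul_id hε)), hψ.comp hχ, ?_⟩
  filter_upwards [X_eq, hχ.1.tendsto.eventually right_inv] with z X_χ ret_ψ
  simp only [germOf, Function.comp] at X_χ ret_ψ ⊢
  rw [X_χ, quad_eq, ← diagMap_quadMap_diagMap hD', ret_ψ]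
  simp only [signedQuad, ContinuousLinearMap.comp_apply, smul_apply, Pi.smul_apply,
    ContinuousLinearMap.id_apply, smul_smul, hε, one_smul]

/-- Entries of the Hessian of `x ↦ x₁² + x₁x₂ + a x₂²`, encoded as in `quadMap`. -/
def hessianB (a : ℝ) : Fin 3 → ℝ := ![2, 1, 2 * a]

theorem hessianB_mem_quadSet {a : ℝ} (ha : 1 / 4 < a) : hessianB a ∈ quadSet := by
  constructor
  · simp [hessianB]
  · simp only [hessianB, Matrix.cons_val]
    linarith

theorem exists_eq_conjDiag_hessianB {M : Fin 3 → ℝ} (hM : M ∈ quadSet) (hM₀ : 0 < M 0) :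
    ∃ a : ℝ, 1 / 4 < a ∧ ∃ D : Fin 2 → ℝ, (∀ i, 0 < D i) ∧ M = conjDiag D (hessianB a) := by
  obtain ⟨mul_pos, det_pos⟩ := hM
  have hM₁ : 0 < M 1 := pos_of_mul_pos_right mul_pos hM₀.le
  set d := √(M 0 / 2)
  have d_pos : 0 < d := Real.sqrt_pos.2 (by positivity)
  have d_sq : d ^ 2 = M 0 / 2 := Real.sq_sqrt (by positivity)
  refine ⟨M 0 * M 2 / (4 * M 1 ^ 2), ?_, ![d, M 1 / d], fun i => ?_, ?_⟩
  · rw [div_lt_div_iff₀ (by norm_num) (by positivity)]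
    linarith
  · fin_cases i
    exacts [d_pos, div_pos hM₁ d_pos]
  · ext i
    fin_cases i
    · simp [conjDiag, hessianB, d_sq]
    · simp [conjDiag, hessianB, mul_div_cancel₀, d_pos.ne']
    · simp [conjDiag, hessianB, div_pow, d_sq]
      field_simp
      norm_num

/-! ### The caustic-equivalence classes -/

theorem fderiv_familyB_apply (a : ℝ) (z v : Plane × Plane) : fderiv ℝ (familyB a) z v =
    (2 * z.1 0 + z.1 1 + z.2 0) * v.1 0 + (z.1 0 + 2 * a * z.1 1 + z.2 1) * v.1 1 +
      z.1 0 * v.2 0 + z.1 1 * v.2 1 := by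
  have x (i : Fin 2) := (ContinuousLinearMap.proj (R := ℝ) i ∘L
    ContinuousLinearMap.fst ℝ Plane Plane).hasFDerivAt (x := z)
  have q (i : Fin 2) := (ContinuousLinearMap.proj (R := ℝ) i ∘L
    ContinuousLinearMap.snd ℝ Plane Plane).hasFDerivAt (x := z)
  have h : HasFDerivAt (familyB a) _ z :=
    (((((x 0).pow 2).add ((x 0).mul (x 1))).add (((x 1).pow 2).const_mul a)).add
      ((q 0).mul (x 0))).add ((q 1).mul (x 1))
  rw [h.fderiv]
  simp
  ring

theorem conormal_familyB (a : ℝ) (z : Plane × Plane) : conormal (familyB a) z = z.swap := by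
  refine Prod.ext rfl (funext fun i => ?_)
  fin_cases i <;> simp [conormal, dQ, fderiv_familyB_apply]

theorem dX_familyB_swap_quadMap (a : ℝ) (i : Fin 2) (z : Phase) :
    dX (familyB a) i (quadMap (hessianB a) z).swap = -z.2 i := by
  fin_cases i <;> simp [dX, fderiv_familyB_apply, quadMap_apply, hessianB]

theorem preimage_swap_quadMap_critSet (a : ℝ) (σ : Set (Fin 2)) :
    (fun z => (quadMap (hessianB a) z).swap) ⁻¹' critSet (familyB a) σ = cornerL σ := by
  ext z
  simp only [critSet, cornerL, Set.mem_preimage, Set.mem_ofPred_eq, dX_familyB_swap_quadMap,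
    neg_eq_zero]
  exact and_congr_right fun _ => forall₂_congr fun _ _ => and_comm

theorem map_conormal_familyB (a : ℝ) (σ : Set (Fin 2)) :
    map (conormal (familyB a)) (𝓝[critSet (familyB a) σ] 0) =
      map (quadMap (hessianB a)) (𝓝[cornerL σ] 0) := by
  obtain ⟨e, he⟩ := (isSympLin_quadMap (hessianB a)).exists_equiv
  have map_swap : map (fun z => (quadMap (hessianB a) z).swap) (𝓝[cornerL σ] 0) =
      𝓝[critSet (familyB a) σ] 0 := by
    have map_homeomorph := (e.toHomeomorph.trans
      (Homeomorph.prodComm Plane Plane)).isOpenEmbedding.map_nhdsWithin_preimage_eq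
        (critSet (familyB a) σ) 0
    have coe_eq : ⇑(e.toHomeomorph.trans (Homeomorph.prodComm Plane Plane)) =
        fun z => (quadMap (hessianB a) z).swap := by rw [← he]; rfl
    have map_origin : (fun z => (quadMap (hessianB a) z).swap) 0 = 0 := by simp
    rwa [coe_eq, preimage_swap_quadMap_critSet, map_origin] at map_homeomorph
  rw [← map_swap, map_map]
  exact congrArg (map · _) (funext fun z => by simp [conormal_familyB])

/-- `(q, p) ↦ (q, -p)`, which turns the germs generated by `F` into those generated by `-F`. -/
def reflect (z : Phase) : Phase := (z.1, -z.2)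

theorem dX_neg (F : Plane × Plane → ℝ) (i : Fin 2) : dX (-F) i = -dX F i := by
  funext z
  simp [dX, fderiv_neg]

theorem conormal_neg (F : Plane × Plane → ℝ) : conormal (-F) = reflect ∘ conormal F := by
  funext z
  refine Prod.ext rfl (funext fun i => ?_)
  simp [conormal, reflect, dQ, fderiv_neg]

theorem critSet_neg (F : Plane × Plane → ℝ) (σ : Set (Fin 2)) : critSet (-F) σ = critSet F σ := by
  simp only [critSet, dX_neg, Pi.neg_apply, neg_eq_zero]

theorem map_reflect_cornerL (σ : Set (Fin 2)) :
    map reflect (𝓝[cornerL σ] 0) = 𝓝[cornerL σ] 0 := by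
  have map_homeomorph := ((Homeomorph.refl Plane).prodCongr
    (Homeomorph.neg Plane)).isOpenEmbedding.map_nhdsWithin_preimage_eq (cornerL σ) 0
  have coe_eq : ⇑((Homeomorph.refl Plane).prodCongr (Homeomorph.neg Plane)) = reflect := rfl
  have preimage_eq : reflect ⁻¹' cornerL σ = cornerL σ := by
    ext z
    simp [reflect, cornerL]
  have reflect_zero : reflect 0 = 0 := Prod.ext rfl neg_zero
  rwa [coe_eq, preimage_eq, reflect_zero] at map_homeomorph

theorem reflect_quadMap_reflect (M : Fin 3 → ℝ) :
    reflect ∘ quadMap M ∘ reflect = signedQuad (-1) M := by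
  funext z
  ext i <;> fin_cases i <;> simp [reflect, quadMap_apply, signedQuad] <;> ring

theorem IsGeneratingFamily.neg {F : Plane × Plane → ℝ} {S T : Phase → Phase}
    (h : IsGeneratingFamily F S)
    (hT : ∀ σ, map T (𝓝[cornerL σ] 0) = map reflect (map S (𝓝[cornerL σ] 0))) :
    IsGeneratingFamily (-F) T where
  smooth := ⟨neg_eq_zero.2 h.smooth.1, h.smooth.2.mono fun _ hz => hz.neg⟩
  critical := by rw [fderiv_neg, h.critical, neg_zero]
  nondegenerate := by
    convert h.nondegenerate.units_smul (Sum.elim (fun _ => 1) fun _ => -1) using 1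
    funext i
    rcases i with i | i
    · simp
    · simp [dX_neg, fderiv_neg, Units.smul_def]
  generates σ := by rw [hT, h.generates, conormal_neg, critSet_neg, map_map]

theorem map_eq_signedQuad_one {a : ℝ} {S : Phase → Phase}
    (h : IsGeneratingFamily (familyB a) S) (σ : Set (Fin 2)) :
    map S (𝓝[cornerL σ] 0) = map (signedQuad 1 (hessianB a)) (𝓝[cornerL σ] 0) := by
  have signedQuad_one : signedQuad 1 (hessianB a) = quadMap (hessianB a) := by
    rw [signedQuad, one_smul, one_smul, ContinuousLinearMap.id_comp]
  rw [h.generates, map_conormal_familyB, signedQuad_one]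

theorem map_reflect_eq_signedQuad_neg_one {a : ℝ} {S : Phase → Phase}
    (h : IsGeneratingFamily (familyB a) S) (σ : Set (Fin 2)) :
    map reflect (map S (𝓝[cornerL σ] 0)) =
      map (signedQuad (-1) (hessianB a)) (𝓝[cornerL σ] 0) := by
  rw [h.generates, map_conormal_familyB, ← reflect_quadMap_reflect, ← map_map, ← map_map,
    map_reflect_cornerL]

theorem map_eq_signedQuad_neg_one {a : ℝ} {F : Plane × Plane → ℝ} {S T : Phase → Phase}
    (hS : IsGeneratingFamily (familyB a) S) (hF : IsGeneratingFamily F S)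
    (hT : IsGeneratingFamily (-F) T) (σ : Set (Fin 2)) :
    map T (𝓝[cornerL σ] 0) = map (signedQuad (-1) (hessianB a)) (𝓝[cornerL σ] 0) := by
  rw [← map_reflect_eq_signedQuad_neg_one hS, hT.generates, hF.generates, conormal_neg,
    critSet_neg, map_map]

theorem jet_mem_sympJets_of_mem_causticClass {l : ℕ} {S S' : Phase → Phase}
    (h : S' ∈ causticClass S) : jet l S' ∈ sympJets l := by
  rcases h with h | ⟨_, _, _, _, _, h⟩ <;> exact ⟨S', h.1, rfl⟩

theorem weakCausticJets_subset_sympJets (l : ℕ) (S : ℝ → Phase → Phase) :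
    weakCausticJets l S ⊆ sympJets l :=
  Set.iUnion₂_subset fun _ _ => Set.image_subset_iff.2 fun _ =>
    jet_mem_sympJets_of_mem_causticClass

theorem exists_params_of_mem_causticClass {a : ℝ} (ha : 1 / 4 < a) {S S' : Phase → Phase}
    (hS : IsSympGerm S) (hF : IsGeneratingFamily (familyB a) S) (hS' : S' ∈ causticClass S)
    (n : ℕ) : ∃ t ∈ paramSet n, jet (n + 1) S' = jet (n + 1) (germOf t) := by
  have quad := hessianB_mem_quadSet ha
  rcases hS' with mem_class | ⟨F, T, hFS, hT, hFT, mem_class⟩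
  · exact exists_params_of_mem_lagrangianClass (one_mul 1) quad hS (map_eq_signedQuad_one hF)
      mem_class n
  · exact exists_params_of_mem_lagrangianClass (ε := -1) (by norm_num) quad hT
      (map_eq_signedQuad_neg_one hF hFS hFT) mem_class n

theorem exists_germOf_mem_causticClass {S : ℝ → Phase → Phase}
    (hS : ∀ a : ℝ, 1 / 4 < a → IsSympGerm (S a))
    (hF : ∀ a : ℝ, 1 / 4 < a → IsGeneratingFamily (familyB a) (S a))
    {n : ℕ} {t : Params n} (ht : t ∈ paramSet n) :
    ∃ a : ℝ, 1 / 4 < a ∧ germOf t ∈ causticClass (S a) := by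
  obtain ⟨hdet, hquad⟩ := ht
  rcases lt_or_gt_of_ne (left_ne_zero_of_mul hquad.1.ne') with neg | pos
  · have neg_sq : (-1 : ℝ) * -1 = 1 := by norm_num
    obtain ⟨a, ha, D, hD, quad_eq⟩ := exists_eq_conjDiag_hessianB
      (smul_mem_quadSet neg_sq hquad) (by simpa using neg)
    have symp := (isSympLin_signedQuad neg_sq (hessianB a)).isSympGerm
    refine ⟨a, ha, Or.inr ⟨familyB a, _, hF a ha, symp, (hF a ha).neg fun σ =>
      (map_reflect_eq_signedQuad_neg_one (hF a ha) σ).symm,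
      germOf_mem_lagrangianClass neg_sq hD symp (fun _ => rfl) hdet ?_⟩⟩
    rw [conjDiag_smul, ← quad_eq, smul_smul, neg_sq, one_smul]
  · obtain ⟨a, ha, D, hD, quad_eq⟩ := exists_eq_conjDiag_hessianB hquad pos
    exact ⟨a, ha, Or.inl (germOf_mem_lagrangianClass (one_mul 1) hD (hS a ha)
      (map_eq_signedQuad_one (hF a ha)) hdet (by rw [one_smul, quad_eq]))⟩

theorem weakCausticJets_eq_image (n : ℕ) {S : ℝ → Phase → Phase}
    (hS : ∀ a : ℝ, 1 / 4 < a → IsSympGerm (S a))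
    (hF : ∀ a : ℝ, 1 / 4 < a → IsGeneratingFamily (familyB a) (S a)) :
    weakCausticJets (n + 1) S = (fun t => jet (n + 1) (germOf t)) '' paramSet n := by
  refine Set.Subset.antisymm (Set.iUnion₂_subset fun a ha => ?_) ?_
  · rintro _ ⟨S', hS', rfl⟩
    obtain ⟨t, ht, jet_eq⟩ := exists_params_of_mem_causticClass ha (hS a ha) (hF a ha) hS' n
    exact ⟨t, ht, jet_eq.symm⟩
  · rintro _ ⟨t, ht, rfl⟩
    obtain ⟨a, ha, mem_class⟩ := exists_germOf_mem_causticClass hS hF ht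
    exact Set.mem_iUnion₂.2 ⟨a, ha, germOf t, mem_class, rfl⟩

/-! ### The immersion -/

theorem isImmersedManifoldIn_of_parametrization {V : Type*} [NormedAddCommGroup V]
    [NormedSpace ℝ V] {N W : Set V} (hNW : W ⊆ N) {d : ℕ} {U : Set (EuclideanSpace ℝ (Fin d))}
    (hU : IsOpen U) {Φ : EuclideanSpace ℝ (Fin d) → V} (smooth : ∀ x ∈ U, ContDiffAt ℝ ∞ Φ x)
    (inj : Set.InjOn Φ U) (immersion : ∀ x ∈ U, Function.Injective (fderiv ℝ Φ x))
    (image_eq : Φ '' U = W) : IsImmersedManifoldIn N W := by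
  let M : TopologicalSpace.Opens (EuclideanSpace ℝ (Fin d)) := ⟨U, hU⟩
  refine ⟨hNW, d, M, inferInstance, inferInstance, inferInstance, inferInstance, inferInstance,
    Φ ∘ Subtype.val, fun x => ?_, inj.injective, fun x => ?_, ?_⟩
  · exact (smooth x x.2).contMDiffAt.comp x contMDiff_subtype_val.contMDiffAt
  · have inclusion_immersion :
        Function.Injective (mfderiv (𝓡 d) (𝓡 d) (Subtype.val : M → _) x) :=
      (mdifferentiable_chart x).mfderiv_injective (mem_chart_source _ x)
    rw [mfderiv_comp x ((smooth x x.2).contMDiffAt.mdifferentiableAt (by simp))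
      ((contMDiff_subtype_val (n := ∞)).contMDiffAt.mdifferentiableAt (by simp)),
      mfderiv_eq_fderiv]
    exact (immersion x x.2).comp inclusion_immersion
  · rw [Set.range_comp, Subtype.range_val]
    exact image_eq

theorem injOn_jet_germOf (n : ℕ) :
    Set.InjOn (fun t : Params n => jet (n + 1) (germOf t)) (paramSet n) := by
  intro t ht t' _ (jet_eq : jet (n + 1) (germOf t) = jet (n + 1) (germOf t'))
  have stationary : JetStationary t (t' - t) := fun L b affine_in_s => by
    have at_one := affine_in_s 1
    rw [one_smul, one_smul, add_sub_cancel, ← jet_eq] at at_one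
    exact left_eq_add.1 at_one
  exact (sub_eq_zero.1 (stationary.eq_zero ht)).symm

section

variable {E : Type*} [NormedAddCommGroup E] [NormedSpace ℝ E] {n : ℕ} (e : E →ₗ[ℝ] Params n)

theorem jetStationary_of_fderiv_eq_zero {s v : E}
    (diff : DifferentiableAt ℝ (fun s => jet (n + 1) (germOf (e s))) s)
    (h : fderiv ℝ (fun s => jet (n + 1) (germOf (e s))) s v = 0) :
    JetStationary (e s) (e v) := by
  intro L b affine_in_r
  have along_line := L.hasFDerivAt.comp_hasDerivAt (0 : ℝ) (diff.hasFDerivAt.hasLineDerivAt v)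
  have affine_deriv : HasDerivAt (fun r : ℝ => L (jet (n + 1) (germOf (e s))) + r • b) b 0 := by
    simpa using ((hasDerivAt_id (0 : ℝ)).smul_const b).const_add
      (L (jet (n + 1) (germOf (e s))))
  have deriv_eq := affine_deriv.unique (along_line.congr_of_eventuallyEq
    (Eventually.of_forall fun r => by simp [← affine_in_r r]))
  rw [deriv_eq, h, map_zero]

theorem isOpen_preimage_paramSet [FiniteDimensional ℝ E] : IsOpen (e ⁻¹' paramSet n) := by
  have base : Continuous fun s => (e s).base :=
    (LinearMap.fst ℝ _ _ ∘ₗ e).continuous_of_finiteDimensional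
  have quad : Continuous fun s => (e s).quad :=
    (LinearMap.fst ℝ _ _ ∘ₗ LinearMap.snd ℝ _ _ ∘ₗ LinearMap.snd ℝ _ _ ∘ₗ
      e).continuous_of_finiteDimensional
  have det : Continuous detMap := by unfold detMap; fun_prop
  have quadSet_open : IsOpen quadSet :=
    (isOpen_lt (g := fun M : Fin 3 → ℝ => M 0 * M 1) continuous_const (by fun_prop)).inter
      (isOpen_lt (g := fun M : Fin 3 → ℝ => M 0 * M 2 - M 1 ^ 2) continuous_const (by fun_prop))
  exact (isOpen_ne_fun (det.comp base) continuous_const).inter (quadSet_open.preimage quad)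

end

end RetLag

theorem proposition4p1 (l : ℕ) (hl : 1 ≤ l) (S : ℝ → RetLag.Phase → RetLag.Phase)
    (hS : ∀ a : ℝ, 1 / 4 < a → RetLag.IsSympGerm (S a))
    (hF : ∀ a : ℝ, 1 / 4 < a → RetLag.IsGeneratingFamily (RetLag.familyB a) (S a)) :
    RetLag.IsImmersedManifoldIn (RetLag.sympJets l) (RetLag.weakCausticJets l S) := by
  obtain ⟨n, rfl⟩ := Nat.exists_eq_add_of_le' hl
  let e : EuclideanSpace ℝ (Fin (Module.finrank ℝ (RetLag.Params n))) ≃ₗ[ℝ] RetLag.Params n :=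
    LinearEquiv.ofFinrankEq _ _ finrank_euclideanSpace_fin
  have smooth (s) (hs : s ∈ e ⁻¹' RetLag.paramSet n) :=
    RetLag.contDiffAt_jet_germOf (l := n + 1) e.toLinearMap hs.1
  refine RetLag.isImmersedManifoldIn_of_parametrization
    (RetLag.weakCausticJets_subset_sympJets _ S)
    (RetLag.isOpen_preimage_paramSet e.toLinearMap) smooth
    ((RetLag.injOn_jet_germOf n).comp e.injective.injOn fun _ hs => hs)
    (fun s hs => (injective_iff_map_eq_zero _).2 fun v hv => ?_) ?_
  · have stationary := RetLag.jetStationary_of_fderiv_eq_zero e.toLinearMap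
      ((smooth s hs).differentiableAt (by simp)) hv
    exact e.map_eq_zero_iff.1 (stationary.eq_zero hs)
  · rw [RetLag.weakCausticJets_eq_image n hS hF]
    exact (Set.image_image (fun t => RetLag.jet (n + 1) (RetLag.germOf t)) e _).symm.trans
      (congrArg _ (Set.image_preimage_eq _ e.surjective))
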